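/- Let $\Omega\subseteq\mathbb R^n$ be open with $0\in\Omega$, and let $f\in C^4(\Omega;\mathbb R^n)$ be such that $\partial_t u+\partial_x f(u)=0$ is strictly hyperbolic: for all $u\in\Omega$, $Df(u)$ has $n$ real eigenvalues $\lambda_1(u)<\dots<\lambda_n(u)$. Assume that each characteristic field is either genuinely nonlinear or linearly degenerate on $\Omega$. Fix $k_1,\dots,k_n>0$. Let $r_j(u)$ be the $j$-th right eigenvector of $Df(u)$, normalized by $\nabla\lambda_j\cdot r_j=k_j$ if the $j$-th field is genuinely nonlinear, and by $|r_j|=1$ if it is linearly degenerate; in the latter case the orientation of $r_j$ near $0$ is fixed by requiring $r_j(u)\cdot e_j>0$, for a given unit $j$-th eigenvector $e_j$ of $Df(0)$. **Wave curves.** Let $\sigma\mapsto R_j(\sigma)(u)$ be the integral curve of $r_j$ through $u$. Let $\sigma\mapsto S_j(\sigma)(u)$ be the $j$-th Rankine–Hugoniot (shock) curve through $u$, tangent to $r_j(u)$ at $u$, parametrized so that $\frac{\partial}{\partial\sigma}\lambda_j(S_j(\sigma)(u))=k_j$ in the genuinely nonlinear case and by arc-length in the linearly degenerate case. Put $\psi_j(\sigma)=R_j(\sigma)$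 if $\sigma\ge0$, $\psi_j(\sigma)=S_j(\sigma)$ if $\sigma<0$, and $$\boldsymbol\Psi(\sigma_1,\dots,\sigma_n)=\psi_n(\sigma_n)\circ\dots\circ\psi_1(\sigma_1),\qquad \mathbf S(q_1,\dots,q_n)=S_n(q_n)\circ\dots\circ S_1(q_1).$$ **Functionals.** Fix $\rho>0$; all wave parameters are required to be smaller than $\rho$ in absolute value. Let $v=\sum_{\alpha=1}^N v_\alpha\chi_{[x_\alpha,x_{\alpha+1}[}$ be piecewise constant with values in $\Omega$ (right continuous, finitely many jumps, compact support), and let $\mathcal I(v)$ be its set of jump points. For $x\in\mathcal I(v)$ let $\sigma_{x,1},\dots,\sigma_{x,n}$ be such that $v(x)=\boldsymbol\Psi(\sigma_{x,1},\dots,\sigma_{x,n})(v(x-))$, $|\sigma_{x,i}|<\rho$. Set $$\mathbf V(v)=\sum_{x\in\mathcal I(v)}\sum_i|\sigma_{x,i}|,\qquad \mathbf Q(v)=\sum|\sigma_{x,i}\sigma_{y,j}|,\qquad \mathbf\Upsilon=\mathbf V+C_0\mathbf Q,$$ where the sum in $\mathbf Q$ is over all $((x,i),(y,j))$ with $x,y\in\mathcal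 I(v)$, $x<y$, and either $i>j$, or $i=j$, the $i$-th field is genuinely nonlinear and $\min\{\sigma_{x,i},\sigma_{y,i}\}<0$. Let $\mathcal D^*_\delta$ be the set of those $v$ all of whose jumps admit such $\sigma_{x,i}$ and for which $\mathbf\Upsilon(v)<\delta$. Let $$A_j^-[v](x)=\sum_{y\le x}|\sigma_{y,j}|,\qquad A_j^+[v](x)=\sum_{y>x}|\sigma_{y,j}|$$ (sums over $y\in\mathcal I(v)$), and $$\mathbf A_i[v](q,x)=\sum_{j<i}A_j^+[v](x)+\sum_{j>i}A_j^-[v](x)+\theta_i\left(A_i^+[v](x)\chi_{[0,+\infty[}(q)+A_i^-[v](x)\chi_{]-\infty,0[}(q)\right),$$ with $\theta_i=1$ if the $i$-th field is genuinely nonlinear and $\theta_i=0$ if it is linearly degenerate. For $v,\tilde v\in\mathcal D^*_\delta$ let $$\mathbf W_i[v,\tilde v](q,x)=1+\kappa_1\mathbf A_i[v](q,x)+\kappa_1\mathbf A_i[\tilde v](-q,x)+\kappa_1\kappa_2(\mathbf Q(v)+\mathbf Q(\tilde v)),$$ define $\mathbf q(x)=(q_1(x),\dots,q_n(x))$ by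 $\tilde v(x)=\mathbf S(\mathbf q(x))(v(x))$, $|q_i(x)|<\rho$, and let $$\mathbf\Phi(v,\tilde v)=\sum_{i=1}^n\int_{\mathbb R}|q_i(x)|\,\mathbf W_i[v,\tilde v](q_i(x),x)\,dx .$$ For $\eta>0$ let $B_\eta(u)=\{v\in\mathcal D^*_\delta:\|v-u\|_{L^1}<\eta\}$, $$\mathbf\Xi_\eta(u,\tilde u)=\inf\{\mathbf\Phi(v,\tilde v): v\in B_\eta(u),\ \tilde v\in B_\eta(\tilde u)\},\qquad \mathbf\Xi(u,\tilde u)=\sup_{\eta>0}\mathbf\Xi_\eta(u,\tilde u).$$ **Proposition.** There are $\rho_0>0$ and $K>0$, depending only on $\Omega$, $f$, $(k_j)$ and $(e_j)$, such that for every $\rho\in\,]0,\rho_0[$ there is $\delta_0>0$ with the following property. For all $\delta\in\,]0,\delta_0[$, all $C_0>0$, $\kappa_1>0$, $\kappa_2\ge K$, and all $u,\tilde u\in\mathcal D^*_\delta$: * the wave sizes are well defined: for every $x\in\mathbb R$ there is exactly one $\sigma$ with $u(x)=\boldsymbol\Psi(\sigma)(u(x-))$ and $|\sigma_i|<\rho$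 for all $i$, and exactly one $q$ with $\tilde u(x)=\mathbf S(q)(u(x))$ and $|q_i|<\rho$ for all $i$; and the integrals defining $\mathbf\Phi(u,\tilde u)$ converge; * $\lim_{\eta\to0+}\mathbf\Xi_\eta(u,\tilde u)=\mathbf\Xi(u,\tilde u)$, and $$\mathbf\Xi(u,\tilde u)=\mathbf\Phi(u,\tilde u).$$ -/

import Mathlib

open Set Filter Topology MeasureTheory
open scoped RealInnerProductSpace

namespace ConsLaw

/-- The state space `ℝⁿ` with its Euclidean norm. -/
abbrev State (n : ℕ) : Type := EuclideanSpace ℝ (Fin n)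

/-- `l` lists `n` distinct real eigenvalues of `A` in increasing order. -/
def IsOrderedSpectrum {n : ℕ} (A : State n →L[ℝ] State n) (l : Fin n → ℝ) : Prop :=
  StrictMono l ∧ ∀ j, ∃ v : State n, v ≠ 0 ∧ A v = l j • v

open Classical in
/-- The `j`-th eigenvalue of `A`, in increasing order, when `A` has `n` distinct real ones
(an `n × n` matrix has at most one ordered list of `n` eigenvalues). -/
noncomputable def orderedEigenvalue {n : ℕ} (A : State n →L[ℝ] State n) : Fin n → ℝ :=
  if h : ∃ l, IsOrderedSpectrum A l then h.choose else 0

/-- The data of the problem: the set of states `Ω`, the flow `f`, the numbers `k j` used to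
parametrize the genuinely nonlinear waves, and vectors `e j` that orient the linearly degenerate
ones. -/
structure Data (n : ℕ) where
  Ω : Set (State n)
  f : State n → State n
  k : Fin n → ℝ
  e : Fin n → State n

namespace Data

variable {n : ℕ} (S : Data n)

/-- The characteristic speed `λ_j(u)`, the `j`-th eigenvalue of `Df(u)`. -/
noncomputable def speed (j : Fin n) (u : State n) : ℝ :=
  orderedEigenvalue (fderiv ℝ S.f u) j

/-- For every state, `Df(u)` has `n` distinct real eigenvalues. -/
def StrictlyHyperbolic : Prop :=
  ∀ u ∈ S.Ω, ∃ l : Fin n → ℝ, IsOrderedSpectrum (fderiv ℝ S.f u) l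

/-- `v` is a right eigenvector of `Df(u)` for `λ_j(u)` (possibly `0`). -/
def IsEigenvector (j : Fin n) (u v : State n) : Prop :=
  fderiv ℝ S.f u v = S.speed j u • v

/-- The `j`-th field is genuinely nonlinear: `∇λ_j · r_j ≠ 0` on `Ω`. -/
def GenuinelyNonlinear (j : Fin n) : Prop :=
  ∀ u ∈ S.Ω, ∀ v, v ≠ 0 → S.IsEigenvector j u v → fderiv ℝ (S.speed j) u v ≠ 0

/-- The `j`-th field is linearly degenerate: `∇λ_j · r_j = 0` on `Ω`. -/
def LinearlyDegenerate (j : Fin n) : Prop :=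
  ∀ u ∈ S.Ω, ∀ v, S.IsEigenvector j u v → fderiv ℝ (S.speed j) u v = 0

/-- The standing assumption on the system of conservation laws `∂ₜu + ∂ₓf(u) = 0`. -/
structure Admissible : Prop where
  isOpen : IsOpen S.Ω
  zero_mem : (0 : State n) ∈ S.Ω
  contDiffOn : ContDiffOn ℝ 4 S.f S.Ω
  hyperbolic : S.StrictlyHyperbolic
  fields : ∀ j, S.GenuinelyNonlinear j ∨ S.LinearlyDegenerate j

/-- The normalizing data: `k j > 0`, and `e j` is a unit `j`-th eigenvector at the state `0`. -/
structure Normalized : Prop where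
  k_pos : ∀ j, 0 < S.k j
  e_norm : ∀ j, ‖S.e j‖ = 1
  e_eigen : ∀ j, S.IsEigenvector j 0 (S.e j)

/-- `v` is the normalized right eigenvector `r_j(u)`: if the `j`-th field is genuinely nonlinear,
`∇λ_j(u) · v = k_j`; if it is linearly degenerate, `v` is a unit vector (arc-length), its sign
being fixed, for `u` near `0`, by `⟪e_j, v⟫ > 0`. -/
def IsRightEigenvector (j : Fin n) (u v : State n) : Prop :=
  S.IsEigenvector j u v ∧
  (S.GenuinelyNonlinear j → fderiv ℝ (S.speed j) u v = S.k j) ∧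
  (S.LinearlyDegenerate j → ‖v‖ = 1 ∧ 0 < ⟪S.e j, v⟫)

/-- `w = R_j(s)(u)`: `w` is the point of parameter `s` of the rarefaction curve exiting `u`,
i.e. of the integral curve of `r_j` with value `u` at `0`. -/
def IsRarefaction (j : Fin n) (s : ℝ) (u w : State n) : Prop :=
  ∃ c c' : ℝ → State n, c 0 = u ∧ c s = w ∧
    ∀ t ∈ uIcc 0 s, c t ∈ S.Ω ∧ HasDerivWithinAt c (c' t) (uIcc 0 s) t ∧
      S.IsRightEigenvector j (c t) (c' t)

/-- `w = S_j(s)(u)`: `w` is the point of parameter `s` of the `j`-th Rankine-Hugoniot (shock) curve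
exiting `u`. This is the `C¹` curve `c` through `u`, tangent to `r_j(u)` there, whose points satisfy
the Rankine-Hugoniot conditions with a continuous shock speed `a` that starts from `λ_j(u)`; it is
parametrized by `∂λ_j/∂s = k_j` if the field is genuinely nonlinear, and by arc-length if it is
linearly degenerate. -/
def IsShock (j : Fin n) (s : ℝ) (u w : State n) : Prop :=
  ∃ (c c' : ℝ → State n) (a : ℝ → ℝ), c 0 = u ∧ c s = w ∧ a 0 = S.speed j u ∧
    S.IsRightEigenvector j u (c' 0) ∧
    ContinuousOn a (uIcc 0 s) ∧ ContinuousOn c' (uIcc 0 s) ∧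
    ∀ t ∈ uIcc 0 s, c t ∈ S.Ω ∧ HasDerivWithinAt c (c' t) (uIcc 0 s) t ∧
      S.f (c t) - S.f u = a t • (c t - u) ∧
      (S.GenuinelyNonlinear j → S.speed j (c t) = S.speed j u + S.k j * t) ∧
      (S.LinearlyDegenerate j → ‖c' t‖ = 1)

/-- `w = ψ_j(s)(u)`: the Lax curve. -/
def IsLax (j : Fin n) (s : ℝ) (u w : State n) : Prop :=
  (0 ≤ s → S.IsRarefaction j s u w) ∧ (s < 0 → S.IsShock j s u w)

/-- `u⁺ = Ψ(σ)(u⁻) = ψ_n(σ_n) ∘ ⋯ ∘ ψ_1(σ_1)(u⁻)`. -/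
def IsLaxPath (σ : Fin n → ℝ) (um up : State n) : Prop :=
  ∃ w : Fin (n + 1) → State n, w 0 = um ∧ w (Fin.last n) = up ∧
    ∀ j : Fin n, S.IsLax j (σ j) (w j.castSucc) (w j.succ)

/-- `u⁺ = S(q)(u⁻) = S_n(q_n) ∘ ⋯ ∘ S_1(q_1)(u⁻)`. -/
def IsShockPath (q : Fin n → ℝ) (um up : State n) : Prop :=
  ∃ w : Fin (n + 1) → State n, w 0 = um ∧ w (Fin.last n) = up ∧
    ∀ j : Fin n, S.IsShock j (q j) (w j.castSucc) (w j.succ)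

/-- `σ` solves the Riemann problem `(u⁻, u⁺)` with waves smaller than `ρ`. -/
def SolvesRiemann (ρ : ℝ) (um up : State n) (σ : Fin n → ℝ) : Prop :=
  (∀ i, |σ i| < ρ) ∧ S.IsLaxPath σ um up

/-- `q` connects `u⁻` to `u⁺` along shock curves with parameters smaller than `ρ`. -/
def SolvesShock (ρ : ℝ) (um up : State n) (q : Fin n → ℝ) : Prop :=
  (∀ i, |q i| < ρ) ∧ S.IsShockPath q um up

open Classical in
/-- The map `E(u⁻, u⁺)`, the strengths of the waves in the Riemann problem. -/
noncomputable def waves (ρ : ℝ) (um up : State n) : Fin n → ℝ :=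
  if h : ∃ σ, S.SolvesRiemann ρ um up σ then h.choose else 0

open Classical in
/-- The vector `q` such that `u⁺ = S(q)(u⁻)`. -/
noncomputable def shocks (ρ : ℝ) (um up : State n) : Fin n → ℝ :=
  if h : ∃ q, S.SolvesShock ρ um up q then h.choose else 0

end Data

/-- `v = ∑ u_α χ_[x_α, x_{α+1}[` with `x_1 < ⋯ < x_{N+1}`: the right continuous representatives of
the integrable piecewise constant maps with finitely many jumps. -/
def IsPiecewiseConstant {n : ℕ} (v : ℝ → State n) : Prop :=
  ∃ (N : ℕ) (x : Fin (N + 1) → ℝ) (c : Fin N → State n), StrictMono x ∧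
    v = fun y => ∑ α, (Ico (x α.castSucc) (x α.succ)).indicator (fun _ => c α) y

/-- The set of the points of jump of a right continuous `v`. -/
def jumps {n : ℕ} (v : ℝ → State n) : Set ℝ := {x | Function.leftLim v x ≠ v x}

namespace Data

variable {n : ℕ} (S : Data n)

/-- `σ_{x,i}`, the strength of the `i`-th wave at `x`. -/
noncomputable def σ (ρ : ℝ) (v : ℝ → State n) (x : ℝ) (i : Fin n) : ℝ :=
  S.waves ρ (Function.leftLim v x) (v x) i

/-- The set of pairs of approaching waves. -/
def approaching (ρ : ℝ) (v : ℝ → State n) : Set ((ℝ × Fin n) × (ℝ × Fin n)) :=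
  {p | p.1.1 ∈ jumps v ∧ p.2.1 ∈ jumps v ∧ p.1.1 < p.2.1 ∧
    (p.2.2 < p.1.2 ∨ (p.1.2 = p.2.2 ∧ S.GenuinelyNonlinear p.1.2 ∧
      min (S.σ ρ v p.1.1 p.1.2) (S.σ ρ v p.2.1 p.2.2) < 0))}

/-- The linear potential. -/
noncomputable def V (ρ : ℝ) (v : ℝ → State n) : ℝ :=
  ∑ᶠ x ∈ jumps v, ∑ i, |S.σ ρ v x i|

/-- The interaction potential. -/
noncomputable def Q (ρ : ℝ) (v : ℝ → State n) : ℝ :=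
  ∑ᶠ p ∈ S.approaching ρ v, |S.σ ρ v p.1.1 p.1.2 * S.σ ρ v p.2.1 p.2.2|

/-- `Υ = V + C₀ Q`. -/
noncomputable def Upsilon (ρ C₀ : ℝ) (v : ℝ → State n) : ℝ := S.V ρ v + C₀ * S.Q ρ v

/-- `D_δ*`: the integrable piecewise constant maps into `Ω` with `Υ(v) < δ`; for `Υ(v)` to make
sense, the Riemann problem has to be solvable at every jump. -/
def Dstar (ρ C₀ δ : ℝ) : Set (ℝ → State n) :=
  {v | IsPiecewiseConstant v ∧ (∀ x, v x ∈ S.Ω) ∧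
    (∀ x ∈ jumps v, ∃ s, S.SolvesRiemann ρ (Function.leftLim v x) (v x) s) ∧
    S.Upsilon ρ C₀ v < δ}

/-- `A_j⁻[v](x)`: the waves of the `j`-th family at points `y ≤ x`. -/
noncomputable def Aminus (ρ : ℝ) (v : ℝ → State n) (j : Fin n) (x : ℝ) : ℝ :=
  ∑ᶠ y ∈ jumps v ∩ Iic x, |S.σ ρ v y j|

/-- `A_j⁺[v](x)`: the waves of the `j`-th family at points `y > x`. -/
noncomputable def Aplus (ρ : ℝ) (v : ℝ → State n) (j : Fin n) (x : ℝ) : ℝ :=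
  ∑ᶠ y ∈ jumps v ∩ Ioi x, |S.σ ρ v y j|

open Classical in
/-- `A_i[v](q, x)`. -/
noncomputable def A (ρ : ℝ) (v : ℝ → State n) (i : Fin n) (q x : ℝ) : ℝ :=
  ∑ j ∈ Finset.univ.filter (· < i), S.Aplus ρ v j x
  + ∑ j ∈ Finset.univ.filter (i < ·), S.Aminus ρ v j x
  + if S.GenuinelyNonlinear i then
      (if 0 ≤ q then S.Aplus ρ v i x else S.Aminus ρ v i x)
    else 0

/-- The weight `W_i[v, v'](q, x)`. -/
noncomputable def W (ρ κ₁ κ₂ : ℝ) (v v' : ℝ → State n) (i : Fin n) (q x : ℝ) : ℝ :=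
  1 + κ₁ * S.A ρ v i q x + κ₁ * S.A ρ v' i (-q) x + κ₁ * κ₂ * (S.Q ρ v + S.Q ρ v')

/-- The `i`-th integrand `|q_i(x)| W_i[v, v'](q_i(x), x)` of `Φ`, where `v'(x) = S(q(x))(v(x))`. -/
noncomputable def integrand (ρ κ₁ κ₂ : ℝ) (v v' : ℝ → State n) (i : Fin n) (x : ℝ) : ℝ :=
  |S.shocks ρ (v x) (v' x) i| * S.W ρ κ₁ κ₂ v v' i (S.shocks ρ (v x) (v' x) i) x

/-- The stability functional `Φ`. -/
noncomputable def Phi (ρ κ₁ κ₂ : ℝ) (v v' : ℝ → State n) : ℝ :=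
  ∑ i, ∫ x, S.integrand ρ κ₁ κ₂ v v' i x

/-- `B_η(u)`: the elements of `D_δ*` at `L¹` distance less than `η` from `u`. -/
def B (ρ C₀ δ η : ℝ) (u : ℝ → State n) : Set (ℝ → State n) :=
  {v | v ∈ S.Dstar ρ C₀ δ ∧ eLpNorm (fun x => v x - u x) 1 volume < ENNReal.ofReal η}

/-- `Ξ_η(u, u')`, the infimum of `Φ` on `B_η(u) × B_η(u')`. -/
noncomputable def XiEta (ρ C₀ δ κ₁ κ₂ η : ℝ) (u u' : ℝ → State n) : ℝ :=
  sInf {y | ∃ v ∈ S.B ρ C₀ δ η u, ∃ v' ∈ S.B ρ C₀ δ η u', y = S.Phi ρ κ₁ κ₂ v v'}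

/-- The relaxed functional `Ξ(u, u') = sup_{η > 0} Ξ_η(u, u')`. -/
noncomputable def Xi (ρ C₀ δ κ₁ κ₂ : ℝ) (u u' : ℝ → State n) : ℝ :=
  ⨆ η : {η : ℝ // 0 < η}, S.XiEta ρ C₀ δ κ₁ κ₂ η u u'

end Data

end ConsLaw

/-! Since `u` and `u'` belong to their own balls, `Xi ≤ Phi` is immediate. The content is that `Phi`
is lower semicontinuous for `L¹` convergence inside `Dstar` (`exists_Phi_lt`). Along a subsequence
converging almost everywhere, Fatou's lemma reduces this to lower semicontinuity of the integrand
`|q_i| W_i` at the points `x` of convergence (`eventually_integrand_lt`). There `q_i` converges,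
because the solution of the shock problem depends Lipschitz continuously on the states. If the limit
is `0`, nothing has to be proved. Otherwise the sign of `q_i` is eventually constant, which freezes
the choice between `Aplus` and `Aminus`, and each of the two maps contributes separately through
`weightPot`: a sum of wave strengths with weights `0` or `1` depending on the family and on the side
of `x`, plus `κ₂ Q`.

The functional `weightPot` is a function `pot` of the list `fans` of the Riemann problems between
consecutive values. The limit is sampled at finitely many points of convergence: `x` itself and a
point at, or just to the right of, each jump. On the limit, the sampled functional is exact. On the
approximants, it converges to that value, being a continuous function of finitely many states
(`continuous_approach`, `tendsto_pot_fans`). It also bounds their full functional from below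
(`pot_sample_le`): deleting a sample point merges two adjacent Riemann problems, and by Glimm's
interaction estimate this raises the linear part by at most `C` times the sum of the products of
approaching waves, while the interaction part drops by at least half of that sum if the total
strength is small. Hence `κ₂ ≥ 2C` suffices (`eventually_weightPot_lt`).

What precedes is the local theory. Lax and shock curves, as characterized by their definitions,
exist and are unique near `0`, and have the form `u + s • Z s u` with `Z` Lipschitz. The inversion
of the composed maps (`exists_inverse`) and the interaction estimate (`exists_interaction`) use only
this form, the independence of the directions `Z j 0 0`, and the exact additivity of parameters
along a linearly degenerate field or for two rarefactions. No differentiability of the Lax curves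
across `s = 0` is involved. -/

namespace ConsLaw

/-! ### Divided differences of smooth maps. -/

section Hadamard
variable {E F : Type*} [NormedAddCommGroup E] [NormedSpace ℝ E] [FiniteDimensional ℝ E]
  [NormedAddCommGroup F] [NormedSpace ℝ F]

/-- A germ of class `C^k` is the germ of a globally defined map of class `C^k`. -/
theorem exists_contDiff_eventuallyEq {k : ℕ} {h : E → F} {x : E} (hh : ContDiffAt ℝ k h x) :
    ∃ g : E → F, ContDiff ℝ k g ∧ g =ᶠ[𝓝 x] h := by
  obtain ⟨u, hu, hcd⟩ := hh.contDiffOn (m := k) le_rfl (by simp)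
  obtain ⟨R, hR, hsub⟩ := Metric.mem_nhds_iff.1 (by simpa using hu : u ∈ 𝓝 x)
  let χ : ContDiffBump x := ⟨R / 4, R / 2, by positivity, by linarith⟩
  refine ⟨fun y => χ y • h y, ?_, ?_⟩
  · rw [contDiff_iff_contDiffAt]
    intro y
    by_cases hy : y ∈ Metric.ball x R
    · exact χ.contDiff.contDiffAt.smul ((hcd.mono hsub).contDiffAt (Metric.isOpen_ball.mem_nhds hy))
    · have hy' : y ∉ tsupport χ := by
        rw [χ.tsupport_eq]
        intro hc
        exact hy (Metric.closedBall_subset_ball (by simp only [χ]; linarith) hc)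
      have : (fun z => χ z • h z) =ᶠ[𝓝 y] fun _ => 0 := by
        filter_upwards [notMem_tsupport_iff_eventuallyEq.1 hy'] with z hz
        simp [hz]
      exact contDiffAt_const.congr_of_eventuallyEq this
  · filter_upwards [χ.eventuallyEq_one] with z hz
    simp [hz]

/-- Differentiation under the integral sign: the candidate derivative is jointly continuous, hence
bounded on the compact set `closedBall p 1 × [0, 1]`, which provides the dominating constant. -/
theorem contDiff_segment_average [CompleteSpace F] {G : E → F} (hG : ContDiff ℝ 1 G) :
    ContDiff ℝ 1 (fun p : E × E => ∫ θ in (0 : ℝ)..1, G (p.1 + θ • (p.2 - p.1))) := by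
  have hG' : Continuous (fderiv ℝ G) := hG.continuous_fderiv one_ne_zero
  let D : E × E → ℝ → (E × E →L[ℝ] F) := fun p θ =>
    (fderiv ℝ G (p.1 + θ • (p.2 - p.1))).comp
      (ContinuousLinearMap.fst ℝ E E +
        θ • (ContinuousLinearMap.snd ℝ E E - ContinuousLinearMap.fst ℝ E E))
  have hD : Continuous (Function.uncurry D) := by
    simp only [D, Function.uncurry_def]
    refine Continuous.clm_comp (hG'.comp (by fun_prop)) (by fun_prop)
  rw [contDiff_one_iff_hasFDerivAt]
  refine ⟨fun p => ∫ θ in (0 : ℝ)..1, D p θ,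
    intervalIntegral.continuous_parametric_intervalIntegral_of_continuous' hD _ _, fun p => ?_⟩
  obtain ⟨B, hB⟩ := ((isCompact_closedBall p 1).prod (isCompact_Icc (a := (0 : ℝ)) (b := 1))).exists_bound_of_continuousOn
    hD.continuousOn
  refine intervalIntegral.hasFDerivAt_integral_of_dominated_of_fderiv_le (F' := D)
    (bound := fun _ => B) (Metric.closedBall_mem_nhds p one_pos) ?_ ?_ ?_ ?_ ?_ ?_
  · exact Eventually.of_forall fun q =>
      (hG.continuous.comp (by fun_prop)).aestronglyMeasurable
  · exact (hG.continuous.comp (by fun_prop)).intervalIntegrable _ _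
  · exact (hD.comp (by fun_prop : Continuous fun θ : ℝ => (p, θ))).aestronglyMeasurable
  · refine Eventually.of_forall fun θ hθ q hq => hB (q, θ) ⟨hq, ?_⟩
    rw [uIoc_of_le zero_le_one] at hθ
    exact ⟨hθ.1.le, hθ.2⟩
  · simp
  · refine Eventually.of_forall fun θ _ q _ => ?_
    have h1 : HasFDerivAt (fun q : E × E => q.1 + θ • (q.2 - q.1))
      (ContinuousLinearMap.fst ℝ E E +
        θ • (ContinuousLinearMap.snd ℝ E E - ContinuousLinearMap.fst ℝ E E)) q :=
      hasFDerivAt_fst.add ((hasFDerivAt_snd.sub hasFDerivAt_fst).const_smul θ)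
    exact ((hG.differentiable one_ne_zero) _).hasFDerivAt.comp q h1

/-- Hadamard's lemma: a `C²` map has a `C¹` divided difference. -/
theorem exists_divided_difference [CompleteSpace F] {h : E → F} {x : E}
    (hh : ContDiffAt ℝ 2 h x) :
    ∃ A : E × E → (E →L[ℝ] F), ContDiffAt ℝ 1 A (x, x) ∧
      (∀ᶠ p in 𝓝 (x, x), A p (p.2 - p.1) = h p.2 - h p.1) ∧
      (∀ᶠ u in 𝓝 x, A (u, u) = fderiv ℝ h u) := by
  -- With a globally defined representative, the average along the segment makes sense for all pairs
  -- of points.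
  obtain ⟨g, hg, hgh⟩ := exists_contDiff_eventuallyEq (k := 2) (h := h) (x := x) (by exact_mod_cast hh)
  have hg2 : ContDiff ℝ 1 (fderiv ℝ g) := hg.fderiv_right (by norm_num)
  refine ⟨fun p => ∫ θ in (0 : ℝ)..1, fderiv ℝ g (p.1 + θ • (p.2 - p.1)),
    (contDiff_segment_average hg2).contDiffAt, ?_, ?_⟩
  · have h1 : ∀ᶠ p : E × E in 𝓝 (x, x), g p.1 = h p.1 := hgh.prod_inl_nhds x
    have h2 : ∀ᶠ p : E × E in 𝓝 (x, x), g p.2 = h p.2 := hgh.prod_inr_nhds x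
    filter_upwards [h1, h2] with p h1 h2
    rw [← h1, ← h2]
    have hd : ∀ θ : ℝ, HasDerivAt (fun θ : ℝ => g (p.1 + θ • (p.2 - p.1)))
        (fderiv ℝ g (p.1 + θ • (p.2 - p.1)) (p.2 - p.1)) θ := by
      intro θ
      have : HasDerivAt (fun θ : ℝ => p.1 + θ • (p.2 - p.1)) (p.2 - p.1) θ := by
        simpa using ((hasDerivAt_id θ).smul_const (p.2 - p.1)).const_add p.1
      exact ((hg.differentiable (by norm_num)) _).hasFDerivAt.comp_hasDerivAt θ this
    have hc : Continuous fun θ : ℝ => fderiv ℝ g (p.1 + θ • (p.2 - p.1)) :=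
      hg2.continuous.comp (by fun_prop)
    rw [ContinuousLinearMap.intervalIntegral_apply (hc.intervalIntegrable _ _),
      intervalIntegral.integral_eq_sub_of_hasDerivAt (fun θ _ => hd θ)
        ((hc.clm_apply continuous_const).intervalIntegrable _ _)]
    simp
  · filter_upwards [hgh.eventuallyEq_nhds] with u hu
    simp [hu.fderiv_eq]

end Hadamard

/-! ### Simple real spectra and their perturbation. -/

section Spectrum
variable {n : ℕ}

/-- A basis of eigenvectors. -/
theorem IsOrderedSpectrum.exists_basis {A : State n →L[ℝ] State n} {l : Fin n → ℝ}
    (h : IsOrderedSpectrum A l) :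
    ∃ b : Module.Basis (Fin n) ℝ (State n), (∀ j, A (b j) = l j • b j) ∧
      ∀ v i, b.repr (A v) i = l i * b.repr v i := by
  choose v hv using h.2
  have hli : LinearIndependent ℝ v :=
    Module.End.eigenvectors_linearIndependent' (A : State n →ₗ[ℝ] State n) l h.1.injective v
      (fun i => ⟨Module.End.mem_eigenspace_iff.2 (hv i).2, (hv i).1⟩)
  let b := basisOfLinearIndependentOfCardEqFinrank' v hli (by simp)
  have hb : ∀ j, b j = v j := fun j => by simp [b]
  have hA : ∀ j, A (b j) = l j • b j := fun j => by rw [hb]; exact (hv j).2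
  refine ⟨b, hA, fun w i => ?_⟩
  have : (b.coord i) ∘ₗ (A : State n →ₗ[ℝ] State n) = l i • b.coord i := by
    refine b.ext fun j => ?_
    by_cases hij : j = i
    · subst hij; simp [hA]
    · simp [hA, hij]
  simpa using LinearMap.congr_fun this w

theorem IsOrderedSpectrum.eq_of_eigenvector {A : State n →L[ℝ] State n} {l : Fin n → ℝ}
    (h : IsOrderedSpectrum A l) {v : State n} {a : ℝ} (hv : v ≠ 0) (hAv : A v = a • v) :
    ∃ j, a = l j := by
  obtain ⟨b, -, hb⟩ := h.exists_basis
  by_contra! hne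
  refine hv (b.repr.injective ?_)
  ext i
  have h1 := hb v i
  rw [hAv] at h1
  simp only [map_smul, Finsupp.smul_apply, smul_eq_mul] at h1
  have h2 : (a - l i) * b.repr v i = 0 := by linarith
  simpa [sub_ne_zero.2 (hne i)] using h2

theorem IsOrderedSpectrum.unique {A : State n →L[ℝ] State n} {l l' : Fin n → ℝ}
    (h : IsOrderedSpectrum A l) (h' : IsOrderedSpectrum A l') : l = l' := by
  have key : ∀ {m m' : Fin n → ℝ}, IsOrderedSpectrum A m → IsOrderedSpectrum A m' →
      range m ⊆ range m' := by
    rintro m m' hm hm' _ ⟨j, rfl⟩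
    obtain ⟨v, hv, hAv⟩ := hm.2 j
    obtain ⟨i, hi⟩ := hm'.eq_of_eigenvector hv hAv
    exact ⟨i, hi.symm⟩
  exact (StrictMono.range_inj h.1 h'.1).1 ((key h h').antisymm (key h' h))

theorem IsOrderedSpectrum.orderedEigenvalue_eq {A : State n →L[ℝ] State n} {l : Fin n → ℝ}
    (h : IsOrderedSpectrum A l) : orderedEigenvalue A = l := by
  have hex : ∃ l, IsOrderedSpectrum A l := ⟨l, h⟩
  unfold orderedEigenvalue
  rw [dif_pos hex]
  exact hex.choose_spec.unique h

theorem IsOrderedSpectrum.exists_smul {A : State n →L[ℝ] State n} {l : Fin n → ℝ}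
    (h : IsOrderedSpectrum A l) {j : Fin n} {e v : State n} (he : e ≠ 0) (hAe : A e = l j • e)
    (hAv : A v = l j • v) : ∃ c : ℝ, v = c • e := by
  obtain ⟨b, -, hb⟩ := h.exists_basis
  have key : ∀ w, A w = l j • w → ∀ i, i ≠ j → b.repr w i = 0 := by
    intro w hw i hi
    have h1 := hb w i
    rw [hw] at h1
    simp only [map_smul, Finsupp.smul_apply, smul_eq_mul] at h1
    have h2 : (l j - l i) * b.repr w i = 0 := by linarith
    simpa [sub_ne_zero.2 (h.1.injective.ne hi.symm)] using h2
  have hej : b.repr e j ≠ 0 := by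
    intro h0
    refine he (b.repr.injective ?_)
    ext i
    by_cases hi : i = j
    · subst hi; simpa using h0
    · simpa using key e hAe i hi
  refine ⟨b.repr v j / b.repr e j, b.repr.injective ?_⟩
  ext i
  by_cases hi : i = j
  · subst hi; simp [hej]
  · simp [key e hAe i hi, key v hAv i hi]

theorem IsOrderedSpectrum.eq_inner_smul {A : State n →L[ℝ] State n} {l : Fin n → ℝ}
    (h : IsOrderedSpectrum A l) {j : Fin n} {e v w : State n} (hew : ⟪e, w⟫ = 1)
    (hAw : A w = l j • w) (hAv : A v = l j • v) : v = ⟪e, v⟫ • w := by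
  have hw : w ≠ 0 := by rintro rfl; simp at hew
  obtain ⟨c, rfl⟩ := h.exists_smul hw hAw hAv
  rw [inner_smul_right, hew, mul_one]

/-- This is the nondegeneracy needed by the implicit function theorem for eigenpairs. The `j`-th
coordinate in the eigenbasis annihilates the range of `A - l j`, so `a = 0`; then `v` is a multiple
of `e` orthogonal to `e`. -/
theorem IsOrderedSpectrum.injective_linearization {A : State n →L[ℝ] State n} {l : Fin n → ℝ}
    (h : IsOrderedSpectrum A l) {j : Fin n} {e v : State n} {a : ℝ} (he : ‖e‖ = 1)
    (hAe : A e = l j • e) (h1 : A v - l j • v = a • e) (h2 : ⟪e, v⟫ = 0) : v = 0 ∧ a = 0 := by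
  have he0 : e ≠ 0 := by rintro rfl; simp at he
  have hee : ⟪e, e⟫ = 1 := by rw [real_inner_self_eq_norm_sq, he]; norm_num
  obtain ⟨b, hA, hb⟩ := h.exists_basis
  obtain ⟨c, hc⟩ := h.exists_smul he0 hAe (hA j)
  have hbj : b.repr e j * c = 1 := by
    have := congrArg (fun w => b.repr w j) hc
    simp at this
    linarith
  have ha : a = 0 := by
    have h3 := congrArg (fun w => b.repr w j) h1
    simp only [map_sub, map_smul, Finsupp.sub_apply, Finsupp.smul_apply, smul_eq_mul, hb] at h3
    have h4 : a * (b.repr e j * c) = 0 := by rw [← mul_assoc, ← h3]; ring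
    rwa [hbj, mul_one] at h4
  subst ha
  have hAv : A v = l j • v := by rw [zero_smul, sub_eq_zero] at h1; exact h1
  have := h.eq_inner_smul hee hAe hAv
  exact ⟨by rw [this, h2, zero_smul], rfl⟩

/-- Simple eigenvalues and their eigenvectors depend smoothly on the operator. -/
theorem IsOrderedSpectrum.exists_eigenpair {A₀ : State n →L[ℝ] State n} {l : Fin n → ℝ}
    (h : IsOrderedSpectrum A₀ l) (j : Fin n) {e : State n} (he : ‖e‖ = 1)
    (hAe : A₀ e = l j • e) :
    ∃ (V : (State n →L[ℝ] State n) → State n) (Λ : (State n →L[ℝ] State n) → ℝ),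
      ContDiffAt ℝ 3 V A₀ ∧ ContDiffAt ℝ 3 Λ A₀ ∧ V A₀ = e ∧ Λ A₀ = l j ∧
      ∀ᶠ A in 𝓝 A₀, A (V A) = Λ A • V A ∧ ⟪e, V A⟫ = 1 := by
  have hee : ⟪e, e⟫ = 1 := by rw [real_inner_self_eq_norm_sq, he]; norm_num
  -- The eigenpair is the implicit solution of `φ (A, v, λ) = φ (A₀, e, l j)`; the second component
  -- removes the scaling freedom of `v`.
  let φ : (State n →L[ℝ] State n) × (State n × ℝ) → State n × ℝ :=
    fun p => (p.1 p.2.1 - p.2.2 • p.2.1, ⟪e, p.2.1⟫)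
  let u : (State n →L[ℝ] State n) × (State n × ℝ) := (A₀, (e, l j))
  have hφ : ContDiffAt ℝ 3 φ u := by
    refine ContDiff.contDiffAt ?_
    refine ContDiff.prodMk ?_ (contDiff_const.inner ℝ (by fun_prop))
    exact (ContDiff.clm_apply contDiff_fst (by fun_prop)).sub
      (ContDiff.smul (contDiff_snd.comp contDiff_snd) (contDiff_fst.comp contDiff_snd))
  let D : State n × ℝ →L[ℝ] State n × ℝ :=
    ((A₀.comp (ContinuousLinearMap.fst ℝ _ _)) -
      (l j • ContinuousLinearMap.fst ℝ (State n) ℝ +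
        (ContinuousLinearMap.snd ℝ (State n) ℝ).smulRight e)).prod
      ((innerSL ℝ e).comp (ContinuousLinearMap.fst ℝ _ _))
  have hD : fderiv ℝ φ u ∘L .inr ℝ _ _ = D := by
    have h1 : HasFDerivAt (fun y : State n × ℝ => φ (A₀, y)) (fderiv ℝ φ u ∘L .inr ℝ _ _)
        (e, l j) :=
      (hφ.differentiableAt (by norm_num)).hasFDerivAt.comp (e, l j)
        (hasFDerivAt_prodMk_right A₀ (e, l j))
    have h2 : HasFDerivAt (fun y : State n × ℝ => φ (A₀, y)) D (e, l j) := by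
      have h3 : HasFDerivAt (fun y : State n × ℝ => y.2 • y.1)
          (l j • ContinuousLinearMap.fst ℝ (State n) ℝ +
            (ContinuousLinearMap.snd ℝ (State n) ℝ).smulRight e) (e, l j) :=
        HasFDerivAt.fun_smul (x := (e, l j)) (hasFDerivAt_snd (𝕜 := ℝ) (E := State n) (F := ℝ))
          (hasFDerivAt_fst (𝕜 := ℝ) (E := State n) (F := ℝ))
      refine HasFDerivAt.prodMk ?_ ?_
      · exact (A₀.hasFDerivAt.comp _ hasFDerivAt_fst).sub h3
      · exact (innerSL ℝ e).hasFDerivAt.comp (e, l j) hasFDerivAt_fst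
    exact h1.unique h2
  have hinj : Function.Injective D := by
    rw [injective_iff_map_eq_zero]
    rintro ⟨v, a⟩ hva
    have h1 : A₀ v - (l j • v + a • e) = 0 := congrArg Prod.fst hva
    have h2 : ⟪e, v⟫ = 0 := congrArg Prod.snd hva
    obtain ⟨rfl, rfl⟩ := h.injective_linearization (a := a) he hAe
      (by rw [← sub_eq_zero, ← h1]; abel) h2
    rfl
  have hinv : (fderiv ℝ φ u ∘L .inr ℝ _ _).IsInvertible := by
    rw [hD]
    refine ⟨(LinearEquiv.ofInjectiveEndo (D : State n × ℝ →ₗ[ℝ] State n × ℝ) hinj).toContinuousLinearEquiv, ?_⟩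
    ext x <;> rfl
  let ψ := hφ.implicitFunction (by norm_num) hinv
  have hψ : ContDiffAt ℝ 3 ψ A₀ := hφ.contDiffAt_implicitFunction (by norm_num) hinv
  have hψ0 : ψ A₀ = (e, l j) := hφ.implicitFunction_apply_self (by norm_num) hinv
  refine ⟨fun A => (ψ A).1, fun A => (ψ A).2, hψ.fst, hψ.snd, congrArg Prod.fst hψ0,
    congrArg Prod.snd hψ0, ?_⟩
  filter_upwards [hφ.eventually_apply_implicitFunction (by norm_num) hinv] with A hA
  have h1 : A (ψ A).1 - (ψ A).2 • (ψ A).1 = A₀ e - l j • e := congrArg Prod.fst hA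
  have h2 : ⟪e, (ψ A).1⟫ = ⟪e, e⟫ := congrArg Prod.snd hA
  exact ⟨by rw [hAe, sub_self, sub_eq_zero] at h1; exact h1, by rw [h2, hee]⟩

end Spectrum

section Fields
variable {n : ℕ}

/-- The last clause isolates the `j`-th eigenpair: an eigenvalue merely close to `l j` must be `Λ
j`. It identifies shock speeds, which are eigenvalues of an averaged Jacobian. -/
theorem IsOrderedSpectrum.exists_eigenpairs {A₀ : State n →L[ℝ] State n} {l : Fin n → ℝ}
    (h : IsOrderedSpectrum A₀ l) {e : Fin n → State n} (he : ∀ j, ‖e j‖ = 1)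
    (hAe : ∀ j, A₀ (e j) = l j • e j) :
    ∃ (V : Fin n → (State n →L[ℝ] State n) → State n)
      (Λ : Fin n → (State n →L[ℝ] State n) → ℝ),
      (∀ j, ContDiffAt ℝ 3 (V j) A₀ ∧ ContDiffAt ℝ 3 (Λ j) A₀ ∧ V j A₀ = e j ∧ Λ j A₀ = l j) ∧
      (∀ᶠ A in 𝓝 A₀, IsOrderedSpectrum A (fun j => Λ j A) ∧
        ∀ j, A (V j A) = Λ j A • V j A ∧ ⟪e j, V j A⟫ = 1) ∧
      ∀ j, ∀ᶠ q : (State n →L[ℝ] State n) × ℝ in 𝓝 (A₀, l j), ∀ v, v ≠ 0 → q.1 v = q.2 • v →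
        q.2 = Λ j q.1 ∧ v = ⟪e j, v⟫ • V j q.1 := by
  choose V Λ hV hΛ hV0 hΛ0 hev using fun j => h.exists_eigenpair j (he j) (hAe j)
  have hspec : ∀ᶠ A in 𝓝 A₀, IsOrderedSpectrum A (fun j => Λ j A) ∧
        ∀ j, A (V j A) = Λ j A • V j A ∧ ⟪e j, V j A⟫ = 1 := by
    have h1 : ∀ᶠ A in 𝓝 A₀, ∀ i j, i < j → Λ i A < Λ j A := by
      refine eventually_all.2 fun i => eventually_all.2 fun j => ?_
      by_cases hij : i < j
      · have := (hΛ i).continuousAt.eventually_lt (hΛ j).continuousAt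
          (by rw [hΛ0, hΛ0]; exact h.1 hij)
        filter_upwards [this] with A hA _ using hA
      · exact Eventually.of_forall fun A hA => absurd hA hij
    filter_upwards [h1, eventually_all.2 hev] with A hA hA'
    refine ⟨⟨fun i j hij => hA i j hij, fun j => ⟨V j A, ?_, (hA' j).1⟩⟩, hA'⟩
    intro h0
    have := (hA' j).2
    simp [h0] at this
  refine ⟨V, Λ, fun j => ⟨hV j, hΛ j, hV0 j, hΛ0 j⟩, hspec, fun j => ?_⟩
  have h2 : ∀ᶠ q : (State n →L[ℝ] State n) × ℝ in 𝓝 (A₀, l j), ∀ i, i ≠ j → q.2 ≠ Λ i q.1 := by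
    refine eventually_all.2 fun i => ?_
    by_cases hij : i = j
    · exact Eventually.of_forall fun q hq => absurd hij hq
    · have hc : ContinuousAt (fun q : (State n →L[ℝ] State n) × ℝ => q.2 - Λ i q.1) (A₀, l j) :=
        continuousAt_snd.sub ((hΛ i).continuousAt.comp (f := Prod.fst) (x := (A₀, l j))
          continuousAt_fst)
      have := hc.eventually_ne
        (by simpa [hΛ0] using sub_ne_zero.2 (h.1.injective.ne (Ne.symm hij)) : l j - Λ i A₀ ≠ 0)
      filter_upwards [this] with q hq _ hq'
      exact hq (by rw [hq', sub_self])
  have h3 : ∀ᶠ q : (State n →L[ℝ] State n) × ℝ in 𝓝 (A₀, l j),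
      IsOrderedSpectrum q.1 (fun j => Λ j q.1) ∧
        ∀ j, q.1 (V j q.1) = Λ j q.1 • V j q.1 ∧ ⟪e j, V j q.1⟫ = 1 := by
    exact hspec.prod_inl_nhds (l j)
  filter_upwards [h2, h3] with q hq hq' v hv hqv
  obtain ⟨i, hi⟩ := hq'.1.eq_of_eigenvector hv hqv
  have hij : i = j := by
    by_contra hne
    exact hq i hne hi
  subst hij
  have hi' : q.2 = Λ i q.1 := hi
  exact ⟨hi, hq'.1.eq_inner_smul (hq'.2 i).2 (hq'.2 i).1 (by rw [hqv, hi'])⟩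

end Fields

/-! ### The characteristic fields and the Hugoniot locus near the state `0`. -/

namespace Data
variable {n : ℕ} {S : Data n}

theorem Admissible.isOrderedSpectrum (hS : S.Admissible) {u : State n} (hu : u ∈ S.Ω) :
    IsOrderedSpectrum (fderiv ℝ S.f u) (fun j => S.speed j u) := by
  obtain ⟨l, hl⟩ := hS.hyperbolic u hu
  have : (fun j => S.speed j u) = l := by
    funext j
    simp only [speed, hl.orderedEigenvalue_eq]
  rwa [this]

theorem Normalized.e_ne_zero (hN : S.Normalized) (j : Fin n) : S.e j ≠ 0 := by
  intro h0
  have := hN.e_norm j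
  simp [h0] at this

theorem GenuinelyNonlinear.not_linearlyDegenerate (hS : S.Admissible) (hN : S.Normalized)
    {j : Fin n} (h : S.GenuinelyNonlinear j) : ¬ S.LinearlyDegenerate j := fun h' =>
  h 0 hS.zero_mem _ (hN.e_ne_zero j) (hN.e_eigen j) (h' 0 hS.zero_mem _ (hN.e_eigen j))

theorem Admissible.ld_of_not_gnl (hS : S.Admissible) {j : Fin n} (h : ¬ S.GenuinelyNonlinear j) :
    S.LinearlyDegenerate j := (hS.fields j).resolve_left h

theorem Admissible.mem_nhds (hS : S.Admissible) : S.Ω ∈ 𝓝 (0 : State n) :=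
  hS.isOpen.mem_nhds hS.zero_mem

theorem Admissible.contDiffAt (hS : S.Admissible) : ContDiffAt ℝ 4 S.f 0 :=
  hS.contDiffOn.contDiffAt hS.mem_nhds

/-- The structure, near the state `0`, of the `j`-th field: `r` is the normalized eigenvector, and
`a`, `N` are the shock speed and the direction of the segments `[u, w]` of the Hugoniot locus. -/
structure LocalField (S : Data n) (j : Fin n) where
  r : State n → State n
  a : State n × State n → ℝ
  N : State n × State n → State n
  r_contDiffAt : ContDiffAt ℝ 1 r 0
  r_zero : ∃ c : ℝ, c ≠ 0 ∧ r 0 = c • S.e j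
  r_zero_of_ld : S.LinearlyDegenerate j → r 0 = S.e j
  r_iff : ∀ᶠ u in 𝓝 (0 : State n), ∀ v, S.IsRightEigenvector j u v ↔ v = r u
  a_contDiffAt : ContDiffAt ℝ 1 a (0, 0)
  N_contDiffAt : ContDiffAt ℝ 1 N (0, 0)
  a_diag : ∀ᶠ u in 𝓝 (0 : State n), a (u, u) = S.speed j u
  speed_contDiffAt : ContDiffAt ℝ 3 (S.speed j) 0
  isolated : ∀ᶠ q : (State n × State n) × ℝ in 𝓝 ((0, 0), S.speed j 0), q.1.2 ≠ q.1.1 →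
    S.f q.1.2 - S.f q.1.1 = q.2 • (q.1.2 - q.1.1) → q.2 = a q.1 ∧
      (S.GenuinelyNonlinear j →
        q.1.2 - q.1.1 = ((S.speed j q.1.2 - S.speed j q.1.1) / S.k j) • N q.1) ∧
      (S.LinearlyDegenerate j → q.1.2 - q.1.1 = ⟪S.e j, q.1.2 - q.1.1⟫ • N q.1)
  hugoniot : S.GenuinelyNonlinear j → ∀ᶠ p : State n × State n in 𝓝 (0, 0), ∀ s : ℝ,
    p.2 - p.1 = s • N p → S.f p.2 - S.f p.1 = a p • (p.2 - p.1) ∧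
      S.speed j p.2 - S.speed j p.1 = S.k j * s
  N_diag : S.GenuinelyNonlinear j → ∀ᶠ u in 𝓝 (0 : State n), N (u, u) = r u

/-- Writing `f w - f u = A(u, w) (w - u)`, the Rankine-Hugoniot condition says that `w - u` is an
eigenvector of `A(u, w)` whose eigenvalue is the shock speed. As long as that speed is close to
`λ_j(0)`, only the direction `V_j (A(u, w))` is possible. For a genuinely nonlinear field this
direction is rescaled by means of the divided difference `B` of `λ_j`, so that its coefficient in `w
- u` becomes `(λ_j(w) - λ_j(u)) / k_j`, the parameter of the shock curve. -/
theorem exists_localField (hS : S.Admissible) (hN : S.Normalized) (j : Fin n) :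
    Nonempty (LocalField S j) := by
  obtain ⟨V, Λ, hVΛ, hspec, hisol⟩ := (hS.isOrderedSpectrum hS.zero_mem).exists_eigenpairs
    hN.e_norm hN.e_eigen
  obtain ⟨hV, hΛ, hV0, hΛ0⟩ := hVΛ j
  have hDf : ContDiffAt ℝ 3 (fderiv ℝ S.f) 0 := hS.contDiffAt.fderiv_right (by norm_num)
  have hspeed_eq : S.speed j =ᶠ[𝓝 0] fun u => Λ j (fderiv ℝ S.f u) := by
    filter_upwards [hDf.continuousAt.eventually hspec] with u hu
    exact congrFun hu.1.orderedEigenvalue_eq j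
  have hspeed : ContDiffAt ℝ 3 (S.speed j) 0 :=
    (ContDiffAt.comp (0 : State n) hΛ hDf).congr_of_eventuallyEq hspeed_eq
  have hv : ContDiffAt ℝ 3 (fun u => V j (fderiv ℝ S.f u)) 0 := ContDiffAt.comp (0 : State n) hV hDf
  have hvu : ∀ᶠ u in 𝓝 (0 : State n), u ∈ S.Ω ∧ S.IsEigenvector j u (V j (fderiv ℝ S.f u)) ∧
      ⟪S.e j, V j (fderiv ℝ S.f u)⟫ = 1 := by
    filter_upwards [hDf.continuousAt.eventually hspec, hspeed_eq, hS.mem_nhds] with u hu hu' hu''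
    exact ⟨hu'', by rw [IsEigenvector, hu']; exact (hu.2 j).1, (hu.2 j).2⟩
  obtain ⟨A, hA, hAd, hAdiag⟩ := exists_divided_difference (h := S.f) (x := 0)
    (hS.contDiffAt.of_le (by norm_num))
  obtain ⟨B, hB, hBd, hBdiag⟩ := exists_divided_difference (h := S.speed j) (x := 0)
    (hspeed.of_le (by norm_num))
  have hA0 : A (0, 0) = fderiv ℝ S.f 0 := hAdiag.self_of_nhds
  have hB0 : B (0, 0) = fderiv ℝ (S.speed j) 0 := hBdiag.self_of_nhds
  have ha : ContDiffAt ℝ 1 (fun p => Λ j (A p)) (0, 0) :=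
    ContDiffAt.comp ((0 : State n), (0 : State n)) (hA0 ▸ hΛ.of_le (by norm_num)) hA
  have hVA : ContDiffAt ℝ 1 (fun p => V j (A p)) (0, 0) :=
    ContDiffAt.comp ((0 : State n), (0 : State n)) (hA0 ▸ hV.of_le (by norm_num)) hA
  have hA_spec : ∀ᶠ p in 𝓝 ((0 : State n), (0 : State n)), A p (V j (A p)) = Λ j (A p) • V j (A p) := by
    have := hA.continuousAt.eventually (hA0.symm ▸ hspec)
    filter_upwards [this] with p hp using (hp.2 j).1
  have ha_diag : ∀ᶠ u in 𝓝 (0 : State n), Λ j (A (u, u)) = S.speed j u := by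
    filter_upwards [hAdiag, hspeed_eq] with u h1 h2
    rw [h1, h2]
  have hisol' : ∀ᶠ q : (State n × State n) × ℝ in 𝓝 ((0, 0), S.speed j 0), q.1.2 ≠ q.1.1 →
      S.f q.1.2 - S.f q.1.1 = q.2 • (q.1.2 - q.1.1) → q.2 = Λ j (A q.1) ∧
      q.1.2 - q.1.1 = ⟪S.e j, q.1.2 - q.1.1⟫ • V j (A q.1) := by
    have hc : ContinuousAt (fun q : (State n × State n) × ℝ => (A q.1, q.2))
        ((0, 0), S.speed j 0) :=
      (ContinuousAt.comp (f := Prod.fst) (x := (((0 : State n), (0 : State n)), S.speed j 0))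
        hA.continuousAt continuousAt_fst).prodMk continuousAt_snd
    have h1 := hc.eventually (hA0.symm ▸ hisol j)
    have h2 : ∀ᶠ q : (State n × State n) × ℝ in 𝓝 ((0, 0), S.speed j 0),
        A q.1 (q.1.2 - q.1.1) = S.f q.1.2 - S.f q.1.1 :=
      hAd.prod_inl_nhds (S.speed j 0)
    filter_upwards [h1, h2] with q h1 h2 hne hRH
    exact h1 _ (sub_ne_zero.2 hne) (by rw [h2, hRH])
  by_cases hg : S.GenuinelyNonlinear j
  · have hnld := hg.not_linearlyDegenerate hS hN
    have hk := hN.k_pos j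
    have hgrad : ContDiffAt ℝ 2 (fderiv ℝ (S.speed j)) 0 := hspeed.fderiv_right (by norm_num)
    have hne0 : fderiv ℝ (S.speed j) 0 (S.e j) ≠ 0 :=
      hg 0 hS.zero_mem _ (hN.e_ne_zero j) (hN.e_eigen j)
    have hr : ContDiffAt ℝ 2 (fun u => (S.k j / fderiv ℝ (S.speed j) u (V j (fderiv ℝ S.f u))) •
        V j (fderiv ℝ S.f u)) 0 := by
      refine ContDiffAt.smul (contDiffAt_const.div (hgrad.clm_apply (hv.of_le (by norm_num))) ?_)
        (hv.of_le (by norm_num))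
      rw [hV0]; exact hne0
    have hBV : ContDiffAt ℝ 1 (fun p => B p (V j (A p))) (0, 0) := hB.clm_apply hVA
    have hBV0 : B (0, 0) (V j (A (0, 0))) ≠ 0 := by rw [hA0, hB0, hV0]; exact hne0
    have hNs : ContDiffAt ℝ 1 (fun p => (S.k j / B p (V j (A p))) • V j (A p)) (0, 0) :=
      ContDiffAt.smul (contDiffAt_const.div hBV hBV0) hVA
    have hBVne := hBV.continuousAt.eventually_ne hBV0
    refine ⟨⟨_, fun p => Λ j (A p), _, hr.of_le (by norm_num), ?_, fun h => absurd h hnld, ?_, ha,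
      hNs, ha_diag, hspeed, ?_, fun _ => ?_, fun _ => ?_⟩⟩
    · exact ⟨S.k j / fderiv ℝ (S.speed j) 0 (S.e j), div_ne_zero hk.ne' hne0, by simp only [hV0]⟩
    · filter_upwards [hvu] with u hu v
      have hVne : V j (fderiv ℝ S.f u) ≠ 0 := by
        intro h0
        have := hu.2.2
        simp [h0] at this
      have hd := hg u hu.1 _ hVne hu.2.1
      constructor
      · rintro ⟨h1, h2, -⟩
        have h3 := (hS.isOrderedSpectrum hu.1).eq_inner_smul hu.2.2 hu.2.1 h1
        have h4 := h2 hg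
        rw [h3, map_smul, smul_eq_mul] at h4
        rw [← h4, mul_div_assoc, div_self hd, mul_one]
        exact h3
      · rintro rfl
        refine ⟨?_, fun _ => ?_, fun h => absurd h hnld⟩
        · have := hu.2.1
          rw [IsEigenvector] at this ⊢
          rw [map_smul, this, smul_comm]
        · rw [map_smul, smul_eq_mul, div_mul_cancel₀ _ hd]
    · have h1 : ∀ᶠ q : (State n × State n) × ℝ in 𝓝 ((0, 0), S.speed j 0),
          B q.1 (q.1.2 - q.1.1) = S.speed j q.1.2 - S.speed j q.1.1 ∧ B q.1 (V j (A q.1)) ≠ 0 :=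
        (hBd.and hBVne).prod_inl_nhds (S.speed j 0)
      filter_upwards [hisol', h1] with q h1 h2 hne hRH
      obtain ⟨h3, h4⟩ := h1 hne hRH
      refine ⟨h3, fun _ => ?_, fun h => absurd h hnld⟩
      rw [← h2.1, smul_smul]
      nth_rewrite 2 [h4]
      rw [map_smul, smul_eq_mul]
      have : ⟪S.e j, q.1.2 - q.1.1⟫ * B q.1 (V j (A q.1)) / S.k j * (S.k j / B q.1 (V j (A q.1))) =
        ⟪S.e j, q.1.2 - q.1.1⟫ := by
        have := h2.2
        field_simp
      rw [this]
      exact h4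
    · filter_upwards [hAd, hBd, hBVne, hA_spec] with p h1 h2 h3 h4 s hs
      rw [← h1, ← h2, hs]
      simp only [map_smul, h4, smul_eq_mul]
      refine ⟨?_, by field_simp⟩
      simp only [smul_smul]
      congr 1
      ring
    · filter_upwards [hAdiag, hBdiag] with u h1 h2
      simp only [h1, h2]
  · have hld := hS.ld_of_not_gnl hg
    have hr : ContDiffAt ℝ 3 (fun u => (‖V j (fderiv ℝ S.f u)‖⁻¹ : ℝ) • V j (fderiv ℝ S.f u)) 0 := by
      have h0 : V j (fderiv ℝ S.f 0) ≠ 0 := by rw [hV0]; exact hN.e_ne_zero j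
      exact ((hv.norm ℝ h0).inv (norm_ne_zero_iff.2 h0)).smul hv
    refine ⟨⟨_, fun p => Λ j (A p), fun p => V j (A p), hr.of_le (by norm_num), ?_, fun _ => ?_, ?_, ha,
      hVA, ha_diag, hspeed, ?_, fun h => absurd h hg, fun h => absurd h hg⟩⟩
    · exact ⟨1, one_ne_zero, by simp only [hV0, hN.e_norm]; simp⟩
    · simp only [hV0, hN.e_norm]; simp
    · filter_upwards [hvu] with u hu v
      have hVne : V j (fderiv ℝ S.f u) ≠ 0 := by
        intro h0
        have := hu.2.2
        simp [h0] at this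
      constructor
      · rintro ⟨h1, -, h2⟩
        have h3 := (hS.isOrderedSpectrum hu.1).eq_inner_smul hu.2.2 hu.2.1 h1
        obtain ⟨h4, h5⟩ := h2 hld
        have h6 : ‖v‖ = ⟪S.e j, v⟫ * ‖V j (fderiv ℝ S.f u)‖ := by
          nth_rewrite 1 [h3]
          rw [norm_smul, Real.norm_of_nonneg h5.le]
        rw [h4] at h6
        rw [← eq_inv_of_mul_eq_one_left h6.symm]
        exact h3
      · rintro rfl
        refine ⟨?_, fun h => absurd h hg, fun _ => ⟨?_, ?_⟩⟩
        · have := hu.2.1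
          rw [IsEigenvector] at this ⊢
          rw [map_smul, this, smul_comm]
        · rw [norm_smul, norm_inv, norm_norm, inv_mul_cancel₀ (norm_ne_zero_iff.2 hVne)]
        · rw [inner_smul_right, hu.2.2, mul_one]
          exact inv_pos.2 (norm_pos_iff.2 hVne)
    · filter_upwards [hisol'] with q h1 hne hRH
      exact ⟨(h1 hne hRH).1, fun h => absurd h hg, fun _ => (h1 hne hRH).2⟩

end Data

/-! ### Continuity arguments, uniqueness for differential equations, local flows. -/

section Curves
variable {E : Type*} [NormedAddCommGroup E] [NormedSpace ℝ E]

theorem mul_mem_uIcc_zero {s θ : ℝ} (hθ : θ ∈ Icc (0 : ℝ) 1) : s * θ ∈ uIcc 0 s := by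
  rcases le_total 0 s with h | h
  · rw [uIcc_of_le h]; exact ⟨mul_nonneg h hθ.1, by nlinarith [hθ.2]⟩
  · rw [uIcc_of_ge h]; exact ⟨by nlinarith [hθ.2], mul_nonpos_of_nonpos_of_nonneg h hθ.1⟩

theorem exists_eq_mul_of_mem_uIcc_zero {s t : ℝ} (ht : t ∈ uIcc 0 s) :
    ∃ θ ∈ Icc (0 : ℝ) 1, t = s * θ := by
  rcases eq_or_ne s 0 with rfl | hs
  · exact ⟨0, by simp, by simpa using ht⟩
  · refine ⟨t / s, ?_, by field_simp⟩
    rcases le_total 0 s with h | h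
    · rw [uIcc_of_le h] at ht
      exact ⟨div_nonneg ht.1 h, div_le_one_of_le₀ ht.2 h⟩
    · rw [uIcc_of_ge h] at ht
      exact ⟨div_nonneg_of_nonpos ht.2 h, div_le_one_of_ge ht.1 h⟩

theorem uIcc_zero_subset {s t : ℝ} (ht : t ∈ uIcc 0 s) : uIcc 0 t ⊆ uIcc 0 s :=
  uIcc_subset_uIcc left_mem_uIcc ht

theorem abs_le_of_mem_uIcc_zero {s t : ℝ} (ht : t ∈ uIcc 0 s) : |t| ≤ |s| := by
  simpa using abs_sub_left_of_mem_uIcc ht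

/-- A continuity argument: a bound that improves itself holds on the whole interval. -/
theorem forall_le_half_of_continuousOn {s : ℝ} {g : ℝ → ℝ} (hg : ContinuousOn g (uIcc 0 s))
    (h0 : g 0 < 1)
    (hstep : ∀ t ∈ uIcc 0 s, (∀ t' ∈ uIcc 0 t, g t' < 1) → g t ≤ 1 / 2) :
    ∀ t ∈ uIcc 0 s, g t ≤ 1 / 2 := by
  let G : ℝ → ℝ := fun θ => g (s * θ)
  have hG : ContinuousOn G (Icc 0 1) :=
    hg.comp (by fun_prop) fun θ hθ => mul_mem_uIcc_zero hθ
  have hsub : ∀ θ ∈ Icc (0 : ℝ) 1, (∀ θ' ∈ Icc (0 : ℝ) θ, G θ' < 1) → G θ ≤ 1 / 2 := by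
    intro θ hθ h
    refine hstep _ (mul_mem_uIcc_zero hθ) fun t' ht' => ?_
    obtain ⟨θ', hθ', rfl⟩ := exists_eq_mul_of_mem_uIcc_zero ht'
    have := h (θ * θ') ⟨mul_nonneg hθ.1 hθ'.1, by nlinarith [hθ.1, hθ'.2]⟩
    rwa [mul_assoc]
  have hall : ∀ θ ∈ Icc (0 : ℝ) 1, G θ < 1 := by
    by_contra! hne
    have hcomp : IsCompact (Icc (0 : ℝ) 1 ∩ G ⁻¹' Ici 1) :=
      isCompact_Icc.of_isClosed_subset (hG.preimage_isClosed_of_isClosed isClosed_Icc isClosed_Ici)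
        inter_subset_left
    obtain ⟨θ₀, hθ₀, hmin⟩ := hcomp.exists_isLeast (by obtain ⟨θ, h1, h2⟩ := hne; exact ⟨θ, h1, h2⟩)
    have hlt : ∀ θ ∈ Ico (0 : ℝ) θ₀, G θ ≤ 1 / 2 := by
      intro θ hθ
      refine hsub θ ⟨hθ.1, hθ.2.le.trans hθ₀.1.2⟩ fun θ' hθ' => ?_
      by_contra! hcon
      exact absurd (hmin ⟨⟨hθ'.1, (hθ'.2.trans hθ.2.le).trans hθ₀.1.2⟩, hcon⟩)
        (not_le.2 (hθ'.2.trans_lt hθ.2))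
    have hG0 : G 0 < 1 := by simpa [G] using h0
    have hG0' : G 0 ≤ 1 / 2 := hsub 0 (by simp) fun θ' hθ' => by
      have : θ' = 0 := le_antisymm hθ'.2 hθ'.1
      rwa [this]
    have h1 : (1 : ℝ) ≤ G θ₀ := hθ₀.2
    -- Before the first `θ₀` with `G θ₀ ≥ 1` one has `G ≤ 1 / 2`, so the intermediate value `3 / 4`
    -- cannot be taken.
    obtain ⟨θ, hθ, hθv⟩ := intermediate_value_Icc hθ₀.1.1
      (hG.mono (Icc_subset_Icc_right hθ₀.1.2)) (show (3 / 4 : ℝ) ∈ Icc (G 0) (G θ₀) from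
        ⟨by linarith, by linarith⟩)
    have hne : θ ≠ θ₀ := by rintro rfl; linarith
    have := hlt θ ⟨hθ.1, lt_of_le_of_ne hθ.2 hne⟩
    linarith
  intro t ht
  obtain ⟨θ, hθ, rfl⟩ := exists_eq_mul_of_mem_uIcc_zero ht
  exact hsub θ hθ fun θ' hθ' => hall θ' ⟨hθ'.1, hθ'.2.trans hθ.2⟩

/-- The substitution `t = s * θ` brings both signs of `s` to the interval `[0, 1]`, so that
uniqueness forward in time also covers backward curves. -/
theorem hasDerivWithinAt_rescale {s : ℝ} {c c' : ℝ → E}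
    (hc : ∀ t ∈ uIcc 0 s, HasDerivWithinAt c (c' t) (uIcc 0 s) t) {θ : ℝ}
    (hθ : θ ∈ Icc (0 : ℝ) 1) :
    HasDerivWithinAt (fun θ => c (s * θ)) (s • c' (s * θ)) (Icc 0 1) θ := by
  have h1 : HasDerivWithinAt (fun θ : ℝ => s * θ) s (Icc 0 1) θ := by
    simpa using ((hasDerivAt_id θ).const_mul s).hasDerivWithinAt
  exact (hc _ (mul_mem_uIcc_zero hθ)).scomp θ h1 fun θ hθ => mul_mem_uIcc_zero hθ

/-- Uniqueness for an autonomous equation, on either side of the initial time. -/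
theorem eqOn_uIcc_of_hasDerivWithinAt {r : E → E} {K : NNReal} {U : Set E}
    (hr : LipschitzOnWith K r U) {s : ℝ} {c d : ℝ → E}
    (hc : ∀ t ∈ uIcc 0 s, HasDerivWithinAt c (r (c t)) (uIcc 0 s) t) (hcU : ∀ t ∈ uIcc 0 s, c t ∈ U)
    (hd : ∀ t ∈ uIcc 0 s, HasDerivWithinAt d (r (d t)) (uIcc 0 s) t) (hdU : ∀ t ∈ uIcc 0 s, d t ∈ U)
    (h0 : c 0 = d 0) : EqOn c d (uIcc 0 s) := by
  have hlip : LipschitzOnWith (‖s‖₊ * K) (fun x => s • r x) U := by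
    intro x hx y hy
    rw [edist_smul₀, ENNReal.smul_def, smul_eq_mul, ENNReal.coe_mul, mul_assoc]
    gcongr
    exact hr hx hy
  have key : ∀ {c : ℝ → E}, (∀ t ∈ uIcc 0 s, HasDerivWithinAt c (r (c t)) (uIcc 0 s) t) →
      ContinuousOn (fun θ => c (s * θ)) (Icc 0 1) ∧ ∀ θ ∈ Ico (0 : ℝ) 1,
        HasDerivWithinAt (fun θ => c (s * θ)) (s • r (c (s * θ))) (Ici θ) θ := by
    intro c hc
    have := fun θ (hθ : θ ∈ Icc (0 : ℝ) 1) => hasDerivWithinAt_rescale hc hθ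
    exact ⟨fun θ hθ => (this θ hθ).continuousWithinAt, fun θ hθ =>
      (this θ ⟨hθ.1, hθ.2.le⟩).mono_of_mem_nhdsWithin (Icc_mem_nhdsGE_of_mem hθ)⟩
  intro t ht
  obtain ⟨θ, hθ, rfl⟩ := exists_eq_mul_of_mem_uIcc_zero ht
  exact ODE_solution_unique_of_mem_Icc_right (v := fun _ x => s • r x) (s := fun _ => U)
    (fun _ _ => hlip) (key hc).1 (key hc).2 (fun θ hθ => hcU _ (mul_mem_uIcc_zero ⟨hθ.1, hθ.2.le⟩))
    (key hd).1 (key hd).2 (fun θ hθ => hdU _ (mul_mem_uIcc_zero ⟨hθ.1, hθ.2.le⟩))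
    (by simpa using h0) hθ

/-- The local flow of a `C¹` vector field near `0`, written as `u + s • Z s u` with `Z` Lipschitz. -/
theorem exists_local_flow [CompleteSpace E] {r : E → E} (hr : ContDiffAt ℝ 1 r 0) {R : ℝ}
    (hR : 0 < R) :
    ∃ ρ > 0, ∃ L : ℝ, ∃ φ Z : ℝ → E → E,
      (∀ u s, ‖u‖ ≤ ρ → |s| ≤ ρ → ‖φ s u‖ < R ∧ φ s u = u + s • Z s u ∧
        HasDerivAt (fun t => φ t u) (r (φ s u)) s) ∧
      (∀ u, ‖u‖ ≤ ρ → φ 0 u = u) ∧ (∀ u, ‖u‖ ≤ ρ → Z 0 u = r u) ∧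
      (∀ u w s t, ‖u‖ ≤ ρ → ‖w‖ ≤ ρ → |s| ≤ ρ → |t| ≤ ρ →
        ‖Z s u - Z t w‖ ≤ L * (|s - t| + ‖u - w‖)) ∧
      (∀ (u : E) (s : ℝ) (c c' : ℝ → E), ‖u‖ ≤ ρ → |s| ≤ ρ → c 0 = u →
        (∀ t ∈ uIcc 0 s, HasDerivWithinAt c (c' t) (uIcc 0 s) t ∧ (‖c t‖ < R → c' t = r (c t))) →
        ∀ t ∈ uIcc 0 s, c t = φ t u) := by
  obtain ⟨K, U, hU, hlip⟩ := hr.exists_lipschitzOnWith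
  obtain ⟨R₁, hR₁, hR₁U⟩ := Metric.mem_nhds_iff.1 hU
  set R₀ := min R R₁ with hR₀
  have hR₀pos : 0 < R₀ := lt_min hR hR₁
  have hball : ∀ x : E, ‖x‖ < R₀ → x ∈ U := fun x hx =>
    hR₁U (by simpa using hx.trans_le (min_le_right _ _))
  set M := K * R₀ + ‖r 0‖ with hM
  have hM0 : 0 ≤ M := by positivity
  have hbd : ∀ x : E, ‖x‖ < R₀ → ‖r x‖ ≤ M := by
    intro x hx
    have h1 := hlip.norm_sub_le (hball x hx) (hball 0 (by simpa using hR₀pos))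
    have h2 : ‖r x‖ ≤ ‖r x - r 0‖ + ‖r 0‖ := by simpa using norm_add_le (r x - r 0) (r 0)
    have h3 : (K : ℝ) * ‖x - 0‖ ≤ K * R₀ := by
      rw [sub_zero]; gcongr
    linarith
  obtain ⟨ε, hε, a, r', L₁, K₁, hr', hpl⟩ := IsPicardLindelof.of_contDiffAt_one hr
  obtain ⟨α, hα, L', hL'⟩ :=
    (hpl 0).exists_forall_mem_closedBall_eq_hasDerivWithinAt_lipschitzOnWith
  simp only [zero_sub, zero_add] at hα hL'
  have hα0 := hα 0 (Metric.mem_closedBall_self r'.2)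
  have hcont : ContinuousAt (α 0) 0 :=
    ((hα0.2 0 ⟨by linarith, hε.le⟩).continuousWithinAt).continuousAt
      (Icc_mem_nhds (by linarith) hε)
  have hev : ∀ᶠ t in 𝓝 (0 : ℝ), ‖α 0 t‖ < R₀ / 4 := by
    have := hcont.norm.eventually_lt (continuousAt_const (y := R₀ / 4))
      (by rw [hα0.1]; simpa using hR₀pos)
    exact this
  obtain ⟨δ, hδ, hδs⟩ := Metric.eventually_nhds_iff.1 hev
  -- The last entry gives `L' * ρ ≤ R₀ / 4`. Together with `‖α 0 t‖ < R₀ / 4` it keeps the flow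
  -- within `R₀ / 2`, as the continuity argument below requires.
  set ρ := min (min (δ / 2) (ε / 2)) (min r' (R₀ / (4 * (L' + 1)))) with hρ
  have hρpos : 0 < ρ := by
    refine lt_min (lt_min (by linarith) (by linarith)) (lt_min (by exact_mod_cast hr') ?_)
    positivity
  have hρδ : ρ < δ := ((min_le_left _ _).trans (min_le_left _ _)).trans_lt (by linarith)
  have hρε : ρ < ε := ((min_le_left _ _).trans (min_le_right _ _)).trans_lt (by linarith)
  have hρr : ρ ≤ r' := (min_le_right _ _).trans (min_le_left _ _)
  have hρR : L' * ρ ≤ R₀ / 4 := by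
    have h1 : ρ ≤ R₀ / (4 * (L' + 1)) := (min_le_right _ _).trans (min_le_right _ _)
    have h2 : (0 : ℝ) < L' + 1 := by positivity
    rw [le_div_iff₀ (by positivity)] at h1
    nlinarith [L'.2]
  have hmem : ∀ u : E, ‖u‖ ≤ ρ → u ∈ Metric.closedBall (0 : E) r' := fun u hu => by
    simpa using hu.trans hρr
  have htm : ∀ t : ℝ, |t| ≤ ρ → t ∈ Icc (-ε) ε := fun t ht => abs_le.1 (ht.trans hρε.le)
  have hLu : ∀ u w : E, ∀ t : ℝ, ‖u‖ ≤ ρ → ‖w‖ ≤ ρ → |t| ≤ ρ →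
      ‖α u t - α w t‖ ≤ L' * ‖u - w‖ := fun u w t hu hw ht =>
    (hL' t (htm t ht)).norm_sub_le (hmem u hu) (hmem w hw)
  have hsmall : ∀ (u : E) (t : ℝ), ‖u‖ ≤ ρ → |t| ≤ ρ → ‖α u t‖ < R₀ := by
    intro u t hu ht
    have h1 := hLu u 0 t hu (by simpa using hρpos.le) ht
    have h2 : ‖α 0 t‖ < R₀ / 4 := hδs (by simpa using ht.trans_lt hρδ)
    have h3 : ‖α u t‖ ≤ ‖α u t - α 0 t‖ + ‖α 0 t‖ := by
      simpa using norm_add_le (α u t - α 0 t) (α 0 t)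
    have h4 : (L' : ℝ) * ‖u - 0‖ ≤ L' * ρ := by rw [sub_zero]; gcongr
    linarith
  have hder : ∀ (u : E) (t : ℝ), ‖u‖ ≤ ρ → |t| ≤ ρ → HasDerivAt (α u) (r (α u t)) t := by
    intro u t hu ht
    refine ((hα u (hmem u hu)).2 t (htm t ht)).hasDerivAt (Icc_mem_nhds ?_ ?_)
    · linarith [(abs_le.1 ht).1]
    · linarith [(abs_le.1 ht).2]
  have hLt : ∀ (u : E) (s t : ℝ), ‖u‖ ≤ ρ → |s| ≤ ρ → |t| ≤ ρ →
      ‖α u s - α u t‖ ≤ M * |s - t| := by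
    intro u s t hu hs ht
    exact (convex_Icc (-ρ) ρ).norm_image_sub_le_of_norm_hasDerivWithin_le
      (fun x hx => (hder u x hu (abs_le.2 hx)).hasDerivWithinAt)
      (fun x hx => hbd _ (hsmall u x hu (abs_le.2 hx))) (abs_le.1 ht) (abs_le.1 hs)
  have hsc : ∀ (s θ : ℝ), |s| ≤ ρ → θ ∈ Icc (0 : ℝ) 1 → |s * θ| ≤ ρ := fun s θ hs hθ =>
    (abs_le_of_mem_uIcc_zero (mul_mem_uIcc_zero hθ)).trans hs
  have hrc : ∀ (u : E) (s : ℝ), ‖u‖ ≤ ρ → |s| ≤ ρ →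
      IntervalIntegrable (fun θ => r (α u (s * θ))) volume 0 1 := by
    intro u s hu hs
    refine ContinuousOn.intervalIntegrable ?_
    rw [uIcc_of_le zero_le_one]
    refine hlip.continuousOn.comp (fun θ hθ => ?_) fun θ hθ => hball _ (hsmall u _ hu (hsc s θ hs hθ))
    exact ((hder u _ hu (hsc s θ hs hθ)).continuousAt.comp (f := fun θ => s * θ)
      (by fun_prop)).continuousWithinAt
  -- `Z s u` is the mean velocity along the trajectory. It makes sense at `s = 0` and inherits a
  -- Lipschitz bound from `r` and from the flow.
  refine ⟨ρ, hρpos, K * (M + L'), fun s u => α u s, fun s u => ∫ θ in (0 : ℝ)..1, r (α u (s * θ)),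
    fun u s hu hs => ⟨(hsmall u s hu hs).trans_le (min_le_left _ _), ?_, hder u s hu hs⟩,
    fun u hu => (hα u (hmem u hu)).1, fun u hu => ?_, ?_, ?_⟩
  · rw [← intervalIntegral.integral_smul,
      intervalIntegral.integral_eq_sub_of_hasDerivAt (f := fun θ => α u (s * θ))]
    · simp [(hα u (hmem u hu)).1]
    · intro θ hθ
      rw [uIcc_of_le zero_le_one] at hθ
      have h1 : HasDerivAt (fun θ : ℝ => s * θ) s θ := by
        simpa using (hasDerivAt_id θ).const_mul s
      exact (hder u _ hu (hsc s θ hs hθ)).scomp θ h1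
    · exact (hrc u s hu hs).smul s
  · simp [(hα u (hmem u hu)).1]
  · intro u w s t hu hw hs ht
    rw [← intervalIntegral.integral_sub (hrc u s hu hs) (hrc w t hw ht)]
    have : ∀ θ ∈ uIoc (0 : ℝ) 1, ‖r (α u (s * θ)) - r (α w (t * θ))‖ ≤
        K * (M + L') * (|s - t| + ‖u - w‖) := by
      intro θ hθ
      rw [uIoc_of_le zero_le_one] at hθ
      have hθ' : θ ∈ Icc (0 : ℝ) 1 := ⟨hθ.1.le, hθ.2⟩
      have h1 := hlip.norm_sub_le (hball _ (hsmall u _ hu (hsc s θ hs hθ')))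
        (hball _ (hsmall w _ hw (hsc t θ ht hθ')))
      have h2 := hLt u _ _ hu (hsc s θ hs hθ') (hsc t θ ht hθ')
      have h3 := hLu u w _ hu hw (hsc t θ ht hθ')
      have h4 : |s * θ - t * θ| ≤ |s - t| := by
        rw [← sub_mul, abs_mul, abs_of_nonneg hθ'.1]
        exact mul_le_of_le_one_right (abs_nonneg _) hθ'.2
      have h5 : ‖α u (s * θ) - α w (t * θ)‖ ≤ M * |s - t| + L' * ‖u - w‖ := by
        have := norm_add_le (α u (s * θ) - α u (t * θ)) (α u (t * θ) - α w (t * θ))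
        rw [sub_add_sub_cancel] at this
        nlinarith
      calc _ ≤ K * ‖α u (s * θ) - α w (t * θ)‖ := h1
        _ ≤ K * (M * |s - t| + L' * ‖u - w‖) := by gcongr
        _ ≤ K * ((M + L') * (|s - t| + ‖u - w‖)) := by
          gcongr
          nlinarith [mul_nonneg hM0 (norm_nonneg (u - w)), mul_nonneg L'.coe_nonneg (abs_nonneg (s - t))]
        _ = _ := by ring
    simpa using intervalIntegral.norm_integral_le_of_norm_le_const this
  · intro u s c c' hu hs hc0 hc
    have hφ : ∀ t ∈ uIcc 0 s, |t| ≤ ρ := fun t ht => (abs_le_of_mem_uIcc_zero ht).trans hs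
    have hunique : ∀ t ∈ uIcc 0 s, (∀ t' ∈ uIcc 0 t, ‖c t'‖ < R₀) → c t = α u t := by
      intro t ht hlt
      have hsub := uIcc_zero_subset ht
      refine eqOn_uIcc_of_hasDerivWithinAt (hlip.mono fun x (hx : ‖x‖ < R₀) => hball x hx)
        (fun t' ht' => ?_) hlt
        (fun t' ht' => (hder u t' hu (hφ t' (hsub ht'))).hasDerivWithinAt)
        (fun t' ht' => hsmall u t' hu (hφ t' (hsub ht'))) (by rw [hc0, (hα u (hmem u hu)).1])
        right_mem_uIcc
      have := hc t' (hsub ht')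
      rw [← this.2 ((hlt t' ht').trans_le (min_le_left _ _))]
      exact this.1.mono hsub
    have hR₀' : ∀ (u : E) (t : ℝ), ‖u‖ ≤ ρ → |t| ≤ ρ → ‖α u t‖ ≤ R₀ / 2 := by
      intro u t hu ht
      have h1 := hLu u 0 t hu (by simpa using hρpos.le) ht
      have h2 : ‖α 0 t‖ < R₀ / 4 := hδs (by simpa using ht.trans_lt hρδ)
      have h3 : ‖α u t‖ ≤ ‖α u t - α 0 t‖ + ‖α 0 t‖ := by
        simpa using norm_add_le (α u t - α 0 t) (α 0 t)
      have h4 : (L' : ℝ) * ‖u - 0‖ ≤ L' * ρ := by rw [sub_zero]; gcongr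
      linarith
    -- A competing curve is known to solve the equation only inside the ball of radius `R`. While it
    -- stays within `R₀` it agrees with the flow, hence lies within `R₀ / 2`, and so it never
    -- leaves.
    have hboot := forall_le_half_of_continuousOn (s := s) (g := fun t => ‖c t‖ / R₀)
      (fun t ht => ((hc t ht).1.continuousWithinAt.norm).div_const _) ?_ ?_
    · intro t ht
      refine hunique t ht fun t' ht' => ?_
      have := hboot t' (uIcc_zero_subset ht ht')
      rw [div_le_iff₀ hR₀pos] at this
      linarith
    · have h1 := hsmall u 0 hu (by simpa using hρpos.le)
      rw [(hα u (hmem u hu)).1] at h1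
      simp only [hc0]
      rwa [div_lt_one hR₀pos]
    · intro t ht hlt
      rw [hunique t ht fun t' ht' => (div_lt_one hR₀pos).1 (hlt t' ht'), div_le_iff₀ hR₀pos]
      linarith [hR₀' u t hu (hφ t ht)]

end Curves

section Radii
variable {E F : Type*} [NormedAddCommGroup E] [NormedAddCommGroup F]

theorem exists_radius {P : E → Prop} (h : ∀ᶠ u in 𝓝 (0 : E), P u) :
    ∃ ρ > 0, ∀ u, ‖u‖ ≤ ρ → P u := by
  obtain ⟨ρ, hρ, h⟩ := Metric.eventually_nhds_iff.1 h
  exact ⟨ρ / 2, by positivity, fun u hu => h (by rw [dist_zero_right]; linarith)⟩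

theorem exists_radius₂ {P : E × F → Prop} (h : ∀ᶠ p in 𝓝 ((0, 0) : E × F), P p) :
    ∃ ρ > 0, ∀ u w, ‖u‖ ≤ ρ → ‖w‖ ≤ ρ → P (u, w) := by
  obtain ⟨ρ, hρ, h⟩ := exists_radius (E := E × F) h
  exact ⟨ρ, hρ, fun u w hu hw => h _ (max_le hu hw)⟩

end Radii

/-! ### Rarefaction curves, and shock curves of genuinely nonlinear fields. -/

namespace Data
variable {n : ℕ} {S : Data n}

/-- `Z` describes the curves `s ↦ u + s • Z s u`, for `s` and `u` smaller than `ρ`, and is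
Lipschitz continuous. -/
def LipschitzCurve {E : Type*} [NormedAddCommGroup E] (ρ L : ℝ) (Z : ℝ → E → E) : Prop :=
  ∀ u w s t, ‖u‖ ≤ ρ → ‖w‖ ≤ ρ → |s| ≤ ρ → |t| ≤ ρ → ‖Z s u - Z t w‖ ≤ L * (|s - t| + ‖u - w‖)

theorem LipschitzCurve.mono {E : Type*} [NormedAddCommGroup E] {ρ ρ' L L' : ℝ} {Z : ℝ → E → E}
    (h : LipschitzCurve ρ L Z) (hρ : ρ' ≤ ρ) (hL : L ≤ L') : LipschitzCurve ρ' L' Z :=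
  fun u w s t hu hw hs ht => (h u w s t (hu.trans hρ) (hw.trans hρ) (hs.trans hρ)
    (ht.trans hρ)).trans (by gcongr)

theorem exists_rarefaction (hS : S.Admissible) {j : Fin n} (D : LocalField S j) :
    ∃ ρ > 0, ∃ L : ℝ, ∃ φ Z : ℝ → State n → State n,
      (∀ u s, ‖u‖ ≤ ρ → |s| ≤ ρ → φ s u = u + s • Z s u ∧ φ s u ∈ S.Ω ∧
        S.IsRightEigenvector j (φ s u) (D.r (φ s u)) ∧
        HasDerivAt (fun t => φ t u) (D.r (φ s u)) s) ∧
      (∀ u, ‖u‖ ≤ ρ → φ 0 u = u ∧ Z 0 u = D.r u) ∧ LipschitzCurve ρ L Z ∧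
      (∀ (u : State n) (s : ℝ) (c c' : ℝ → State n), ‖u‖ ≤ ρ → |s| ≤ ρ → c 0 = u →
        (∀ t ∈ uIcc 0 s, c t ∈ S.Ω ∧ HasDerivWithinAt c (c' t) (uIcc 0 s) t ∧
          S.IsRightEigenvector j (c t) (c' t)) → ∀ t ∈ uIcc 0 s, c t = φ t u) ∧
      (∀ u s w, ‖u‖ ≤ ρ → |s| ≤ ρ → (S.IsRarefaction j s u w ↔ w = φ s u)) ∧
      (∀ u s t, ‖u‖ ≤ ρ → |s| ≤ ρ → |t| ≤ ρ → |s + t| ≤ ρ → ‖φ s u‖ ≤ ρ →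
        φ t (φ s u) = φ (s + t) u) := by
  obtain ⟨R, hR, hRp⟩ := exists_radius (D.r_iff.and hS.mem_nhds)
  obtain ⟨ρ, hρ, L, φ, Z, h1, h2, h3, h4, h5⟩ := exists_local_flow D.r_contDiffAt hR
  have huniq : ∀ (u : State n) (s : ℝ) (c c' : ℝ → State n), ‖u‖ ≤ ρ → |s| ≤ ρ → c 0 = u →
        (∀ t ∈ uIcc 0 s, c t ∈ S.Ω ∧ HasDerivWithinAt c (c' t) (uIcc 0 s) t ∧
          S.IsRightEigenvector j (c t) (c' t)) → ∀ t ∈ uIcc 0 s, c t = φ t u :=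
    fun u s c c' hu hs hc0 hc => h5 u s c c' hu hs hc0 fun t ht =>
      ⟨(hc t ht).2.1, fun hR => ((hRp _ hR.le).1 _).1 (hc t ht).2.2⟩
  have hcur : ∀ u s, ‖u‖ ≤ ρ → |s| ≤ ρ → φ s u = u + s • Z s u ∧ φ s u ∈ S.Ω ∧
        S.IsRightEigenvector j (φ s u) (D.r (φ s u)) ∧
        HasDerivAt (fun t => φ t u) (D.r (φ s u)) s := by
    intro u s hu hs
    have h := h1 u s hu hs
    exact ⟨h.2.1, (hRp _ h.1.le).2, ((hRp _ h.1.le).1 _).2 rfl, h.2.2⟩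
  refine ⟨ρ, hρ, L, φ, Z, hcur, fun u hu => ⟨h2 u hu, h3 u hu⟩,
    fun u w s t hu hw hs ht => h4 u w s t hu hw hs ht, huniq, fun u s w hu hs => ⟨?_, ?_⟩, ?_⟩
  · rintro ⟨c, c', hc0, rfl, hc⟩
    exact huniq u s c c' hu hs hc0 hc s right_mem_uIcc
  · rintro rfl
    refine ⟨fun t => φ t u, fun t => D.r (φ t u), h2 u hu, rfl, fun t ht => ?_⟩
    have h := hcur u t hu ((abs_le_of_mem_uIcc_zero ht).trans hs)
    exact ⟨h.2.1, h.2.2.2.hasDerivWithinAt, h.2.2.1⟩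
  · intro u s t hu hs ht hst hφ
    have hmem : ∀ τ ∈ uIcc 0 t, |s + τ| ≤ ρ := by
      intro τ hτ
      rcases le_total 0 t with h | h
      · rw [uIcc_of_le h] at hτ
        exact abs_le.2 ⟨by linarith [(abs_le.1 hs).1, hτ.1], by linarith [(abs_le.1 hst).2, hτ.2]⟩
      · rw [uIcc_of_ge h] at hτ
        exact abs_le.2 ⟨by linarith [(abs_le.1 hst).1, hτ.1], by linarith [(abs_le.1 hs).2, hτ.2]⟩
    refine (huniq (φ s u) t (fun τ => φ (s + τ) u) (fun τ => D.r (φ (s + τ) u)) hφ ht (by simp)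
      (fun τ hτ => ?_) t right_mem_uIcc).symm
    have h := hcur u (s + τ) hu (hmem τ hτ)
    exact ⟨h.2.1, (h.2.2.2.comp_const_add s τ).hasDerivWithinAt, h.2.2.1⟩

/-- Continuity of `g` is enough. This yields the initial tangent of a curve written as `u + t • Z t
u`. -/
theorem hasDerivAt_smul_self_zero {E : Type*} [NormedAddCommGroup E] [NormedSpace ℝ E]
    {g : ℝ → E} (hg : ContinuousAt g 0) : HasDerivAt (fun t => t • g t) (g 0) 0 := by
  rw [hasDerivAt_iff_tendsto_slope]
  refine (hg.tendsto.mono_left nhdsWithin_le_nhds).congr' ?_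
  filter_upwards [self_mem_nhdsWithin] with t (ht : t ≠ 0)
  simp [slope, ht]

/-- The shock curve is the implicit solution `w = W (s, u)` of `w - u = s • N (u, w)`; at `s = 0`
the derivative in `w` is the identity. Conversely, a curve as in `IsShock` solves this equation with
`s` equal to its own parameter, because both are measured by `λ_j`, as long as its points and its
speed stay close to `0` and `λ_j(0)`. A continuity argument shows that they do. -/
theorem exists_shock_of_gnl (hS : S.Admissible) (hN : S.Normalized) {j : Fin n}
    (D : LocalField S j) (hg : S.GenuinelyNonlinear j) :
    ∃ ρ > 0, ∃ L : ℝ, ∃ Z : ℝ → State n → State n,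
      (∀ u, ‖u‖ ≤ ρ → Z 0 u = D.r u) ∧ LipschitzCurve ρ L Z ∧
      (∀ u s w, ‖u‖ ≤ ρ → |s| ≤ ρ → (S.IsShock j s u w ↔ w = u + s • Z s u)) := by
  have hnld := hg.not_linearlyDegenerate hS hN
  have hk := hN.k_pos j
  let F : (ℝ × State n) × State n → State n := fun q => q.2 - q.1.2 - q.1.1 • D.N (q.1.2, q.2)
  let o : (ℝ × State n) × State n := ((0, 0), 0)
  have hNc : ContDiffAt ℝ 1 (fun q : (ℝ × State n) × State n => D.N (q.1.2, q.2)) o :=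
    ContDiffAt.comp o (g := D.N) D.N_contDiffAt
      (contDiffAt_fst.snd.prodMk contDiffAt_snd)
  have hF : ContDiffAt ℝ 1 F o := by
    refine ContDiffAt.sub (contDiffAt_snd.sub contDiffAt_fst.snd) (ContDiffAt.smul contDiffAt_fst.fst hNc)
  have hF2 : fderiv ℝ F o ∘L .inr ℝ _ _ = ContinuousLinearMap.id ℝ (State n) := by
    have h1 : HasFDerivAt (fun w : State n => F ((0, 0), w)) (fderiv ℝ F o ∘L .inr ℝ _ _) 0 :=
      (hF.differentiableAt (by norm_num)).hasFDerivAt.comp (0 : State n)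
        (hasFDerivAt_prodMk_right ((0 : ℝ), (0 : State n)) (0 : State n))
    have h2 : HasFDerivAt (fun w : State n => F ((0, 0), w)) (ContinuousLinearMap.id ℝ (State n)) 0 := by
      simpa [F] using (show HasFDerivAt (fun w : State n => w) (ContinuousLinearMap.id ℝ (State n)) 0
        from hasFDerivAt_id (0 : State n))
    exact h1.unique h2
  have hinv : (fderiv ℝ F o ∘L .inr ℝ _ _).IsInvertible := by
    rw [hF2]; exact ⟨ContinuousLinearEquiv.refl ℝ _, rfl⟩
  let W := hF.implicitFunction (by norm_num) hinv
  have hW : ContDiffAt ℝ 1 W (0, 0) := hF.contDiffAt_implicitFunction (by norm_num) hinv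
  have hW0 : W (0, 0) = 0 := hF.implicitFunction_apply_self (by norm_num) hinv
  have hFo : F o = 0 := by simp [F, o]
  have hWeq : ∀ᶠ p in 𝓝 ((0 : ℝ), (0 : State n)), W p = p.2 + p.1 • D.N (p.2, W p) := by
    filter_upwards [hF.eventually_apply_implicitFunction (by norm_num) hinv] with p hp
    have hp' : W p - p.2 - p.1 • D.N (p.2, W p) = 0 := hp.trans hFo
    rw [sub_sub, sub_eq_zero] at hp'
    exact hp'
  have hWuniq : ∀ᶠ q : (ℝ × State n) × State n in 𝓝 o,
      q.2 - q.1.2 = q.1.1 • D.N (q.1.2, q.2) → W q.1 = q.2 := by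
    filter_upwards [hF.eventually_apply_eq_iff_implicitFunction (by norm_num) hinv] with q hq h
    exact hq.1 (by rw [hFo]; simp only [F]; rw [h, sub_self])
  have hpair : ContDiffAt ℝ 1 (fun p : ℝ × State n => (p.2, W p)) (0, 0) :=
    contDiffAt_snd.prodMk hW
  have hpair0 : Tendsto (fun p : ℝ × State n => (p.2, W p)) (𝓝 (0, 0)) (𝓝 (0, 0)) := by
    simpa [ContinuousAt, hW0] using hpair.continuousAt
  have hZ : ContDiffAt ℝ 1 (fun p : ℝ × State n => D.N (p.2, W p)) (0, 0) :=
    ContDiffAt.comp ((0 : ℝ), (0 : State n)) (g := D.N) (by rw [hW0]; exact D.N_contDiffAt) hpair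
  have ha : ContDiffAt ℝ 1 (fun p : ℝ × State n => D.a (p.2, W p)) (0, 0) :=
    ContDiffAt.comp ((0 : ℝ), (0 : State n)) (g := D.a) (by rw [hW0]; exact D.a_contDiffAt) hpair
  obtain ⟨K, U, hU, hlip⟩ := hZ.exists_lipschitzOnWith
  obtain ⟨R₁, hR₁, hiso⟩ : ∃ R > 0, ∀ (u w : State n) (a : ℝ), ‖u‖ < R → ‖w‖ < R →
      |a - S.speed j 0| < R → w ≠ u → S.f w - S.f u = a • (w - u) → a = D.a (u, w) ∧
        w - u = ((S.speed j w - S.speed j u) / S.k j) • D.N (u, w) := by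
    obtain ⟨R, hR, h⟩ := Metric.eventually_nhds_iff.1 D.isolated
    refine ⟨R, hR, fun u w a hu hw ha hne hRH => ?_⟩
    have := @h ((u, w), a) (by
      simp only [Prod.dist_eq, dist_zero_right, Real.dist_eq]
      exact max_lt (max_lt hu hw) ha) hne hRH
    exact ⟨this.1, this.2.1 hg⟩
  obtain ⟨R₂, hR₂, huni⟩ : ∃ R > 0, ∀ (s : ℝ) (u w : State n), |s| < R → ‖u‖ < R → ‖w‖ < R →
      w - u = s • D.N (u, w) → W (s, u) = w := by
    obtain ⟨R, hR, h⟩ := Metric.eventually_nhds_iff.1 hWuniq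
    refine ⟨R, hR, fun s u w hs hu hw => ?_⟩
    exact @h ((s, u), w) (by
      simp only [o, Prod.dist_eq, dist_zero_right]
      exact max_lt (max_lt hs hu) hw)
  set R := min R₁ R₂ with hRdef
  have hR : 0 < R := lt_min hR₁ hR₂
  have hevu : ∀ {P : State n → Prop}, (∀ᶠ u in 𝓝 0, P u) →
      ∀ᶠ p : ℝ × State n in 𝓝 (0, 0), P p.2 := fun h => h.prod_inr_nhds 0
  have hWsm : ∀ᶠ p : ℝ × State n in 𝓝 (0, 0), ‖W p‖ < R / 2 :=
    hW.continuousAt.norm.eventually_lt continuousAt_const (by rw [hW0]; simpa using hR)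
  have hasm : ∀ᶠ p : ℝ × State n in 𝓝 (0, 0), |D.a (p.2, W p) - S.speed j 0| < R / 2 := by
    refine ContinuousAt.eventually_lt (ha.continuousAt.sub continuousAt_const).abs
      continuousAt_const ?_
    rw [hW0, D.a_diag.self_of_nhds]
    simpa using hR
  have hWu : ∀ᶠ u in 𝓝 (0 : State n), W (0, u) = u := by
    have : Tendsto (fun u : State n => ((0 : ℝ), u)) (𝓝 0) (𝓝 (0, 0)) :=
      (Continuous.prodMk_right (0 : ℝ)).tendsto 0
    filter_upwards [this.eventually hWeq] with u hu
    simpa using hu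
  have hΩ : ∀ᶠ p : ℝ × State n in 𝓝 (0, 0), W p ∈ S.Ω :=
    hW.continuousAt.eventually (by rw [hW0]; exact hS.mem_nhds)
  have hZev := hZ.eventually (by simp)
  have haev := ha.eventually (by simp)
  obtain ⟨ρ₀, hρ₀, hall⟩ := exists_radius₂ (hWeq.and <| (hpair0.eventually (D.hugoniot hg)).and <|
    (hW.eventually (by simp)).and <| hWsm.and <| hasm.and <| hΩ.and <| (hevu hWu).and <|
    (hevu (D.N_diag hg)).and <| (hevu D.r_iff).and <| (hevu D.a_diag).and <| haev.and <|
    hZev.and hU)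
  set ρ := min ρ₀ (R / 2) with hρdef
  have hρ : 0 < ρ := lt_min hρ₀ (by positivity)
  have hall' : ∀ {s : ℝ} {u : State n}, |s| ≤ ρ → ‖u‖ ≤ ρ → _ := fun {s u} hs hu =>
    hall s u (hs.trans (min_le_left _ _)) (hu.trans (min_le_left _ _))
  have hzero : |(0 : ℝ)| ≤ ρ := by simpa using hρ.le
  refine ⟨ρ, hρ, K, fun s u => D.N (u, W (s, u)), fun u hu => ?_, ?_, fun u s w hu hs => ⟨?_, ?_⟩⟩
  · obtain ⟨-, -, -, -, -, -, h7, h8, -⟩ := hall' hzero hu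
    simp only at h7 h8 ⊢
    rw [h7, h8]
  · intro u w s t hu hw hs ht
    have h1 := (hall' hs hu).2.2.2.2.2.2.2.2.2.2.2.2
    have h2 := (hall' ht hw).2.2.2.2.2.2.2.2.2.2.2.2
    refine (hlip.norm_sub_le h1 h2).trans ?_
    gcongr
    rw [Prod.mk_sub_mk, Prod.norm_mk]
    exact max_le (by simp) (by simp)
  · rintro ⟨c, c', a, hc0, rfl, ha0, hr, hac, -, hc⟩
    have hle : ∀ t ∈ uIcc 0 s, |t| ≤ ρ := fun t ht => (abs_le_of_mem_uIcc_zero ht).trans hs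
    have hcc : ContinuousOn c (uIcc 0 s) := fun t ht => (hc t ht).2.1.continuousWithinAt
    have hon : ∀ t ∈ uIcc 0 s, ‖c t‖ < R → |a t - S.speed j 0| < R →
        c t = W (t, u) ∧ a t = D.a (u, W (t, u)) := by
      intro t ht hct hat
      obtain ⟨-, -, hRH, hsp, -⟩ := hc t ht
      have hsp := hsp hg
      obtain ⟨-, -, -, -, -, -, h7, -, -, h10, -⟩ := hall' (hle t ht) hu
      simp only at h7 h10
      -- At the state `u` itself the Rankine-Hugoniot condition says nothing about the speed. But
      -- the growth of `λ_j` at rate `k_j > 0` allows `c t = u` only for `t = 0`, where `a 0` is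
      -- prescribed.
      by_cases hne : c t = u
      · rw [hne] at hsp
        have ht0 : t = 0 := by
          have : S.k j * t = 0 := by linarith
          exact (mul_eq_zero.1 this).resolve_left hk.ne'
        subst ht0
        exact ⟨by rw [hne, h7], by rw [ha0, h7, h10]⟩
      · have huR : ‖u‖ < R := (hu.trans (min_le_right _ _)).trans_lt (by linarith)
        obtain ⟨h1, h2⟩ := hiso u (c t) (a t) (huR.trans_le (min_le_left _ _))
          (hct.trans_le (min_le_left _ _)) (hat.trans_le (min_le_left _ _)) hne hRH
        have h3 : (S.speed j (c t) - S.speed j u) / S.k j = t := by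
          rw [hsp]; field_simp; ring
        rw [h3] at h2
        have h4 : W (t, u) = c t := huni t u (c t)
          (((hle t ht).trans (min_le_right _ _)).trans_lt ((by linarith : R / 2 < R).trans_le
            (min_le_right _ _)))
          (huR.trans_le (min_le_right _ _)) (hct.trans_le (min_le_right _ _)) h2
        exact ⟨h4.symm, by rw [h4, h1]⟩
    have hboot := forall_le_half_of_continuousOn (s := s)
      (g := fun t => max (‖c t‖ / R) (|a t - S.speed j 0| / R)) ?_ ?_ ?_
    · have h := hboot s right_mem_uIcc
      have h1 := (le_max_left _ _).trans h
      have h2 := (le_max_right _ _).trans h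
      rw [div_le_iff₀ hR] at h1 h2
      have h3 := (hon s right_mem_uIcc (by linarith) (by linarith)).1
      simp only at h3 ⊢
      rw [h3]
      exact (hall' hs hu).1
    · refine ContinuousOn.sup (hcc.norm.div_const _) ?_
      exact ((hac.sub continuousOn_const).abs).div_const _
    · obtain ⟨-, -, -, h4, h5, -, h7, -, -, h10, -⟩ := hall' hzero hu
      simp only at h7 h10 h5 h4
      rw [h7, h10] at h5
      rw [h7] at h4
      simp only [hc0, ha0]
      exact max_lt ((div_lt_one hR).2 (by linarith)) ((div_lt_one hR).2 (by linarith))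
    · intro t ht hlt
      have h := hlt t right_mem_uIcc
      have h1 := (le_max_left _ _).trans_lt h
      have h2 := (le_max_right _ _).trans_lt h
      rw [div_lt_one hR] at h1 h2
      obtain ⟨h3, h4⟩ := hon t ht h1 h2
      obtain ⟨-, -, -, h5, h6, -⟩ := hall' (hle t ht) hu
      simp only at h5 h6
      refine max_le ?_ ?_
      · rw [div_le_iff₀ hR, h3]; linarith
      · rw [div_le_iff₀ hR, h4]; linarith
  · intro hw
    have hle : ∀ t ∈ uIcc 0 s, |t| ≤ ρ := fun t ht => (abs_le_of_mem_uIcc_zero ht).trans hs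
    have hWd : ∀ t, |t| ≤ ρ → HasDerivAt (fun t => W (t, u)) (fderiv ℝ W (t, u) (1, 0)) t := by
      intro t ht
      have h1 : HasDerivAt (fun t : ℝ => (t, u)) (1, 0) t := (hasDerivAt_id t).prodMk (hasDerivAt_const t u)
      exact ((hall' ht hu).2.2.1.differentiableAt (by norm_num)).hasFDerivAt.comp_hasDerivAt t h1
    have hpt : ∀ t : ℝ, ContinuousAt (fun t : ℝ => (t, u)) t := fun t => by fun_prop
    obtain ⟨-, -, -, -, -, -, h7, h8, h9, h10, -⟩ := hall' hzero hu
    simp only at h7 h8 h9 h10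
    have hd0 : fderiv ℝ W (0, u) (1, 0) = D.r u := by
      have hZc : ContinuousAt (fun t => D.N (u, W (t, u))) 0 :=
        ContinuousAt.comp (f := fun t : ℝ => (t, u)) (hall' hzero hu).2.2.2.2.2.2.2.2.2.2.2.1.continuousAt
          (hpt 0)
      have h1 := (hasDerivAt_smul_self_zero hZc).const_add u
      rw [h7, h8] at h1
      have h2 : (fun t => W (t, u)) =ᶠ[𝓝 0] fun t => u + t • D.N (u, W (t, u)) := by
        filter_upwards [Metric.closedBall_mem_nhds (0 : ℝ) hρ] with t ht
        exact (hall' (by simpa using ht) hu).1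
      exact (hWd 0 hzero).unique (h1.congr_of_eventuallyEq h2)
    refine ⟨fun t => W (t, u), fun t => fderiv ℝ W (t, u) (1, 0), fun t => D.a (u, W (t, u)),
      h7, ?_, ?_, ?_, ?_, ?_, fun t ht => ?_⟩
    · rw [hw]; exact (hall' hs hu).1
    · simp only [h7, h10]
    · simp only [hd0]
      exact (h9 _).2 rfl
    · intro t ht
      exact (ContinuousAt.comp (f := fun t : ℝ => (t, u))
        (hall' (hle t ht) hu).2.2.2.2.2.2.2.2.2.2.1.continuousAt (hpt t)).continuousWithinAt
    · intro t ht
      have h1 : ContinuousAt (fderiv ℝ W) (t, u) :=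
        ((hall' (hle t ht) hu).2.2.1.fderiv_right (m := 0) (by norm_num)).continuousAt
      exact ((ContinuousAt.comp (f := fun t : ℝ => (t, u)) h1 (hpt t)).clm_apply
        continuousAt_const).continuousWithinAt
    · obtain ⟨h1, h2, -, -, -, h6, -⟩ := hall' (hle t ht) hu
      simp only at h1 h2 h6
      obtain ⟨h11, h12⟩ := h2 t (by rw [sub_eq_iff_eq_add', ← h1])
      exact ⟨h6, (hWd t (hle t ht)).hasDerivWithinAt, h11, fun _ => by linarith,
        fun h => absurd h hnld⟩

end Data
-- Shock curves of linearly degenerate fields.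
namespace Data
variable {n : ℕ} {S : Data n}

/-- Along the integral curve `φ` of `r_j` the speed `λ_j` is constant, so `f(φ) - λ_j(u) φ` has zero
derivative and `φ` is a shock curve. Conversely, the points of a shock curve lie on `φ` by
uniqueness for the equation `w - u = τ • N (u, w)`. Hence its speed is the constant `λ_j(u)`, and
differentiating the Rankine-Hugoniot condition makes `c'` an eigenvector. Its length is `1` and its
orientation is preserved by continuity, so `c' = r_j(c)` and uniqueness for the differential
equation applies. -/
theorem exists_shock_iff_of_ld (hS : S.Admissible) (hN : S.Normalized) {j : Fin n}
    (D : LocalField S j) (hld : S.LinearlyDegenerate j) {ρf L : ℝ} (hρf : 0 < ρf)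
    {φ Z : ℝ → State n → State n}
    (hcur : ∀ u s, ‖u‖ ≤ ρf → |s| ≤ ρf → φ s u = u + s • Z s u ∧ φ s u ∈ S.Ω ∧
        S.IsRightEigenvector j (φ s u) (D.r (φ s u)) ∧
        HasDerivAt (fun t => φ t u) (D.r (φ s u)) s)
    (hzero : ∀ u, ‖u‖ ≤ ρf → φ 0 u = u ∧ Z 0 u = D.r u) (hlip : LipschitzCurve ρf L Z)
    (huniq : ∀ (u : State n) (s : ℝ) (c c' : ℝ → State n), ‖u‖ ≤ ρf → |s| ≤ ρf → c 0 = u →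
        (∀ t ∈ uIcc 0 s, c t ∈ S.Ω ∧ HasDerivWithinAt c (c' t) (uIcc 0 s) t ∧
          S.IsRightEigenvector j (c t) (c' t)) → ∀ t ∈ uIcc 0 s, c t = φ t u) :
    ∃ ρ > 0, ρ ≤ ρf ∧ ∀ u s w, ‖u‖ ≤ ρ → |s| ≤ ρ → (S.IsShock j s u w ↔ w = φ s u) := by
  have hng : ¬ S.GenuinelyNonlinear j := fun h => h.not_linearlyDegenerate hS hN hld
  have hL : 0 ≤ L := by
    by_contra! h
    have h1 := hlip 0 0 ρf 0 (by simpa using hρf.le) (by simpa using hρf.le)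
      (abs_of_pos hρf).le (by simpa using hρf.le)
    have h2 : (0 : ℝ) < |ρf - 0| + ‖(0 : State n) - 0‖ := by simp [hρf.ne']
    have h3 := norm_nonneg (Z ρf 0 - Z 0 0)
    nlinarith
  have hee : ⟪S.e j, S.e j⟫ = 1 := by rw [real_inner_self_eq_norm_sq, hN.e_norm]; norm_num
  have hr0 : D.r 0 = S.e j := D.r_zero_of_ld hld
  have hspd : ∀ᶠ u in 𝓝 (0 : State n), DifferentiableAt ℝ (S.speed j) u := by
    filter_upwards [D.speed_contDiffAt.eventually (by simp)] with u hu
    exact hu.differentiableAt (by norm_num)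
  have hfd : ∀ᶠ u in 𝓝 (0 : State n), DifferentiableAt ℝ S.f u := by
    filter_upwards [hS.contDiffAt.eventually (by simp)] with u hu
    exact hu.differentiableAt (by norm_num)
  have hrcd := D.r_contDiffAt.eventually (by simp)
  have hrsm : ∀ᶠ u in 𝓝 (0 : State n), ‖D.r u - S.e j‖ < 1 / 4 :=
    ((D.r_contDiffAt.continuousAt.sub continuousAt_const).norm).eventually_lt continuousAt_const
      (by simp [hr0])
  obtain ⟨K, U, hU, hNlip⟩ := D.N_contDiffAt.exists_lipschitzOnWith
  obtain ⟨R₁, hR₁, hiso⟩ : ∃ R > 0, ∀ (u w : State n) (a : ℝ), ‖u‖ < R → ‖w‖ < R →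
      |a - S.speed j 0| < R → w ≠ u → S.f w - S.f u = a • (w - u) →
        w - u = ⟪S.e j, w - u⟫ • D.N (u, w) := by
    obtain ⟨R, hR, h⟩ := Metric.eventually_nhds_iff.1 D.isolated
    refine ⟨R, hR, fun u w a hu hw ha hne hRH => ?_⟩
    have := @h ((u, w), a) (by
      simp only [Prod.dist_eq, dist_zero_right, Real.dist_eq]
      exact max_lt (max_lt hu hw) ha) hne hRH
    exact this.2.2 hld
  have hssm : ∀ᶠ u in 𝓝 (0 : State n), |S.speed j u - S.speed j 0| < R₁ / 2 := by
    refine ContinuousAt.eventually_lt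
      (D.speed_contDiffAt.continuousAt.sub continuousAt_const).abs continuousAt_const ?_
    simpa using hR₁
  obtain ⟨R₂, hR₂, hp⟩ := exists_radius (hspd.and <| hfd.and <| hrsm.and <| hssm.and <|
    D.r_iff.and <| (eventually_mem_set.2 hS.mem_nhds).and hrcd)
  obtain ⟨R₃, hR₃, hU'⟩ := exists_radius₂ (E := State n) (F := State n) (P := fun p => p ∈ U) hU
  set R := min (min R₁ R₂) R₃ with hR
  have hRpos : 0 < R := lt_min (lt_min hR₁ hR₂) hR₃
  have hRR₁ : R ≤ R₁ := (min_le_left _ _).trans (min_le_left _ _)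
  have hRR₂ : R ≤ R₂ := (min_le_left _ _).trans (min_le_right _ _)
  have hRR₃ : R ≤ R₃ := min_le_right _ _
  have hZ0 : Z 0 0 = S.e j := by rw [(hzero 0 (by simpa using hρf.le)).2, hr0]
  -- bounds along the integral curves
  set ρ := min (min (ρf / 2) (R / 8)) (min (1 / (8 * (L + 1))) (1 / (2 * (K + 1)))) with hρ
  have hρpos : 0 < ρ := by
    refine lt_min (lt_min (by linarith) (by linarith)) (lt_min (by positivity) (by positivity))
  have hρf' : 2 * ρ ≤ ρf := by
    have : ρ ≤ ρf / 2 := (min_le_left _ _).trans (min_le_left _ _)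
    linarith
  have hρR : ρ ≤ R / 8 := (min_le_left _ _).trans (min_le_right _ _)
  have hρL : L * (3 * ρ) ≤ 1 / 2 := by
    have h1 : ρ ≤ 1 / (8 * (L + 1)) := (min_le_right _ _).trans (min_le_left _ _)
    rw [le_div_iff₀ (by positivity)] at h1
    nlinarith
  have hρK : ρ * K ≤ 1 / 2 := by
    have h1 : ρ ≤ 1 / (2 * (K + 1)) := (min_le_right _ _).trans (min_le_right _ _)
    rw [le_div_iff₀ (by positivity)] at h1
    nlinarith [K.coe_nonneg]
  have hZb : ∀ u s, ‖u‖ ≤ ρ → |s| ≤ 2 * ρ → ‖Z s u - S.e j‖ ≤ 1 / 2 := by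
    intro u s hu hs
    have := hlip u 0 s 0 (by linarith) (by simpa using hρf.le) (by linarith)
      (by simpa using hρf.le)
    rw [hZ0, sub_zero, sub_zero] at this
    refine this.trans (le_trans ?_ hρL)
    gcongr
    linarith
  have hφb : ∀ u s, ‖u‖ ≤ ρ → |s| ≤ 2 * ρ → ‖φ s u‖ ≤ R / 2 := by
    intro u s hu hs
    rw [(hcur u s (by linarith) (by linarith)).1]
    have h1 := hZb u s hu hs
    have h2 : ‖Z s u‖ ≤ 3 / 2 := by
      have := norm_add_le (Z s u - S.e j) (S.e j)
      rw [sub_add_cancel, hN.e_norm] at this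
      linarith
    have h3 : ‖s • Z s u‖ ≤ 2 * ρ * (3 / 2) := by
      rw [norm_smul, Real.norm_eq_abs]
      gcongr
    linarith [norm_add_le u (s • Z s u)]
  have hφs : ∀ u s, ‖u‖ ≤ ρ → |s| ≤ 2 * ρ → S.speed j (φ s u) = S.speed j u ∧
      S.f (φ s u) - S.f u = S.speed j u • (φ s u - u) := by
    intro u s hu hs
    have hI : Convex ℝ (Icc (-(2 * ρ)) (2 * ρ)) := convex_Icc _ _
    have h0 : (0 : ℝ) ∈ Icc (-(2 * ρ)) (2 * ρ) := ⟨by linarith, by linarith⟩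
    have hin : ∀ t ∈ Icc (-(2 * ρ)) (2 * ρ), ‖φ t u‖ ≤ R₂ ∧ |t| ≤ ρf := fun t ht =>
      ⟨by linarith [hφb u t hu (abs_le.2 ht)], (abs_le.2 ht).trans hρf'⟩
    have hφ0 := (hzero u (by linarith)).1
    have hsp : ∀ t ∈ Icc (-(2 * ρ)) (2 * ρ), S.speed j (φ t u) = S.speed j u := by
      intro t ht
      have hd : ∀ x ∈ Icc (-(2 * ρ)) (2 * ρ),
          HasDerivWithinAt (fun t => S.speed j (φ t u)) 0 (Icc (-(2 * ρ)) (2 * ρ)) x := by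
        intro x hx
        obtain ⟨-, h2, h3, h4⟩ := hcur u x (by linarith) (hin x hx).2
        have h5 := ((hp _ (hin x hx).1).1.hasFDerivAt.comp_hasDerivAt x h4).hasDerivWithinAt
          (s := Icc (-(2 * ρ)) (2 * ρ))
        rwa [hld _ h2 _ h3.1] at h5
      have := hI.norm_image_sub_le_of_norm_hasDerivWithin_le (C := 0) hd (by simp) h0 ht
      simp only [hφ0, zero_mul, norm_le_zero_iff, sub_eq_zero] at this
      exact this
    refine ⟨hsp s (abs_le.1 hs), ?_⟩
    have hd : ∀ x ∈ Icc (-(2 * ρ)) (2 * ρ),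
        HasDerivWithinAt (fun t => S.f (φ t u) - S.speed j u • φ t u) 0
          (Icc (-(2 * ρ)) (2 * ρ)) x := by
      intro x hx
      obtain ⟨-, h2, h3, h4⟩ := hcur u x (by linarith) (hin x hx).2
      have h5 := ((hp _ (hin x hx).1).2.1.hasFDerivAt.comp_hasDerivAt x h4).sub
        (h4.const_smul (S.speed j u))
      have h6 := h3.1
      rw [IsEigenvector, hsp x hx] at h6
      rw [h6, sub_self] at h5
      exact h5.hasDerivWithinAt
    have := hI.norm_image_sub_le_of_norm_hasDerivWithin_le (C := 0) hd (by simp) h0 (abs_le.1 hs)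
    simp only [hφ0, zero_mul, norm_le_zero_iff] at this
    rw [smul_sub, ← sub_eq_zero, ← this]
    abel
  refine ⟨ρ, hρpos, by linarith, fun u s w hu hs => ⟨?_, ?_⟩⟩
  swap
  · rintro rfl
    have hle : ∀ t ∈ uIcc 0 s, |t| ≤ ρ := fun t ht => (abs_le_of_mem_uIcc_zero ht).trans hs
    have hρ0 : |(0 : ℝ)| ≤ ρf := by simpa using hρf.le
    have hφ0 := hzero u (by linarith)
    have hder := fun t (ht : t ∈ uIcc 0 s) => hcur u t (by linarith) (by linarith [hle t ht])
    refine ⟨fun t => φ t u, fun t => D.r (φ t u), fun _ => S.speed j u, hφ0.1, rfl, rfl, ?_,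
      continuousOn_const, ?_, fun t ht => ?_⟩
    · have := (hcur u 0 (by linarith) hρ0).2.2.1
      simp only [hφ0.1] at this ⊢
      exact this
    · intro t ht
      have h1 : ContDiffAt ℝ 1 D.r (φ t u) :=
        (hp _ (by linarith [hφb u t hu (by linarith [hle t ht])])).2.2.2.2.2.2
      exact (ContinuousAt.comp (f := fun t => φ t u) h1.continuousAt
        (hder t ht).2.2.2.continuousAt).continuousWithinAt
    · obtain ⟨h1, h2, h3, h4⟩ := hder t ht
      exact ⟨h2, h4.hasDerivWithinAt, (hφs u t hu (by linarith [hle t ht])).2,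
        fun h => absurd h hng, fun _ => (h3.2.2 hld).1⟩
  · rintro ⟨c, c', a, hc0, rfl, ha0, hr, hac, hcc', hc⟩
    have hle : ∀ t ∈ uIcc 0 s, |t| ≤ ρ := fun t ht => (abs_le_of_mem_uIcc_zero ht).trans hs
    have hcb : ∀ t ∈ uIcc 0 s, ‖c t - u‖ ≤ |t| := by
      intro t ht
      have := (convex_uIcc (0 : ℝ) s).norm_image_sub_le_of_norm_hasDerivWithin_le (C := 1)
        (fun x hx => (hc x hx).2.1) (fun x hx => ((hc x hx).2.2.2.2 hld).le) left_mem_uIcc ht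
      simpa [hc0] using this
    have hcR : ∀ t ∈ uIcc 0 s, ‖c t‖ ≤ R / 4 := by
      intro t ht
      have := norm_add_le (c t - u) u
      rw [sub_add_cancel] at this
      linarith [hcb t ht, hle t ht]
    have key : ∀ t ∈ uIcc 0 s, (∀ t' ∈ uIcc 0 t, ‖c' t' - S.e j‖ < 1 / 2 ∧
        |a t' - S.speed j 0| < R₁) → a t = S.speed j u ∧ c' t = D.r (c t) := by
      intro t ht hhist
      have hsub := uIcc_zero_subset ht
      -- the states of the curve lie on an integral curve
      have hpt : ∀ t' ∈ uIcc 0 t, a t' = S.speed j u ∧ S.speed j (c t') = S.speed j u := by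
        intro t' ht'
        rcases eq_or_ne t' 0 with rfl | ht0
        · exact ⟨ha0, by rw [hc0]⟩
        have hts := hsub ht'
        -- Since `c'` stays within `1 / 2` of the unit vector `e_j`, a return to `u` at time `t'`
        -- would give `|t'| ≤ |t'| / 2`.
        have hne : c t' ≠ u := by
          intro hcu
          have hsub' := uIcc_zero_subset ht'
          have := (convex_uIcc (0 : ℝ) t').norm_image_sub_le_of_norm_hasDerivWithin_le
            (f := fun x => c x - x • S.e j) (f' := fun x => c' x - S.e j) (C := 1 / 2)
            (fun x hx => ?_) (fun x hx => (hhist x (hsub' hx)).1.le) left_mem_uIcc right_mem_uIcc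
          · rw [hcu, hc0] at this
            simp only [zero_smul, sub_zero, sub_sub_cancel_left, norm_neg, norm_smul, hN.e_norm,
              mul_one] at this
            have : 0 < ‖t'‖ := norm_pos_iff.2 ht0
            linarith
          · refine (((hc x (hsub (hsub' hx))).2.1.mono (hsub'.trans hsub)).sub ?_)
            simpa using ((hasDerivAt_id x).smul_const (S.e j)).hasDerivWithinAt
        have hRH := (hc t' hts).2.2.1
        have huR : ‖u‖ < R := by linarith
        have hctR : ‖c t'‖ < R := by linarith [hcR t' hts]
        have h1 := hiso u (c t') (a t') (by linarith) (by linarith) (hhist t' ht').2 hne hRH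
        set τ := ⟪S.e j, c t' - u⟫ with hτ
        have hτle : |τ| ≤ ρ := by
          have h2 := abs_real_inner_le_norm (S.e j) (c t' - u)
          rw [hN.e_norm, one_mul] at h2
          linarith [hcb t' hts, hle t' hts]
        -- This is the point of the integral curve with the same `e_j`-component. That component is
        -- `x * ⟪e_j, Z x u⟫` with second factor at least `1 / 2`, so `|x| ≤ 2ρ` covers all `|τ| ≤
        -- ρ`.
        obtain ⟨x, hx, hxτ⟩ : ∃ x ∈ Icc (-(2 * ρ)) (2 * ρ), ⟪S.e j, φ x u - u⟫ = τ := by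
          have hpos : ∀ x, |x| ≤ 2 * ρ → 1 / 2 ≤ ⟪S.e j, Z x u⟫ := by
            intro x hx
            have h2 := abs_real_inner_le_norm (S.e j) (Z x u - S.e j)
            rw [hN.e_norm, one_mul, inner_sub_right, hee] at h2
            have := hZb u x hu hx
            linarith [(abs_le.1 (h2.trans this)).1]
          have hval : ∀ x, |x| ≤ 2 * ρ → ⟪S.e j, φ x u - u⟫ = x * ⟪S.e j, Z x u⟫ := by
            intro x hx
            rw [(hcur u x (by linarith) (by linarith)).1, add_sub_cancel_left, inner_smul_right]
          have hcont : ContinuousOn (fun x => ⟪S.e j, φ x u - u⟫) (Icc (-(2 * ρ)) (2 * ρ)) := by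
            intro x hx
            have := (hcur u x (by linarith) ((abs_le.2 hx).trans hρf')).2.2.2.continuousAt
            exact (continuousAt_const.inner (this.sub continuousAt_const)).continuousWithinAt
          have h2ρ : |2 * ρ| ≤ 2 * ρ := by rw [abs_of_pos (by linarith)]
          have h2ρ' : |-(2 * ρ)| ≤ 2 * ρ := by rw [abs_neg]; exact h2ρ
          refine intermediate_value_Icc (by linarith) hcont ⟨?_, ?_⟩
          · simp only [hval _ h2ρ']
            nlinarith [hpos _ h2ρ', (abs_le.1 hτle).1]
          · simp only [hval _ h2ρ]
            nlinarith [hpos _ h2ρ, (abs_le.1 hτle).2]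
        have hx' := abs_le.2 hx
        have hφx := hφs u x hu hx'
        have hφR := hφb u x hu hx'
        have h2 : φ x u - u = τ • D.N (u, φ x u) := by
          by_cases hφu : φ x u = u
          · rw [hφu, sub_self] at hxτ
            rw [hφu, sub_self, ← hxτ, inner_zero_right, zero_smul]
          · have h3 := hiso u (φ x u) (S.speed j u) (by linarith) (by linarith)
              (by linarith [(hp u (by linarith)).2.2.2.1]) hφu hφx.2
            rwa [hxτ] at h3
        -- Both points are fixed points of `w ↦ u + τ • N (u, w)`, which contracts because `ρ * K ≤
        -- 1 / 2`.
        have h3 : c t' = φ x u := by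
          have h4 := hNlip.norm_sub_le (hU' u (c t') (by linarith) (by linarith))
            (hU' u (φ x u) (by linarith) (by linarith))
          have h5 : c t' - φ x u = τ • (D.N (u, c t') - D.N (u, φ x u)) := by
            rw [smul_sub, ← h1, ← h2]; abel
          have h6 : ‖(u, c t') - (u, φ x u)‖ = ‖c t' - φ x u‖ := by
            rw [Prod.mk_sub_mk, Prod.norm_mk, sub_self, norm_zero]
            exact max_eq_right (norm_nonneg _)
          rw [h6] at h4
          have h7 : ‖c t' - φ x u‖ ≤ 1 / 2 * ‖c t' - φ x u‖ := by
            calc ‖c t' - φ x u‖ = |τ| * ‖D.N (u, c t') - D.N (u, φ x u)‖ := by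
                  rw [h5, norm_smul, Real.norm_eq_abs]
              _ ≤ ρ * (K * ‖c t' - φ x u‖) := by gcongr
              _ = ρ * K * ‖c t' - φ x u‖ := by ring
              _ ≤ _ := by gcongr
          have h8 : ‖c t' - φ x u‖ = 0 := by linarith [norm_nonneg (c t' - φ x u)]
          exact sub_eq_zero.1 (norm_eq_zero.1 h8)
        refine ⟨?_, by rw [h3]; exact hφx.1⟩
        have h4 : a t' • (c t' - u) = S.speed j u • (c t' - u) := by
          rw [← hRH, h3]; exact hφx.2
        exact smul_left_injective ℝ (sub_ne_zero.2 hne) h4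
      have hat := hpt t right_mem_uIcc
      have hcR₂ : ‖c t‖ ≤ R₂ := by linarith [hcR t ht]
      refine ⟨hat.1, ((hp _ hcR₂).2.2.2.2.1 _).1 ?_⟩
      rcases eq_or_ne t 0 with rfl | ht0
      · rw [hc0]; exact hr
      refine ⟨?_, fun h => absurd h hng, fun _ => ⟨(hc t ht).2.2.2.2 hld, ?_⟩⟩
      · have hU : UniqueDiffWithinAt ℝ (uIcc 0 t) t :=
          uniqueDiffOn_Icc (min_lt_max.2 ht0.symm) t right_mem_uIcc
        have hct := (hc t ht).2.1.mono hsub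
        have h1 : HasDerivWithinAt (fun x => S.f (c x) - S.f u) (fderiv ℝ S.f (c t) (c' t))
            (uIcc 0 t) t :=
          ((hp _ hcR₂).2.1.hasFDerivAt.comp_hasDerivWithinAt t hct).sub_const _
        have h2 : HasDerivWithinAt (fun x => S.f (c x) - S.f u) (S.speed j u • c' t)
            (uIcc 0 t) t := by
          refine ((hct.sub_const u).const_smul (S.speed j u)).congr (fun x hx => ?_) ?_
          · rw [(hc x (hsub hx)).2.2.1, (hpt x hx).1]; rfl
          · rw [(hc t ht).2.2.1, hat.1]; rfl
        rw [IsEigenvector, hU.eq_deriv _ h1 h2, hat.2]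
      · have h1 := (hhist t right_mem_uIcc).1
        have h2 := abs_real_inner_le_norm (S.e j) (c' t - S.e j)
        rw [hN.e_norm, one_mul, inner_sub_right, hee] at h2
        linarith [(abs_le.1 h2).1]
    have hgc : ∀ x, max (2 * ‖c' x - S.e j‖) (|a x - S.speed j 0| / R₁) < 1 →
        ‖c' x - S.e j‖ < 1 / 2 ∧ |a x - S.speed j 0| < R₁ := by
      intro x hx
      have h1 := (le_max_left _ _).trans_lt hx
      have h2 := (le_max_right _ _).trans_lt hx
      rw [div_lt_one hR₁] at h2
      exact ⟨by linarith, h2⟩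
    -- The tolerance `‖c' - e_j‖ < 1 / 2` fixes the orientation of `c'`; it improves to `1 / 4` once
    -- `c' = r_j(c)` is known.
    have hboot := forall_le_half_of_continuousOn (s := s)
      (g := fun t => max (2 * ‖c' t - S.e j‖) (|a t - S.speed j 0| / R₁)) ?_ ?_ ?_
    · refine huniq u s c c' (by linarith) (by linarith) hc0 (fun t ht => ?_) s right_mem_uIcc
      have h1 := key t ht fun t' ht' => hgc t'
        ((hboot t' (uIcc_zero_subset ht ht')).trans_lt (by norm_num))
      have hcR₂ : ‖c t‖ ≤ R₂ := by linarith [hcR t ht]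
      exact ⟨(hc t ht).1, (hc t ht).2.1, ((hp _ hcR₂).2.2.2.2.1 _).2 h1.2⟩
    · refine ContinuousOn.sup ?_ ?_
      · exact continuousOn_const.mul ((hcc'.sub continuousOn_const).norm)
      · exact ((hac.sub continuousOn_const).abs).div_const _
    · have hu₂ := hp u (by linarith)
      have h1 : c' 0 = D.r u := (hu₂.2.2.2.2.1 _).1 hr
      simp only [h1, ha0]
      exact max_lt (by linarith [hu₂.2.2.1]) ((div_lt_one hR₁).2 (by linarith [hu₂.2.2.2.1]))
    · intro t ht hhist
      obtain ⟨h1, h2⟩ := key t ht fun t' ht' => hgc t' (hhist t' ht')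
      have hcR₂ : ‖c t‖ ≤ R₂ := by linarith [hcR t ht]
      refine max_le ?_ ?_
      · rw [h2]; linarith [(hp _ hcR₂).2.2.1]
      · rw [h1, div_le_iff₀ hR₁]; linarith [(hp u (by linarith)).2.2.2.1]

end Data

/-- The curve `s ↦ u + s • Z s u`. -/
def curve {E : Type*} [AddCommGroup E] [Module ℝ E] (Z : ℝ → E → E) (s : ℝ) (u : E) : E :=
  u + s • Z s u

/-! ### Lax curves, glued from rarefaction and shock curves. -/

namespace Data
variable {n : ℕ} {S : Data n}

/-- `ZL` and `ZS` describe the `j`-th Lax and shock curves for parameters and states up to `ρ`. -/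
structure IsWaveCurve (S : Data n) (j : Fin n) (ρ L : ℝ) (ZL ZS : ℝ → State n → State n) :
    Prop where
  lipL : LipschitzCurve ρ L ZL
  lipS : LipschitzCurve ρ L ZS
  dir : ∃ c : ℝ, c ≠ 0 ∧ ZL 0 0 = c • S.e j ∧ ZS 0 0 = c • S.e j
  lax_iff : ∀ u s w, ‖u‖ ≤ ρ → |s| ≤ ρ → (S.IsLax j s u w ↔ w = curve ZL s u)
  shock_iff : ∀ u s w, ‖u‖ ≤ ρ → |s| ≤ ρ → (S.IsShock j s u w ↔ w = curve ZS s u)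
  add : ∀ u s t, ‖u‖ ≤ ρ → |s| ≤ ρ → |t| ≤ ρ → |s + t| ≤ ρ → ‖curve ZL s u‖ ≤ ρ →
    (S.GenuinelyNonlinear j → 0 ≤ s ∧ 0 ≤ t) →
    curve ZL t (curve ZL s u) = curve ZL (s + t) u

theorem IsWaveCurve.mono {j : Fin n} {ρ ρ' L L' : ℝ} {ZL ZS : ℝ → State n → State n}
    (h : IsWaveCurve S j ρ L ZL ZS) (hρ : ρ' ≤ ρ) (hL : L ≤ L') :
    IsWaveCurve S j ρ' L' ZL ZS where
  lipL := h.lipL.mono hρ hL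
  lipS := h.lipS.mono hρ hL
  dir := h.dir
  lax_iff u s w hu hs := h.lax_iff u s w (hu.trans hρ) (hs.trans hρ)
  shock_iff u s w hu hs := h.shock_iff u s w (hu.trans hρ) (hs.trans hρ)
  add u s t hu hs ht hst hc hg := h.add u s t (hu.trans hρ) (hs.trans hρ) (ht.trans hρ)
    (hst.trans hρ) (hc.trans hρ) hg

/-- For parameters of opposite signs the estimate passes through the parameter `0`, where both
families agree and `|s - t| = |s| + |t|`. -/
theorem LipschitzCurve.glue {E : Type*} [NormedAddCommGroup E] {ρ L : ℝ} {Z Z' : ℝ → E → E}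
    (hρ : 0 < ρ) (h : LipschitzCurve ρ L Z) (h' : LipschitzCurve ρ L Z')
    (h0 : ∀ u, ‖u‖ ≤ ρ → Z 0 u = Z' 0 u) :
    LipschitzCurve ρ L (fun s u => if 0 ≤ s then Z s u else Z' s u) := by
  intro u w s t hu hw hs ht
  have h00 : |(0 : ℝ)| ≤ ρ := by simpa using hρ.le
  by_cases h1 : 0 ≤ s <;> by_cases h2 : 0 ≤ t <;> simp only [h1, h2, if_true, if_false]
  · exact h u w s t hu hw hs ht
  · have h3 := h u w s 0 hu hw hs h00
    have h4 := h' w w 0 t hw hw h00 ht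
    rw [h0 w hw] at h3
    have h5 := norm_add_le (Z s u - Z' 0 w) (Z' 0 w - Z' t w)
    rw [sub_add_sub_cancel] at h5
    rw [sub_self, norm_zero, add_zero] at h4
    have h6 : |s - t| = |s - 0| + |0 - t| := by
      rw [abs_of_nonneg (by linarith), abs_of_nonneg (by linarith), abs_of_nonneg (by linarith)]
      ring
    rw [h6]
    linarith
  · have h3 := h' u w s 0 hu hw hs h00
    have h4 := h w w 0 t hw hw h00 ht
    rw [h0 w hw] at h4
    have h5 := norm_add_le (Z' s u - Z' 0 w) (Z' 0 w - Z t w)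
    rw [sub_add_sub_cancel] at h5
    rw [sub_self, norm_zero, add_zero] at h4
    have h6 : |s - t| = |s - 0| + |0 - t| := by
      rw [abs_of_nonpos (by linarith), abs_of_nonpos (by linarith), abs_of_nonpos (by linarith)]
      ring
    rw [h6]
    linarith
  · exact h' u w s t hu hw hs ht

/-- For a genuinely nonlinear field the parameters are claimed to add up only for two rarefactions.
For a linearly degenerate one, shock and rarefaction curves coincide and the flow property holds for
all signs. This is the origin of the notion of approaching waves within one family. -/
theorem exists_isWaveCurve (hS : S.Admissible) (hN : S.Normalized) (j : Fin n) :
    ∃ ρ > 0, ∃ L ZL ZS, IsWaveCurve S j ρ L ZL ZS := by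
  obtain ⟨D⟩ := exists_localField hS hN j
  obtain ⟨ρ₁, hρ₁, L₁, φ, Z, hcur, hzero, hlip, huniq, hiff, hadd⟩ := exists_rarefaction hS D
  obtain ⟨c, hc, hr0⟩ := D.r_zero
  by_cases hg : S.GenuinelyNonlinear j
  · obtain ⟨ρ₂, hρ₂, L₂, Z', hzero', hlip', hiff'⟩ := exists_shock_of_gnl hS hN D hg
    set ρ := min ρ₁ ρ₂
    have h1 : ρ ≤ ρ₁ := min_le_left _ _
    have h2 : ρ ≤ ρ₂ := min_le_right _ _
    have hρ : 0 < ρ := lt_min hρ₁ hρ₂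
    refine ⟨ρ, hρ, max L₁ L₂, fun s u => if 0 ≤ s then Z s u else Z' s u, Z', ?_, ?_, ?_, ?_, ?_, ?_⟩
    · refine (hlip.mono h1 (le_max_left _ _)).glue hρ (hlip'.mono h2 (le_max_right _ _)) ?_
      intro u hu
      rw [(hzero u (hu.trans h1)).2, hzero' u (hu.trans h2)]
    · exact hlip'.mono h2 (le_max_right _ _)
    · refine ⟨c, hc, ?_, ?_⟩
      · simp [(hzero 0 (by simpa using hρ₁.le)).2, hr0]
      · rw [hzero' 0 (by simpa using hρ₂.le), hr0]
    · intro u s w hu hs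
      have hu₁ := hu.trans h1
      have hs₁ := hs.trans h1
      unfold IsLax
      by_cases h : 0 ≤ s
      · simp only [h, forall_true_left, not_lt.2 h, IsEmpty.forall_iff, and_true, curve, if_true,
          hiff u s w hu₁ hs₁, (hcur u s hu₁ hs₁).1]
      · simp only [h, IsEmpty.forall_iff, not_le.1 h, forall_true_left, true_and, curve, if_false,
          hiff' u s w (hu.trans h2) (hs.trans h2)]
    · exact fun u s w hu hs => hiff' u s w (hu.trans h2) (hs.trans h2)
    · intro u s t hu hs ht hst hcs hpos
      obtain ⟨h3, h4⟩ := hpos hg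
      have h5 : 0 ≤ s + t := add_nonneg h3 h4
      simp only [curve, h3, h4, h5, if_true] at hcs ⊢
      rw [← (hcur u s (hu.trans h1) (hs.trans h1)).1] at hcs ⊢
      rw [← (hcur _ t (hcs.trans h1) (ht.trans h1)).1,
        ← (hcur u (s + t) (hu.trans h1) (hst.trans h1)).1]
      exact hadd u s t (hu.trans h1) (hs.trans h1) (ht.trans h1) (hst.trans h1) (hcs.trans h1)
  · obtain ⟨ρ, hρ, h1, hiff'⟩ := exists_shock_iff_of_ld hS hN D (hS.ld_of_not_gnl hg) hρ₁ hcur hzero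
      hlip huniq
    refine ⟨ρ, hρ, L₁, Z, Z, hlip.mono h1 le_rfl, hlip.mono h1 le_rfl, ⟨c, hc, ?_, ?_⟩, ?_, ?_, ?_⟩
    · rw [(hzero 0 (by simpa using hρ₁.le)).2, hr0]
    · rw [(hzero 0 (by simpa using hρ₁.le)).2, hr0]
    · intro u s w hu hs
      have hu₁ := hu.trans h1
      have hs₁ := hs.trans h1
      unfold IsLax
      by_cases h : 0 ≤ s
      · simp only [h, forall_true_left, not_lt.2 h, IsEmpty.forall_iff, and_true, curve,
          hiff u s w hu₁ hs₁, (hcur u s hu₁ hs₁).1]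
      · simp only [h, IsEmpty.forall_iff, not_le.1 h, forall_true_left, true_and, curve,
          hiff' u s w hu hs, (hcur u s hu₁ hs₁).1]
    · intro u s w hu hs
      rw [hiff' u s w hu hs, (hcur u s (hu.trans h1) (hs.trans h1)).1, curve]
    · intro u s t hu hs ht hst hcs _
      simp only [curve] at hcs ⊢
      rw [← (hcur u s (hu.trans h1) (hs.trans h1)).1] at hcs ⊢
      rw [← (hcur _ t (hcs.trans h1) (ht.trans h1)).1,
        ← (hcur u (s + t) (hu.trans h1) (hst.trans h1)).1]
      exact hadd u s t (hu.trans h1) (hs.trans h1) (ht.trans h1) (hst.trans h1) (hcs.trans h1)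

theorem exists_pos_le_all (ρ : Fin n → ℝ) (h : ∀ j, 0 < ρ j) : ∃ r > 0, ∀ j, r ≤ ρ j := by
  have h1 : ∀ᶠ r in 𝓝[>] (0 : ℝ), ∀ j, r ≤ ρ j := by
    refine eventually_all.2 fun j => ?_
    filter_upwards [Ioo_mem_nhdsGT (h j)] with r hr using hr.2.le
  obtain ⟨r, hr, hr'⟩ := (h1.and self_mem_nhdsWithin).exists
  exact ⟨r, hr', hr⟩

theorem linearIndependent_e (hS : S.Admissible) (hN : S.Normalized) :
    LinearIndependent ℝ S.e :=
  Module.End.eigenvectors_linearIndependent' (fderiv ℝ S.f 0 : State n →ₗ[ℝ] State n)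
    (fun j => S.speed j 0) (hS.isOrderedSpectrum hS.zero_mem).1.injective S.e
    (fun i => ⟨Module.End.mem_eigenspace_iff.2 (hN.e_eigen i), hN.e_ne_zero i⟩)

/-- A family of Lipschitz curves with linearly independent directions. -/
structure IsCurveFamily (r L : ℝ) (Z : Fin n → ℝ → State n → State n) : Prop where
  r_pos : 0 < r
  L_nonneg : 0 ≤ L
  lip : ∀ j, LipschitzCurve r L (Z j)
  indep : LinearIndependent ℝ fun j => Z j 0 0

/-- Existence, uniqueness and regularity of the Lax and shock curves near `0`. -/
theorem exists_waveCurves (hS : S.Admissible) (hN : S.Normalized) :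
    ∃ (ρ L : ℝ) (ZL ZS : Fin n → ℝ → State n → State n), IsCurveFamily ρ L ZL ∧
      IsCurveFamily ρ L ZS ∧ ∀ j, IsWaveCurve S j ρ L (ZL j) (ZS j) := by
  choose ρ hρ L ZL ZS h using exists_isWaveCurve hS hN
  obtain ⟨r, hr, hrρ⟩ := exists_pos_le_all ρ hρ
  have hL : ∀ j, L j ≤ ∑ i, |L i| := fun j =>
    (le_abs_self _).trans (Finset.single_le_sum (f := fun i => |L i|)
      (fun _ _ => abs_nonneg _) (Finset.mem_univ j))
  have hwc := fun j => (h j).mono (hrρ j) (hL j)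
  have hL0 : 0 ≤ ∑ i, |L i| := Finset.sum_nonneg fun _ _ => abs_nonneg _
  choose c hc hcL hcS using fun j => (h j).dir
  have hind : LinearIndependent ℝ fun j => c j • S.e j := by
    have := (linearIndependent_e hS hN).units_smul (fun j => Units.mk0 (c j) (hc j))
    exact this
  refine ⟨r, ∑ i, |L i|, ZL, ZS, ⟨hr, hL0, fun j => (hwc j).lipL, ?_⟩,
    ⟨hr, hL0, fun j => (hwc j).lipS, ?_⟩, hwc⟩
  · simpa only [hcL] using hind
  · simpa only [hcS] using hind

end Data
-- Compositions of wave curves and their inversion.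
namespace Data

/-- A quantitative strict differentiability at the origin, obtained from the Lipschitz bound on `Z`
alone: the error is `(s - t) • (Z s u - Z 0 0) + t • (Z s u - Z t w)`. -/
theorem LipschitzCurve.norm_curve_sub_le {E : Type*} [NormedAddCommGroup E] [NormedSpace ℝ E]
    {r L η : ℝ} {Z : ℝ → E → E} (h : LipschitzCurve r L Z) (hL : 0 ≤ L) (hη : η ≤ r) {u w : E}
    {s t : ℝ} (hs : |s| ≤ η) (ht : |t| ≤ η) (hu : ‖u‖ ≤ η) (hw : ‖w‖ ≤ η) :
    ‖curve Z s u - curve Z t w - (u - w) - (s - t) • Z 0 0‖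
      ≤ 3 * L * η * (|s - t| + ‖u - w‖) := by
  have hη0 : 0 ≤ η := (abs_nonneg s).trans hs
  have h1 := h u 0 s 0 (hu.trans hη) (by simpa using hη0.trans hη) (hs.trans hη)
    (by simpa using hη0.trans hη)
  have h2 := h u w s t (hu.trans hη) (hw.trans hη) (hs.trans hη) (ht.trans hη)
  rw [sub_zero, sub_zero] at h1
  have e : curve Z s u - curve Z t w - (u - w) - (s - t) • Z 0 0
      = (s - t) • (Z s u - Z 0 0) + t • (Z s u - Z t w) := by
    simp only [curve]; module
  rw [e]
  refine (norm_add_le _ _).trans ?_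
  rw [norm_smul, norm_smul, Real.norm_eq_abs, Real.norm_eq_abs]
  have h3 : |s - t| * ‖Z s u - Z 0 0‖ ≤ |s - t| * (L * (η + η)) :=
    mul_le_mul_of_nonneg_left (h1.trans (by gcongr)) (abs_nonneg _)
  have h4 : |t| * ‖Z s u - Z t w‖ ≤ η * (L * (|s - t| + ‖u - w‖)) := by gcongr
  have h5 : 0 ≤ L * η * ‖u - w‖ := by positivity
  nlinarith

variable {n : ℕ}

/-- The composition of the curves of the families listed in `l`, with parameters `σ`. -/
def run (Z : Fin n → ℝ → State n → State n) (σ : Fin n → ℝ) (l : List (Fin n)) (u : State n) :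
    State n :=
  l.foldl (fun w j => curve (Z j) (σ j) w) u

variable {Z : Fin n → ℝ → State n → State n} {r L : ℝ}

@[simp] theorem run_nil (σ : Fin n → ℝ) (u : State n) : run Z σ [] u = u := rfl

@[simp] theorem run_cons (σ : Fin n → ℝ) (j : Fin n) (l : List (Fin n)) (u : State n) :
    run Z σ (j :: l) u = run Z σ l (curve (Z j) (σ j) u) := rfl

theorem run_append (σ : Fin n → ℝ) (l l' : List (Fin n)) (u : State n) :
    run Z σ (l ++ l') u = run Z σ l' (run Z σ l u) := List.foldl_append

@[simp] theorem run_zero (l : List (Fin n)) (u : State n) : run Z 0 l u = u := by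
  induction l with
  | nil => rfl
  | cons j l ih => simpa [curve] using ih

theorem run_congr {σ τ : Fin n → ℝ} {l : List (Fin n)} (h : ∀ j ∈ l, σ j = τ j) (u : State n) :
    run Z σ l u = run Z τ l u := by
  induction l generalizing u with
  | nil => rfl
  | cons j l ih =>
    rw [run_cons, run_cons, h j (by simp), ih fun i hi => h i (by simp [hi])]

/-- Strict differentiability at the origin survives composition. In the induction, half of `ε` goes
to the first curve. The tolerance of the tail is divided by `3 + z`, which bounds the growth of `‖σ
- τ‖ + ‖u - w‖` after one curve. -/
theorem IsCurveFamily.exists_run_approx (h : IsCurveFamily r L Z) (l : List (Fin n)) {ε : ℝ}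
    (hε : 0 < ε) :
    ∃ η > 0, η ≤ r ∧ ∀ (σ τ : Fin n → ℝ) (u w : State n), ‖σ‖ ≤ η → ‖τ‖ ≤ η → ‖u‖ ≤ η →
      ‖w‖ ≤ η → ‖run Z σ l u - run Z τ l w - (u - w)
        - (l.map fun j => (σ j - τ j) • Z j 0 0).sum‖ ≤ ε * (‖σ - τ‖ + ‖u - w‖) := by
  induction l generalizing ε with
  | nil =>
    refine ⟨r, h.r_pos, le_rfl, fun σ τ u w _ _ _ _ => ?_⟩
    simp only [run_nil, sub_self, List.map_nil, List.sum_nil, norm_zero]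
    positivity
  | cons j l ih =>
    set z := ‖Z j 0 0‖ with hz
    have hz0 : 0 ≤ z := norm_nonneg _
    obtain ⟨η', hη', hη'r, H⟩ := ih (ε := ε / 2 / (3 + z)) (by positivity)
    have hL := h.L_nonneg
    obtain ⟨η, hη, h1, h2, h3, h4⟩ : ∃ η > 0, η ≤ η' ∧ (2 + z) * (2 * η) ≤ η' ∧
        3 * L * η ≤ ε / 2 ∧ 3 * L * η ≤ 1 := by
      have a1 : ∀ᶠ η in 𝓝[>] (0 : ℝ), η < η' :=
        nhdsWithin_le_nhds (eventually_lt_nhds hη')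
      have a2 : ∀ᶠ η in 𝓝[>] (0 : ℝ), (2 + z) * (2 * η) < η' := by
        refine nhdsWithin_le_nhds ?_
        have : Tendsto (fun η : ℝ => (2 + z) * (2 * η)) (𝓝 0) (𝓝 ((2 + z) * (2 * 0))) :=
          Continuous.tendsto (by fun_prop) 0
        exact this.eventually_lt_const (by simpa using hη')
      have a3 : ∀ c > 0, ∀ᶠ η in 𝓝[>] (0 : ℝ), 3 * L * η < c := by
        intro c hc
        refine nhdsWithin_le_nhds ?_
        have : Tendsto (fun η : ℝ => 3 * L * η) (𝓝 0) (𝓝 (3 * L * 0)) :=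
          Continuous.tendsto (by fun_prop) 0
        exact this.eventually_lt_const (by simpa using hc)
      obtain ⟨η, b1, b2, b3, b4, b5⟩ := (a1.and (a2.and ((a3 (ε / 2) (by positivity)).and
        ((a3 1 one_pos).and self_mem_nhdsWithin)))).exists
      exact ⟨η, b5, b1.le, b2.le, b3.le, b4.le⟩
    have key : ∀ (σ τ : Fin n → ℝ) (u w : State n), ‖σ‖ ≤ η → ‖τ‖ ≤ η → ‖u‖ ≤ η → ‖w‖ ≤ η →
        ‖curve (Z j) (σ j) u - curve (Z j) (τ j) w - (u - w) - (σ j - τ j) • Z j 0 0‖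
          ≤ 3 * L * η * (‖σ - τ‖ + ‖u - w‖) ∧
        ‖curve (Z j) (σ j) u - curve (Z j) (τ j) w‖ ≤ (2 + z) * (‖σ - τ‖ + ‖u - w‖) := by
      intro σ τ u w hσ hτ hu hw
      have c1 := (h.lip j).norm_curve_sub_le hL (h1.trans hη'r) ((norm_le_pi_norm σ j).trans hσ)
        ((norm_le_pi_norm τ j).trans hτ) hu hw
      have c2 : |σ j - τ j| ≤ ‖σ - τ‖ := norm_le_pi_norm (σ - τ) j
      have c3 := c1.trans (mul_le_mul_of_nonneg_left (add_le_add_left c2 _) (by positivity))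
      refine ⟨c3, ?_⟩
      have c4 : ‖(σ j - τ j) • Z j 0 0‖ ≤ ‖σ - τ‖ * z := by
        rw [norm_smul]; exact mul_le_mul_of_nonneg_right c2 hz0
      have c5 := norm_add₃_le (a := curve (Z j) (σ j) u - curve (Z j) (τ j) w - (u - w)
        - (σ j - τ j) • Z j 0 0) (b := u - w) (c := (σ j - τ j) • Z j 0 0)
      rw [show curve (Z j) (σ j) u - curve (Z j) (τ j) w - (u - w)
        - (σ j - τ j) • Z j 0 0 + (u - w) + (σ j - τ j) • Z j 0 0
        = curve (Z j) (σ j) u - curve (Z j) (τ j) w by abel] at c5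
      have c6 : 3 * L * η * (‖σ - τ‖ + ‖u - w‖) ≤ 1 * (‖σ - τ‖ + ‖u - w‖) := by gcongr
      have c7 : 0 ≤ z * ‖u - w‖ := by positivity
      nlinarith [norm_nonneg (σ - τ), norm_nonneg (u - w)]
    have small : ∀ (σ : Fin n → ℝ) (u : State n), ‖σ‖ ≤ η → ‖u‖ ≤ η →
        ‖curve (Z j) (σ j) u‖ ≤ η' := by
      intro σ u hσ hu
      have := (key σ 0 u 0 hσ (by simpa using hη.le) hu (by simpa using hη.le)).2
      simp only [curve, Pi.zero_apply, zero_smul, add_zero, sub_zero] at this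
      refine this.trans (le_trans ?_ h2)
      gcongr
      linarith
    refine ⟨η, hη, h1.trans hη'r, fun σ τ u w hσ hτ hu hw => ?_⟩
    obtain ⟨k1, k2⟩ := key σ τ u w hσ hτ hu hw
    have k3 := H σ τ _ _ (hσ.trans h1) (hτ.trans h1) (small σ u hσ hu) (small τ w hτ hw)
    rw [run_cons, run_cons, List.map_cons, List.sum_cons]
    set u₁ := curve (Z j) (σ j) u
    set w₁ := curve (Z j) (τ j) w
    set m := (l.map fun j => (σ j - τ j) • Z j 0 0).sum
    have k4 := norm_add_le (run Z σ l u₁ - run Z τ l w₁ - (u₁ - w₁) - m)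
      (u₁ - w₁ - (u - w) - (σ j - τ j) • Z j 0 0)
    rw [show run Z σ l u₁ - run Z τ l w₁ - (u₁ - w₁) - m
      + (u₁ - w₁ - (u - w) - (σ j - τ j) • Z j 0 0)
      = run Z σ l u₁ - run Z τ l w₁ - (u - w) - ((σ j - τ j) • Z j 0 0 + m) by abel] at k4
    have k5 : ε / 2 / (3 + z) * (‖σ - τ‖ + ‖u₁ - w₁‖)
        ≤ ε / 2 * (‖σ - τ‖ + ‖u - w‖) := by
      calc _ ≤ ε / 2 / (3 + z) * ((3 + z) * (‖σ - τ‖ + ‖u - w‖)) := by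
            gcongr
            nlinarith [norm_nonneg (σ - τ), norm_nonneg (u - w)]
        _ = _ := by field_simp
    have k6 : 3 * L * η * (‖σ - τ‖ + ‖u - w‖) ≤ ε / 2 * (‖σ - τ‖ + ‖u - w‖) := by gcongr
    linarith

/-- The composition of all the curves, in the order of the families. -/
def runAll (Z : Fin n → ℝ → State n → State n) (σ : Fin n → ℝ) (u : State n) : State n :=
  run Z σ (List.finRange n) u

/-- Near the origin `runAll` differs from the identity in `u` plus the isomorphism `B` in `σ` by a
map of Lipschitz constant `1 / (2N)`, where `‖B⁻¹‖ ≤ N`. This gives both the Lipschitz bound on the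
parameters and, for fixed `u`, surjectivity onto a ball. -/
theorem IsCurveFamily.exists_inverse (h : IsCurveFamily r L Z) :
    ∃ η > 0, η ≤ r ∧ ∃ C > 0,
      (∀ (σ τ : Fin n → ℝ) (u w : State n), ‖σ‖ ≤ η → ‖τ‖ ≤ η → ‖u‖ ≤ η → ‖w‖ ≤ η →
        ‖σ - τ‖ ≤ C * (‖runAll Z σ u - runAll Z τ w‖ + ‖u - w‖)) ∧
      (∀ ρ > 0, ∃ r₂ > 0, ∀ u w : State n, ‖u‖ ≤ r₂ → ‖w‖ ≤ r₂ →
        ∃ σ : Fin n → ℝ, (∀ i, |σ i| < ρ) ∧ runAll Z σ u = w) := by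
  have hcard : Fintype.card (Fin n) = Module.finrank ℝ (State n) := by simp
  obtain ⟨B, hB⟩ : ∃ B : (Fin n → ℝ) ≃L[ℝ] State n, ∀ σ, B σ = ∑ j, σ j • Z j 0 0 := by
    set b := Module.Basis.mk h.indep (h.indep.span_eq_top_of_card_eq_finrank' hcard).ge
    refine ⟨b.equivFun.symm.toContinuousLinearEquiv, fun σ => ?_⟩
    change b.equivFun.symm σ = _
    rw [Module.Basis.equivFun_symm_apply]
    simp [b]
  set N : NNReal := ‖(B.symm : State n →L[ℝ] (Fin n → ℝ))‖₊ + 1 with hN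
  have hN0 : 0 < N := by positivity
  have hN0' : (0 : ℝ) < N := by exact_mod_cast hN0
  have hBs : ∀ w, ‖B.symm w‖ ≤ N * ‖w‖ := fun w =>
    ((B.symm : State n →L[ℝ] (Fin n → ℝ)).le_opNorm w).trans (by
      gcongr; rw [hN]; push_cast; linarith [norm_nonneg (B.symm : State n →L[ℝ] (Fin n → ℝ))])
  obtain ⟨η, hη, hηr, H⟩ := h.exists_run_approx (List.finRange n) (ε := (2 * N : ℝ)⁻¹)
    (by positivity)
  have H' : ∀ (σ τ : Fin n → ℝ) (u w : State n), ‖σ‖ ≤ η → ‖τ‖ ≤ η → ‖u‖ ≤ η → ‖w‖ ≤ η →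
      ‖runAll Z σ u - runAll Z τ w - (u - w) - B (σ - τ)‖
        ≤ (2 * N : ℝ)⁻¹ * (‖σ - τ‖ + ‖u - w‖) := by
    intro σ τ u w hσ hτ hu hw
    have := H σ τ u w hσ hτ hu hw
    rw [← List.ofFn_eq_map, List.sum_ofFn] at this
    rw [hB]
    exact this
  refine ⟨η, hη, hηr, 2 * N + 1, by positivity, fun σ τ u w hσ hτ hu hw => ?_, fun ρ hρ => ?_⟩
  · have h1 := H' σ τ u w hσ hτ hu hw
    have h2 := hBs (B (σ - τ))
    rw [B.symm_apply_apply] at h2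
    have h3 := norm_sub_le (runAll Z σ u - runAll Z τ w - (u - w))
      (runAll Z σ u - runAll Z τ w - (u - w) - B (σ - τ))
    rw [sub_sub_cancel] at h3
    have h4 := norm_sub_le (runAll Z σ u - runAll Z τ w) (u - w)
    have h5 : ‖σ - τ‖ ≤ N * (‖runAll Z σ u - runAll Z τ w‖ + ‖u - w‖
        + (2 * N : ℝ)⁻¹ * (‖σ - τ‖ + ‖u - w‖)) := h2.trans (by gcongr; linarith)
    have h6 : (N : ℝ) * ((2 * N : ℝ)⁻¹ * (‖σ - τ‖ + ‖u - w‖)) = (‖σ - τ‖ + ‖u - w‖) / 2 := by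
      field_simp
    rw [mul_add, h6] at h5
    nlinarith [norm_nonneg (runAll Z σ u - runAll Z τ w), norm_nonneg (u - w)]
  · set ε₀ := min η (ρ / 2) with hε₀
    have hε₀0 : 0 < ε₀ := lt_min hη (by positivity)
    refine ⟨min η (ε₀ / (4 * N)), lt_min hη (by positivity), fun u w hu hw => ?_⟩
    have hu1 := hu.trans (min_le_left _ _)
    have happ : ApproximatesLinearOn (fun σ => runAll Z σ u) (B : (Fin n → ℝ) →L[ℝ] State n)
        (Metric.closedBall 0 η) (2 * N)⁻¹ := by
      intro σ hσ τ hτ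
      have := H' σ τ u u (by simpa using hσ) (by simpa using hτ) hu1 hu1
      simpa using this
    have hsurj := happ.surjOn_closedBall_of_nonlinearRightInverse
      ⟨B.symm, N, hBs, B.apply_symm_apply⟩ (ε := ε₀) (b := 0) hε₀0.le
      (Metric.closedBall_subset_closedBall (min_le_left _ _))
    -- The image contains the ball of radius `ε₀ / (2N)` about `runAll Z 0 u = u`; half of this
    -- radius is allotted to each of `u` and `w`.
    have hw' : w ∈ Metric.closedBall (runAll Z 0 u) (((N : ℝ)⁻¹ - ((2 * N)⁻¹ : NNReal)) * ε₀) := by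
      rw [mem_closedBall_iff_norm, runAll, run_zero]
      have e : ((N : ℝ)⁻¹ - ((2 * N)⁻¹ : NNReal)) * ε₀ = ε₀ / (4 * N) + ε₀ / (4 * N) := by
        push_cast; field_simp; norm_num
      rw [e]
      exact (norm_sub_le _ _).trans (add_le_add (hw.trans (min_le_right _ _))
        (hu.trans (min_le_right _ _)))
    obtain ⟨σ, hσ, hσw⟩ := hsurj hw'
    refine ⟨σ, fun i => ?_, hσw⟩
    have := (norm_le_pi_norm σ i).trans (mem_closedBall_zero_iff.1 hσ)
    rw [Real.norm_eq_abs] at this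
    linarith [min_le_right η (ρ / 2)]

end Data
-- Wave paths and the interaction estimate.
namespace Data
variable {n : ℕ} {Z : Fin n → ℝ → State n → State n} {r L M : ℝ}

/-- The bound on the partial compositions keeps every intermediate state where the relation is the
graph of a curve, so a path is forced one state at a time. -/
theorem exists_path_iff {P : Fin n → State n → State n → Prop} {σ : Fin n → ℝ} {u up : State n}
    (hP : ∀ j w w', ‖w‖ ≤ r → (P j w w' ↔ w' = curve (Z j) (σ j) w))
    (hu : ∀ k, ‖run Z σ ((List.finRange n).take k) u‖ ≤ r) :
    (∃ w : Fin (n + 1) → State n, w 0 = u ∧ w (Fin.last n) = up ∧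
      ∀ j : Fin n, P j (w j.castSucc) (w j.succ)) ↔ runAll Z σ u = up := by
  have htake : ∀ j : Fin n, run Z σ ((List.finRange n).take (j + 1)) u
      = curve (Z j) (σ j) (run Z σ ((List.finRange n).take j) u) := by
    intro j
    rw [List.take_add_one, run_append]
    simp
  have hall : run Z σ ((List.finRange n).take n) u = runAll Z σ u := by
    rw [List.take_of_length_le (by simp), runAll]
  constructor
  · rintro ⟨w, h0, h1, h2⟩
    have key : ∀ k : Fin (n + 1), w k = run Z σ ((List.finRange n).take k) u := by
      intro k
      induction k using Fin.induction with
      | zero => simpa using h0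
      | succ j ih =>
        have h3 := h2 j
        rw [ih, Fin.val_castSucc, hP j _ _ (hu j)] at h3
        rw [h3, Fin.val_succ, htake]
    rw [← h1, key, Fin.val_last, hall]
  · rintro rfl
    refine ⟨fun k => run Z σ ((List.finRange n).take k) u, by simp, by simp [hall], fun j => ?_⟩
    rw [hP j _ _ (hu _)]
    exact htake j

/-- The total strength of the waves of the families listed in `l`. -/
def strength (σ : Fin n → ℝ) (l : List (Fin n)) : ℝ := (l.map fun j => |σ j|).sum

@[simp] theorem strength_nil (σ : Fin n → ℝ) : strength σ [] = 0 := rfl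

@[simp] theorem strength_cons (σ : Fin n → ℝ) (j : Fin n) (l : List (Fin n)) :
    strength σ (j :: l) = |σ j| + strength σ l := by simp [strength]

theorem strength_nonneg (σ : Fin n → ℝ) (l : List (Fin n)) : 0 ≤ strength σ l :=
  List.sum_nonneg (by simp)

theorem strength_append (σ : Fin n → ℝ) (l l' : List (Fin n)) :
    strength σ (l ++ l') = strength σ l + strength σ l' := by simp [strength]

theorem strength_finRange (σ : Fin n → ℝ) : strength σ (List.finRange n) = ∑ i, |σ i| := by
  rw [strength, ← List.ofFn_eq_map, List.sum_ofFn]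

theorem IsCurveFamily.exists_bound (h : IsCurveFamily r L Z) :
    ∃ M > 0, ∀ j s u, |s| ≤ r → ‖u‖ ≤ r → ‖Z j s u‖ ≤ M := by
  have hr := h.r_pos
  have hL := h.L_nonneg
  refine ⟨∑ j, ‖Z j 0 0‖ + 2 * L * r + 1, by positivity, fun j s u hs hu => ?_⟩
  have h1 := h.lip j u 0 s 0 hu (by simpa using hr.le) hs (by simpa using hr.le)
  have h2 : ‖Z j 0 0‖ ≤ ∑ j, ‖Z j 0 0‖ :=
    Finset.single_le_sum (f := fun j => ‖Z j 0 0‖) (fun _ _ => norm_nonneg _) (Finset.mem_univ j)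
  have h3 := norm_sub_norm_le (Z j s u) (Z j 0 0)
  rw [sub_zero, sub_zero] at h1
  nlinarith

theorem norm_curve_sub_self_le (hM : ∀ j s u, |s| ≤ r → ‖u‖ ≤ r → ‖Z j s u‖ ≤ M) {j : Fin n}
    {s : ℝ} {u : State n} (hs : |s| ≤ r) (hu : ‖u‖ ≤ r) : ‖curve (Z j) s u - u‖ ≤ M * |s| := by
  rw [curve, add_sub_cancel_left, norm_smul, mul_comm, Real.norm_eq_abs]
  exact mul_le_mul_of_nonneg_right (hM j s u hs hu) (abs_nonneg s)

theorem norm_run_sub_self_le (hM0 : 0 ≤ M)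
    (hM : ∀ j s u, |s| ≤ r → ‖u‖ ≤ r → ‖Z j s u‖ ≤ M) {σ : Fin n → ℝ} (hσ : ∀ j, |σ j| ≤ r)
    {l : List (Fin n)} {u : State n} (hu : ‖u‖ + M * strength σ l ≤ r) :
    ‖run Z σ l u - u‖ ≤ M * strength σ l := by
  induction l generalizing u with
  | nil => simp
  | cons j l ih =>
    rw [strength_cons, mul_add] at hu ⊢
    have h1 : 0 ≤ M * strength σ l := mul_nonneg hM0 (strength_nonneg σ l)
    have h2 : 0 ≤ M * |σ j| := by positivity
    have h3 := norm_curve_sub_self_le hM (hσ j) (u := u) (j := j) (by linarith)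
    have h4 := norm_sub_norm_le (curve (Z j) (σ j) u) u
    have h5 := ih (u := curve (Z j) (σ j) u) (by linarith)
    rw [run_cons]
    have h6 := norm_add_le (run Z σ l (curve (Z j) (σ j) u) - curve (Z j) (σ j) u)
      (curve (Z j) (σ j) u - u)
    rw [sub_add_sub_cancel] at h6
    linarith

/-- The displacements, rather than the end states, are compared: the constant `exp (L * strength) -
1` then vanishes with the strength, which makes interaction errors quadratic. -/
theorem IsCurveFamily.norm_run_sub_run_le (h : IsCurveFamily r L Z) (hM0 : 0 ≤ M)
    (hM : ∀ j s u, |s| ≤ r → ‖u‖ ≤ r → ‖Z j s u‖ ≤ M) {σ : Fin n → ℝ} (hσ : ∀ j, |σ j| ≤ r)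
    {l : List (Fin n)} {u w : State n} (hu : ‖u‖ + M * strength σ l ≤ r)
    (hw : ‖w‖ + M * strength σ l ≤ r) :
    ‖(run Z σ l u - u) - (run Z σ l w - w)‖ ≤ (Real.exp (L * strength σ l) - 1) * ‖u - w‖ := by
  induction l generalizing u w with
  | nil => simp
  | cons j l ih =>
    rw [strength_cons, mul_add] at hu hw
    have hL := h.L_nonneg
    have h1 : 0 ≤ M * strength σ l := mul_nonneg hM0 (strength_nonneg σ l)
    have h2 : 0 ≤ M * |σ j| := by positivity
    have step : ∀ v : State n, ‖v‖ + (M * |σ j| + M * strength σ l) ≤ r →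
        ‖curve (Z j) (σ j) v‖ + M * strength σ l ≤ r := by
      intro v hv
      have h3 := norm_curve_sub_self_le hM (hσ j) (u := v) (j := j) (by linarith)
      have h4 := norm_sub_norm_le (curve (Z j) (σ j) v) v
      linarith
    have h5 := ih (step u hu) (step w hw)
    set u₁ := curve (Z j) (σ j) u
    set w₁ := curve (Z j) (σ j) w
    have h6 : ‖(u₁ - u) - (w₁ - w)‖ ≤ L * |σ j| * ‖u - w‖ := by
      have e : (u₁ - u) - (w₁ - w) = σ j • (Z j (σ j) u - Z j (σ j) w) := by
        simp only [u₁, w₁, curve]; module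
      have h7 := h.lip j u w (σ j) (σ j) (by linarith) (by linarith) (hσ j) (hσ j)
      rw [sub_self, abs_zero, zero_add] at h7
      rw [e, norm_smul, Real.norm_eq_abs]
      calc _ ≤ |σ j| * (L * ‖u - w‖) := by gcongr
        _ = _ := by ring
    have h8 := norm_add_le ((u₁ - u) - (w₁ - w)) (u - w)
    rw [show (u₁ - u) - (w₁ - w) + (u - w) = u₁ - w₁ by abel] at h8
    have h9 := norm_add_le ((run Z σ l u₁ - u₁) - (run Z σ l w₁ - w₁)) ((u₁ - u) - (w₁ - w))
    rw [show (run Z σ l u₁ - u₁) - (run Z σ l w₁ - w₁) + ((u₁ - u) - (w₁ - w))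
      = (run Z σ l u₁ - u) - (run Z σ l w₁ - w) by abel] at h9
    rw [run_cons, run_cons, strength_cons]
    have h10 : 0 ≤ Real.exp (L * strength σ l) - 1 := by
      rw [sub_nonneg]
      exact Real.one_le_exp (mul_nonneg hL (strength_nonneg σ l))
    have h11 := Real.add_one_le_exp (L * |σ j|)
    rw [mul_add, Real.exp_add]
    have h12 : (Real.exp (L * strength σ l) - 1) * ‖u₁ - w₁‖
        ≤ (Real.exp (L * strength σ l) - 1) * (Real.exp (L * |σ j|) * ‖u - w‖) := by
      gcongr
      nlinarith [norm_nonneg (u - w)]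
    nlinarith [norm_nonneg (u - w)]

/-- The products of the wave `t` of the `j`-th family with the waves of `σ` that approach it from
the left. -/
noncomputable def approachOne (G : Fin n → Prop) (σ : Fin n → ℝ) (j : Fin n) (t : ℝ) : ℝ :=
  open Classical in
  ∑ i, if j < i ∨ (i = j ∧ G i ∧ min (σ i) t < 0) then |σ i * t| else 0

/-- The products of approaching waves, those in `σ` being on the left of those in `τ`. -/
noncomputable def approach (G : Fin n → Prop) (σ τ : Fin n → ℝ) : ℝ :=
  ∑ j, approachOne G σ j (τ j)

theorem approachOne_nonneg (G : Fin n → Prop) (σ : Fin n → ℝ) (j : Fin n) (t : ℝ) :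
    0 ≤ approachOne G σ j t :=
  Finset.sum_nonneg fun i _ => by split_ifs <;> positivity

theorem approach_nonneg (G : Fin n → Prop) (σ τ : Fin n → ℝ) : 0 ≤ approach G σ τ :=
  Finset.sum_nonneg fun _ _ => approachOne_nonneg _ _ _ _

-- A wave `t` of family `j`, arriving after all the waves of `σ`, is moved to its place among them.
-- Crossing the larger families costs `|t|` times their strength, once because the direction of the
-- wave `t` is evaluated at a displaced state and once because the crossed waves start from a
-- displaced state. Joining it to `σ j` is exact when `hadd` applies and costs a multiple of `|σ j *
-- t|` otherwise.
set_option maxHeartbeats 1600000 in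
theorem IsCurveFamily.exists_add_wave (h : IsCurveFamily r L Z) {G : Fin n → Prop}
    (hadd : ∀ j u s t, ‖u‖ ≤ r → |s| ≤ r → |t| ≤ r → |s + t| ≤ r → ‖curve (Z j) s u‖ ≤ r →
      (G j → 0 ≤ s ∧ 0 ≤ t) → curve (Z j) t (curve (Z j) s u) = curve (Z j) (s + t) u) :
    ∃ η > 0, η ≤ r ∧ ∃ C > 0, ∀ (σ : Fin n → ℝ) (j : Fin n) (t : ℝ) (u : State n), ‖σ‖ ≤ η →
      |t| ≤ η → ‖u‖ ≤ η →
      ‖curve (Z j) t (runAll Z σ u) - runAll Z (Function.update σ j (σ j + t)) u‖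
        ≤ C * approachOne G σ j t := by
  obtain ⟨M, hM0, hM⟩ := h.exists_bound
  have hr := h.r_pos
  have hL := h.L_nonneg
  obtain ⟨η, hη, e1, e2, e3⟩ : ∃ η > 0, η + M * (n * η + η) ≤ r / 2 ∧ 2 * η ≤ r / 2 ∧
      L * (n * η) ≤ 1 := by
    have a : ∀ a c : ℝ, 0 < c → ∀ᶠ η in 𝓝[>] (0 : ℝ), a * η < c := by
      intro a c hc
      refine nhdsWithin_le_nhds ?_
      have : Tendsto (fun η : ℝ => a * η) (𝓝 0) (𝓝 (a * 0)) := Continuous.tendsto (by fun_prop) 0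
      exact this.eventually_lt_const (by simpa using hc)
    obtain ⟨η, b1, b2, b3, b4⟩ := ((a (1 + M * (n + 1)) (r / 2) (by positivity)).and
      ((a 2 (r / 2) (by positivity)).and ((a (L * n) 1 one_pos).and self_mem_nhdsWithin))).exists
    exact ⟨η, b4, by linarith, b2.le, by linarith⟩
  refine ⟨η, hη, by linarith, 2 * L + 4 * L * M + 3 * (2 * L + L * M) + L * M + 1, by positivity,
    fun σ j t u hσ ht hu => ?_⟩
  have hσi : ∀ i, |σ i| ≤ η := fun i => (norm_le_pi_norm σ i).trans hσ
  have hσr : ∀ i, |σ i| ≤ r := fun i => (hσi i).trans (by linarith)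
  obtain ⟨l₁, l₂, hl⟩ := List.append_of_mem (List.mem_finRange j)
  have hpw : (l₁ ++ j :: l₂).Pairwise (· < ·) := hl ▸ List.pairwise_lt_finRange n
  rw [List.pairwise_append, List.pairwise_cons] at hpw
  obtain ⟨-, ⟨hl₂, hl₂p⟩, hl₁⟩ := hpw
  have hsum : strength σ l₁ + (|σ j| + strength σ l₂) ≤ n * η := by
    rw [← strength_cons, ← strength_append, ← hl, strength_finRange]
    calc _ ≤ ∑ _i : Fin n, η := Finset.sum_le_sum fun i _ => hσi i
      _ = _ := by simp
  set T := strength σ l₂ with hT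
  have hT0 : 0 ≤ T := strength_nonneg _ _
  have hT1 : 0 ≤ strength σ l₁ := strength_nonneg _ _
  set y₀ := run Z σ l₁ u with hy₀
  set y := curve (Z j) (σ j) y₀ with hy
  have hupd₁ : run Z (Function.update σ j (σ j + t)) l₁ u = y₀ :=
    run_congr (fun i hi => Function.update_of_ne (hl₁ i hi j (by simp)).ne _ _) u
  have hupd₂ : ∀ w, run Z (Function.update σ j (σ j + t)) l₂ w = run Z σ l₂ w :=
    run_congr (fun i hi => Function.update_of_ne (hl₂ i hi).ne' _ _)
  rw [runAll, runAll, hl, run_append, run_append, run_cons, run_cons, hupd₁, hupd₂,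
    Function.update_self, ← hy₀, ← hy]
  have b0 : ‖y₀‖ ≤ η + M * strength σ l₁ := by
    have := norm_run_sub_self_le hM0.le hM hσr (l := l₁) (u := u) (by nlinarith [abs_nonneg (σ j)])
    have := norm_sub_norm_le y₀ u
    linarith
  have b0r : ‖y₀‖ ≤ r := by nlinarith [abs_nonneg (σ j)]
  have b1 : ‖y‖ ≤ η + M * (strength σ l₁ + |σ j|) := by
    have := norm_curve_sub_self_le hM (hσr j) (j := j) b0r
    have := norm_sub_norm_le y y₀
    linarith
  have b1T : ‖y‖ + M * T ≤ r / 2 := by nlinarith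
  have htr : |t| ≤ r := by linarith
  have b2 := norm_run_sub_self_le hM0.le hM hσr (l := l₂) (u := y) (by linarith)
  have b2r : ‖run Z σ l₂ y‖ ≤ r := by
    have := norm_sub_norm_le (run Z σ l₂ y) y
    linarith
  set y' := curve (Z j) t y with hy'
  have b3 : ‖y' - y‖ ≤ M * |t| := norm_curve_sub_self_le hM htr (by linarith [mul_nonneg hM0.le hT0])
  have b3r : ‖y'‖ + M * T ≤ r := by
    have := norm_sub_norm_le y' y
    nlinarith [abs_nonneg t]
  set y'' := curve (Z j) (σ j + t) y₀ with hy''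
  have hst : |σ j + t| ≤ r := (abs_add_le _ _).trans (by linarith [hσi j])
  have b4r : ‖y''‖ + M * T ≤ r := by
    have h1 := norm_curve_sub_self_le hM hst (j := j) b0r
    have h2 := norm_sub_norm_le y'' y₀
    have h3 := abs_add_le (σ j) t
    nlinarith [abs_nonneg t]
  have hexp : Real.exp (L * T) - 1 ≤ 2 * (L * T) := by
    have h0 : 0 ≤ L * T := by positivity
    have h1 : L * T ≤ 1 := by
      refine le_trans ?_ e3
      gcongr
      linarith [abs_nonneg (σ j)]
    have := Real.abs_exp_sub_one_sub_id_le (x := L * T) (by rwa [abs_of_nonneg h0])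
    have := (abs_le.1 this).2
    nlinarith
  have hLT1 : L * T ≤ 1 := by
    refine le_trans ?_ e3
    gcongr
    linarith [abs_nonneg (σ j)]
  have hLT0 : 0 ≤ L * T := by positivity
  have c1 := h.norm_run_sub_run_le hM0.le hM hσr (l := l₂) (u := y') (w := y) b3r (by linarith)
  have c2 := h.norm_run_sub_run_le hM0.le hM hσr (l := l₂) (u := y') (w := y'') b3r b4r
  set P : Prop := G j ∧ min (σ j) t < 0 with hP
  have hA : |t| * T + (open Classical in if P then |σ j * t| else 0) ≤ approachOne G σ j t := by
    classical
    have h1 : |t| * T ≤ ∑ i, if j < i then |σ i * t| else 0 := by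
      rw [hT, strength, ← List.sum_toFinset _ (hl₂p.imp fun h => h.ne), Finset.mul_sum,
        ← Finset.sum_filter]
      calc _ = ∑ i ∈ l₂.toFinset, |σ i * t| :=
            Finset.sum_congr rfl fun i _ => by rw [abs_mul, mul_comm]
        _ ≤ _ := Finset.sum_le_sum_of_subset_of_nonneg
            (fun i hi => by simpa using hl₂ i (by simpa using hi)) fun _ _ _ => abs_nonneg _
    have h2 : (if P then |σ j * t| else 0)
        = ∑ i, if i = j ∧ G i ∧ min (σ i) t < 0 then |σ i * t| else 0 := by
      rw [Finset.sum_eq_single j (fun i _ hij => by simp [hij]) (by simp)]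
      simp [hP]
    unfold approachOne
    refine (add_le_add h1 h2.le).trans ?_
    rw [← Finset.sum_add_distrib]
    refine le_of_eq (Finset.sum_congr rfl fun i _ => ?_)
    by_cases hij : j < i
    · simp [hij, hij.ne']
    · simp [hij]
  have d1 : ‖(curve (Z j) t (run Z σ l₂ y) - run Z σ l₂ y) - (y' - y)‖ ≤ L * M * (|t| * T) := by
    have e : (curve (Z j) t (run Z σ l₂ y) - run Z σ l₂ y) - (y' - y)
        = t • (Z j t (run Z σ l₂ y) - Z j t y) := by simp only [hy', curve]; module
    have h7 := h.lip j _ _ t t b2r (by linarith [mul_nonneg hM0.le hT0] : ‖y‖ ≤ r) htr htr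
    rw [sub_self, abs_zero, zero_add] at h7
    rw [e, norm_smul, Real.norm_eq_abs]
    calc _ ≤ |t| * (L * (M * T)) := by gcongr; exact h7.trans (by gcongr)
      _ = _ := by ring
  have d2 : ‖(run Z σ l₂ y' - y') - (run Z σ l₂ y - y)‖ ≤ 2 * L * M * (|t| * T) :=
    c1.trans (by
      calc _ ≤ (2 * (L * T)) * (M * |t|) := by gcongr
        _ = _ := by ring)
  have d3 : ‖y' - y''‖ ≤ (2 * L + L * M) * (open Classical in if P then |σ j * t| else 0) := by
    classical
    by_cases hp : P
    · rw [if_pos hp]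
      have e : y' - y'' = σ j • (Z j (σ j) y₀ - Z j (σ j + t) y₀)
          + t • (Z j t y - Z j (σ j + t) y₀) := by
        simp only [hy', hy'', curve]
        rw [hy, curve]
        module
      have h1 := h.lip j y₀ y₀ (σ j) (σ j + t) b0r b0r (hσr j) hst
      have h2 := h.lip j y y₀ t (σ j + t) (by linarith [mul_nonneg hM0.le hT0]) b0r htr hst
      have h3 := norm_curve_sub_self_le hM (hσr j) (j := j) b0r
      rw [show σ j - (σ j + t) = -t by ring, abs_neg, sub_self, norm_zero, add_zero] at h1
      rw [show t - (σ j + t) = -σ j by ring, abs_neg] at h2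
      rw [e]
      refine (norm_add_le _ _).trans ?_
      rw [norm_smul, norm_smul, Real.norm_eq_abs, Real.norm_eq_abs, abs_mul]
      calc _ ≤ |σ j| * (L * |t|) + |t| * (L * (|σ j| + M * |σ j|)) := by
            gcongr
            exact h2.trans (by gcongr)
        _ = _ := by ring
    · rw [if_neg hp, mul_zero]
      have : y' = y'' := hadd j y₀ (σ j) t b0r (hσr j) htr hst
        (by change ‖y‖ ≤ r; linarith [mul_nonneg hM0.le hT0])
        (fun hg => by
          have : ¬ min (σ j) t < 0 := fun hm => hp ⟨hg, hm⟩
          exact le_min_iff.1 (not_lt.1 this))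
      simp [this]
  have d4 := norm_add_le ((run Z σ l₂ y' - y') - (run Z σ l₂ y'' - y'')) (y' - y'')
  rw [show (run Z σ l₂ y' - y') - (run Z σ l₂ y'' - y'') + (y' - y'')
    = run Z σ l₂ y' - run Z σ l₂ y'' by abel] at d4
  have d5 : (Real.exp (L * T) - 1) * ‖y' - y''‖ ≤ 2 * ‖y' - y''‖ := by
    gcongr; linarith
  have d6 := norm_add₃_le
    (a := (curve (Z j) t (run Z σ l₂ y) - run Z σ l₂ y) - (y' - y))
    (b := -((run Z σ l₂ y' - y') - (run Z σ l₂ y - y)))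
    (c := run Z σ l₂ y' - run Z σ l₂ y'')
  rw [norm_neg, show (curve (Z j) t (run Z σ l₂ y) - run Z σ l₂ y) - (y' - y)
    + -((run Z σ l₂ y' - y') - (run Z σ l₂ y - y)) + (run Z σ l₂ y' - run Z σ l₂ y'')
    = curve (Z j) t (run Z σ l₂ y) - run Z σ l₂ y'' by abel] at d6
  have hQ : 0 ≤ (open Classical in if P then |σ j * t| else 0) := by
    split_ifs <;> positivity
  set Qj := (open Classical in if P then |σ j * t| else 0)
  have hTt : 0 ≤ |t| * T := by positivity
  calc _ ≤ 3 * L * M * (|t| * T) + 3 * ((2 * L + L * M) * Qj) := by linarith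
    _ ≤ (2 * L + 4 * L * M + 3 * (2 * L + L * M) + L * M + 1) * (|t| * T + Qj) := by
        have : 0 ≤ L * M := by positivity
        nlinarith [mul_nonneg this hTt, mul_nonneg this hQ, mul_nonneg hL hTt, mul_nonneg hL hQ]
    _ ≤ _ := by gcongr

end Data
namespace Data
variable {n : ℕ} {Z : Fin n → ℝ → State n → State n} {r L M : ℝ}

/-- When only `Q` holds, the expression is `|a t| - a⁺ t⁺`, a Lipschitz function of `a` with
constant `|t|`. -/
theorem ite_min_neg_mul_le (P Q : Prop) [Decidable P] [Decidable Q] (a b t : ℝ) :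
    (if P ∨ (Q ∧ min a t < 0) then |a * t| else 0)
      ≤ (if P ∨ (Q ∧ min b t < 0) then |b * t| else 0) + |t| * |a - b| := by
  have h1 : |a * t| ≤ |b * t| + |t| * |a - b| := by
    rw [abs_mul, abs_mul]
    have := abs_add_le b (a - b)
    rw [add_sub_cancel] at this
    nlinarith [abs_nonneg t]
  have h0 : 0 ≤ |t| * |a - b| := by positivity
  by_cases hP : P
  · simpa [hP] using h1
  by_cases hQ : Q
  · simp only [hP, hQ, false_or, true_and]
    split_ifs with h2 h3 h3
    · exact h1
    · rw [zero_add, abs_mul, mul_comm]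
      refine mul_le_mul_of_nonneg_left ?_ (abs_nonneg t)
      rw [not_lt, le_min_iff] at h3
      have h4 : a < 0 := by
        rcases min_lt_iff.1 h2 with h | h
        · exact h
        · linarith
      rw [abs_of_neg h4, abs_of_nonpos (by linarith)]
      linarith
    · positivity
    · linarith
  · simpa [hP, hQ] using h0

/-- Only the families `i ≥ j` on the left can approach a wave of family `j`, so nothing is required
of the smaller ones. This permits the comparison with a fan into which the smaller families have
already been merged. -/
theorem approachOne_le (G : Fin n → Prop) (σ τ : Fin n → ℝ) (j : Fin n) (t : ℝ) {g : Fin n → ℝ}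
    (hg : ∀ i, 0 ≤ g i) (h : ∀ i, j ≤ i → |τ i - σ i| ≤ g i) :
    approachOne G τ j t ≤ approachOne G σ j t + |t| * ∑ i, g i := by
  classical
  unfold approachOne
  rw [Finset.mul_sum, ← Finset.sum_add_distrib]
  refine Finset.sum_le_sum fun i _ => ?_
  by_cases hij : j ≤ i
  · have h1 := ite_min_neg_mul_le (j < i) (i = j ∧ G i) (τ i) (σ i) t
    simp only [and_assoc] at h1
    refine (le_of_eq ?_).trans (h1.trans (add_le_add (le_of_eq ?_)
      (mul_le_mul_of_nonneg_left (h i hij) (abs_nonneg t)))) <;> congr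
  · have h1 : ¬ j < i := fun h => hij h.le
    have h2 : i ≠ j := fun h => hij h.ge
    simp only [h1, h2, false_and, or_self, if_false, zero_add]
    exact mul_nonneg (abs_nonneg t) (hg i)

theorem sum_abs_le_card_mul_norm (σ : Fin n → ℝ) : ∑ i, |σ i| ≤ n * ‖σ‖ := by
  calc _ ≤ ∑ _i : Fin n, ‖σ‖ := Finset.sum_le_sum fun i _ => norm_le_pi_norm σ i
    _ = _ := by simp

set_option maxHeartbeats 1600000 in
/-- Interaction estimate for two adjacent Riemann problems. -/
theorem IsCurveFamily.exists_interaction (h : IsCurveFamily r L Z) {G : Fin n → Prop}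
    (hadd : ∀ j u s t, ‖u‖ ≤ r → |s| ≤ r → |t| ≤ r → |s + t| ≤ r → ‖curve (Z j) s u‖ ≤ r →
      (G j → 0 ≤ s ∧ 0 ≤ t) → curve (Z j) t (curve (Z j) s u) = curve (Z j) (s + t) u) :
    ∃ η > 0, η ≤ r ∧ ∃ C > 0, ∃ r₃ > 0, ∀ (σ τ σ' : Fin n → ℝ) (u w w' : State n),
      ‖σ‖ ≤ η → ‖τ‖ ≤ η → ‖σ'‖ ≤ η → ‖u‖ ≤ r₃ → ‖w‖ ≤ r₃ → ‖w'‖ ≤ r₃ → runAll Z σ u = w →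
      runAll Z τ w = w' → runAll Z σ' u = w' →
      ∑ i, |σ' i - σ i - τ i| ≤ C * approach G σ τ := by
  obtain ⟨M, hM0, hM⟩ := h.exists_bound
  have hr := h.r_pos
  obtain ⟨η₁, hη₁, hη₁r, C₁, hC₁, hinj, hsurj⟩ := h.exists_inverse
  obtain ⟨η₂, hη₂, hη₂r, C₂, hC₂, hwave⟩ := h.exists_add_wave hadd
  set η₀ := min η₁ η₂ with hη₀
  have hη₀0 : 0 < η₀ := lt_min hη₁ hη₂
  have h01 : η₀ ≤ η₁ := min_le_left _ _
  have h02 : η₀ ≤ η₂ := min_le_right _ _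
  obtain ⟨rs, hrs, hsol⟩ := hsurj (η₀ / 2) (by positivity)
  set R := min rs (min r η₀) with hR
  have hR0 : 0 < R := lt_min hrs (lt_min hr hη₀0)
  have hRrs : R ≤ rs := min_le_left _ _
  have hRr : R ≤ r := (min_le_right _ _).trans (min_le_left _ _)
  have hRη : R ≤ η₀ := (min_le_right _ _).trans (min_le_right _ _)
  -- The waves of `τ` satisfy `‖τ‖ ≤ 2 C₁ r₃`, so with this choice the states between them remain in
  -- the ball of radius `R`, where the Riemann problem from `u` is solvable.
  set r₃ := R / (1 + 2 * M * n * C₁) with hr₃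
  have hr₃0 : 0 < r₃ := by positivity
  have hr₃R : r₃ * (1 + 2 * M * n * C₁) = R := by rw [hr₃]; field_simp
  have hr₃R' : r₃ ≤ R := div_le_self hR0.le (by linarith [show 0 ≤ 2 * M * n * C₁ by positivity])
  set a := n * (C₁ * C₂) * (1 + r) with ha
  have ha0 : 0 ≤ a := by positivity
  refine ⟨η₀ / 2, by positivity, by linarith, (1 + a) ^ n, by positivity, r₃, hr₃0, ?_⟩
  intro σ τ σ' u w w' hσ hτ hσ' hu hw hw' huw hww' huw'
  set X := approach G σ τ with hX
  have hX0 : 0 ≤ X := approach_nonneg _ _ _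
  have hτs : ‖τ‖ ≤ C₁ * (2 * r₃) := by
    have := hinj τ 0 w w (by linarith) (by simpa using hη₁.le) (by linarith) (by linarith)
    rw [runAll, runAll, run_zero, sub_self, norm_zero, add_zero, sub_zero, ← runAll, hww'] at this
    refine this.trans ?_
    gcongr
    linarith [norm_sub_le w' w]
  have hp : ∀ k, ‖run Z τ ((List.finRange n).take k) w‖ ≤ R := by
    intro k
    have h1 : strength τ ((List.finRange n).take k) ≤ n * (C₁ * (2 * r₃)) := by
      have e : strength τ ((List.finRange n).take k) + strength τ ((List.finRange n).drop k)
          = ∑ i, |τ i| := by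
        rw [← strength_append, List.take_append_drop, strength_finRange]
      have := strength_nonneg τ ((List.finRange n).drop k)
      have := sum_abs_le_card_mul_norm τ
      have : (n : ℝ) * ‖τ‖ ≤ n * (C₁ * (2 * r₃)) := by gcongr
      linarith
    have h2 : M * strength τ ((List.finRange n).take k) ≤ M * (n * (C₁ * (2 * r₃))) := by gcongr
    have h3 := norm_run_sub_self_le hM0.le hM (σ := τ)
      (fun j => (norm_le_pi_norm τ j).trans (by linarith)) (l := (List.finRange n).take k)
      (u := w) (by nlinarith)
    have h4 := norm_sub_norm_le (run Z τ ((List.finRange n).take k) w) w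
    nlinarith
  -- The waves of `τ` are added one at a time: `τ'` solves the problem from `u` to the state reached
  -- after `k` of them. Its distance to the plain sum of strengths obeys a discrete Gronwall
  -- inequality with factor `1 + a`, so it remains proportional to `X`.
  have key : ∀ k ≤ n, ∃ τ' : Fin n → ℝ, ‖τ'‖ ≤ η₀ / 2 ∧
      runAll Z τ' u = run Z τ ((List.finRange n).take k) w ∧
      ∑ i : Fin n, |τ' i - σ i - (if (i : ℕ) < k then τ i else 0)| ≤ ((1 + a) ^ k - 1) * X := by
    intro k
    induction k with
    | zero =>
      intro _
      exact ⟨σ, hσ, by simpa using huw, by simp⟩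
    | succ k ih =>
      intro hk
      obtain ⟨τ', hτ', hrun, hsum⟩ := ih (by omega)
      set j : Fin n := ⟨k, hk⟩ with hj
      have hnext : run Z τ ((List.finRange n).take (k + 1)) w
          = curve (Z j) (τ j) (runAll Z τ' u) := by
        have hk' : (List.finRange n)[k]? = some j := by
          rw [List.getElem?_eq_getElem (by simpa using hk), List.getElem_finRange]
          rfl
        rw [hrun, List.take_add_one, run_append, hk']
        rfl
      obtain ⟨τ'', hτ'', hrun''⟩ := hsol u _ (by linarith) ((hp (k + 1)).trans hRrs)
      set τh := Function.update τ' j (τ' j + τ j) with hτh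
      have hτj : |τ j| ≤ η₀ / 2 := (norm_le_pi_norm τ j).trans hτ
      have hτhn : ‖τh‖ ≤ η₀ := by
        rw [pi_norm_le_iff_of_nonneg hη₀0.le]
        intro i
        by_cases hij : i = j
        · rw [hij, hτh, Function.update_self, Real.norm_eq_abs]
          have h1 : |τ' j| ≤ η₀ / 2 := (norm_le_pi_norm τ' j).trans hτ'
          exact (abs_add_le _ _).trans (by linarith)
        · rw [hτh, Function.update_of_ne hij]
          exact (norm_le_pi_norm τ' i).trans (by linarith)
      have hτ''n : ‖τ''‖ ≤ η₀ / 2 := (pi_norm_le_iff_of_nonneg (by positivity)).2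
        fun i => (hτ'' i).le
      set g := fun i : Fin n => |τ' i - σ i - (if (i : ℕ) < k then τ i else 0)| with hg
      -- The families `i ≥ k` of `τ` have not been added yet, so for these `g i` is just `|τ' i - σ
      -- i|`.
      have hap : approachOne G τ' j (τ j) ≤ X + r * ∑ i, g i := by
        have h1 := approachOne_le G σ τ' j (τ j) (g := g) (fun i => abs_nonneg _) (fun i hi => by
          have : ¬ (i : ℕ) < k := not_lt.2 hi
          simp [hg, this])
        have h2 : approachOne G σ j (τ j) ≤ X :=
          Finset.single_le_sum (f := fun j => approachOne G σ j (τ j))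
            (fun _ _ => approachOne_nonneg _ _ _ _) (Finset.mem_univ j)
        have h3 : |τ j| * ∑ i, g i ≤ r * ∑ i, g i :=
          mul_le_mul_of_nonneg_right (by linarith) (Finset.sum_nonneg fun _ _ => abs_nonneg _)
        linarith
      have hdiff : ‖τ'' - τh‖ ≤ C₁ * C₂ * (X + r * ∑ i, g i) := by
        have h1 := hinj τ'' τh u u (by linarith) (by linarith) (by linarith) (by linarith)
        rw [hrun'', sub_self, norm_zero, add_zero, hnext] at h1
        have h2 := hwave τ' j (τ j) u (by linarith) (by linarith) (by linarith)
        calc _ ≤ C₁ * (C₂ * approachOne G τ' j (τ j)) := h1.trans (by gcongr)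
          _ ≤ C₁ * (C₂ * (X + r * ∑ i, g i)) := by gcongr
          _ = _ := by ring
      refine ⟨τ'', hτ''n, hrun'', ?_⟩
      have hterm : ∀ i : Fin n, |τ'' i - σ i - (if (i : ℕ) < k + 1 then τ i else 0)|
          ≤ |(τ'' - τh) i| + g i := by
        intro i
        have e : τ'' i - σ i - (if (i : ℕ) < k + 1 then τ i else 0)
            = (τ'' - τh) i + (τ' i - σ i - (if (i : ℕ) < k then τ i else 0)) := by
          by_cases hij : i = j
          · have : (i : ℕ) = k := by rw [hij]
            subst hij
            simp [hτh, hj]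
            ring
          · have h1 : (i : ℕ) < k + 1 ↔ (i : ℕ) < k := by
              have : (i : ℕ) ≠ k := fun h => hij (Fin.ext h)
              omega
            simp only [h1, Pi.sub_apply, hτh, Function.update_of_ne hij]
            ring
        rw [e]
        exact abs_add_le _ _
      have hS : ∑ i, |(τ'' - τh) i| ≤ n * (C₁ * C₂ * (X + r * ∑ i, g i)) :=
        (sum_abs_le_card_mul_norm _).trans (by gcongr)
      have hg0 : 0 ≤ ∑ i, g i := Finset.sum_nonneg fun _ _ => abs_nonneg _
      calc _ ≤ ∑ i, (|(τ'' - τh) i| + g i) := Finset.sum_le_sum fun i _ => hterm i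
        _ ≤ n * (C₁ * C₂ * (X + r * ∑ i, g i)) + ∑ i, g i := by
            rw [Finset.sum_add_distrib]; linarith
        _ ≤ a * X + (1 + a) * ∑ i, g i := by
            rw [ha]
            have : 0 ≤ n * (C₁ * C₂) := by positivity
            nlinarith [mul_nonneg this (mul_nonneg hr.le hX0), mul_nonneg this hg0]
        _ ≤ a * X + (1 + a) * (((1 + a) ^ k - 1) * X) := by gcongr
        _ = _ := by ring
  obtain ⟨τ', hτ', hrun, hsum⟩ := key n le_rfl
  have heq : τ' = σ' := by
    have := hinj τ' σ' u u (by linarith) (by linarith) (by linarith) (by linarith)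
    rw [hrun, List.take_of_length_le (by simp), ← runAll, hww', huw', sub_self, sub_self,
      norm_zero, add_zero, mul_zero] at this
    exact sub_eq_zero.1 (norm_le_zero_iff.1 this)
  subst heq
  simp only [Fin.is_lt, if_true] at hsum
  linarith

end Data
-- Well-posedness of the Riemann and shock problems.
namespace Data
variable {n : ℕ} {Z : Fin n → ℝ → State n → State n} {r L M : ℝ}

/-- The relation `P` is abstract so as to serve for the Lax and for the shock curves. The radius
satisfies `ρ₀ + M n ρ₀ ≤ r`, which keeps all partial compositions in the ball where `P` is
described. -/
theorem IsCurveFamily.exists_solver (h : IsCurveFamily r L Z)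
    {P : Fin n → ℝ → State n → State n → Prop}
    (hP : ∀ j u s w, ‖u‖ ≤ r → |s| ≤ r → (P j s u w ↔ w = curve (Z j) s u)) :
    ∃ ρ₀ > 0, ∃ C > 0,
      (∀ (σ : Fin n → ℝ) (u w : State n), ‖σ‖ ≤ ρ₀ → ‖u‖ ≤ ρ₀ →
        ((∃ p : Fin (n + 1) → State n, p 0 = u ∧ p (Fin.last n) = w ∧
          ∀ j : Fin n, P j (σ j) (p j.castSucc) (p j.succ)) ↔ runAll Z σ u = w)) ∧
      (∀ (σ τ : Fin n → ℝ) (u w : State n), ‖σ‖ ≤ ρ₀ → ‖τ‖ ≤ ρ₀ → ‖u‖ ≤ ρ₀ → ‖w‖ ≤ ρ₀ →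
        ‖σ - τ‖ ≤ C * (‖runAll Z σ u - runAll Z τ w‖ + ‖u - w‖)) ∧
      (∀ (σ : Fin n → ℝ) (u : State n), ‖σ‖ ≤ ρ₀ → ‖u‖ ≤ ρ₀ →
        ‖runAll Z σ u - u‖ ≤ C * ∑ i, |σ i|) ∧
      (∀ ρ > 0, ∃ r₂ > 0, ∀ u w : State n, ‖u‖ ≤ r₂ → ‖w‖ ≤ r₂ →
        ∃ σ : Fin n → ℝ, (∀ i, |σ i| < ρ) ∧ runAll Z σ u = w) := by
  obtain ⟨M, hM0, hM⟩ := h.exists_bound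
  obtain ⟨η, hη, hηr, C, hC, hinj, hsurj⟩ := h.exists_inverse
  have hr := h.r_pos
  set ρ₀ := min η (r / (1 + M * n)) with hρ₀
  have hρ₀0 : 0 < ρ₀ := lt_min hη (by positivity)
  have h1 : ρ₀ ≤ η := min_le_left _ _
  have h2 : ρ₀ + M * (n * ρ₀) ≤ r := by
    have : ρ₀ ≤ r / (1 + M * n) := min_le_right _ _
    rw [le_div_iff₀ (by positivity)] at this
    linarith
  have hstr : ∀ (σ : Fin n → ℝ) (l l' : List (Fin n)), l ++ l' = List.finRange n → ‖σ‖ ≤ ρ₀ →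
      strength σ l ≤ n * ρ₀ := by
    intro σ l l' hl hσ
    have e : strength σ l + strength σ l' = ∑ i, |σ i| := by
      rw [← strength_append, hl, strength_finRange]
    have := strength_nonneg σ l'
    have := sum_abs_le_card_mul_norm σ
    have : (n : ℝ) * ‖σ‖ ≤ n * ρ₀ := by gcongr
    linarith
  refine ⟨ρ₀, hρ₀0, C + M, by positivity, fun σ u w hσ hu => ?_, fun σ τ u w hσ hτ hu hw => ?_,
    fun σ u hσ hu => ?_, hsurj⟩
  · have hσr : ∀ i, |σ i| ≤ r := fun i =>
      (norm_le_pi_norm σ i).trans ((hσ.trans h1).trans hηr)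
    refine exists_path_iff (r := r) (P := fun j => P j (σ j))
      (fun j p p' hp => hP j p (σ j) p' hp (hσr j)) fun k => ?_
    have h3 := hstr σ _ _ (List.take_append_drop k _) hσ
    have h4 : M * strength σ ((List.finRange n).take k) ≤ M * (n * ρ₀) := by gcongr
    have h5 := norm_run_sub_self_le hM0.le hM hσr (l := (List.finRange n).take k) (u := u)
      (by linarith)
    have h6 := norm_sub_norm_le (run Z σ ((List.finRange n).take k) u) u
    linarith
  · refine (hinj σ τ u w (hσ.trans h1) (hτ.trans h1) (hu.trans h1) (hw.trans h1)).trans ?_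
    gcongr
    linarith
  · have hσr : ∀ i, |σ i| ≤ r := fun i =>
      (norm_le_pi_norm σ i).trans ((hσ.trans h1).trans hηr)
    have h3 := hstr σ (List.finRange n) [] (List.append_nil _) hσ
    have h4 : M * strength σ (List.finRange n) ≤ M * (n * ρ₀) := by gcongr
    have h5 := norm_run_sub_self_le hM0.le hM hσr (l := List.finRange n) (u := u) (by linarith)
    rw [strength_finRange] at h5
    refine h5.trans ?_
    have : 0 ≤ ∑ i, |σ i| := Finset.sum_nonneg fun _ _ => abs_nonneg _
    nlinarith

/-- For states in the ball of radius `r`, the Riemann problems and the corresponding problems for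
the shock curves are well posed, with Lipschitz solutions that satisfy the interaction estimate. -/
structure IsWellPosed (S : Data n) (ρ r C : ℝ) : Prop where
  riemann : ∀ u w, ‖u‖ ≤ r → ‖w‖ ≤ r → ∃! s, S.SolvesRiemann ρ u w s
  shock : ∀ u w, ‖u‖ ≤ r → ‖w‖ ≤ r → ∃! q, S.SolvesShock ρ u w q
  waves_lip : ∀ u w u' w', ‖u‖ ≤ r → ‖w‖ ≤ r → ‖u'‖ ≤ r → ‖w'‖ ≤ r →
    ‖S.waves ρ u w - S.waves ρ u' w'‖ ≤ C * (‖w - w'‖ + ‖u - u'‖)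
  shocks_lip : ∀ u w u' w', ‖u‖ ≤ r → ‖w‖ ≤ r → ‖u'‖ ≤ r → ‖w'‖ ≤ r →
    ‖S.shocks ρ u w - S.shocks ρ u' w'‖ ≤ C * (‖w - w'‖ + ‖u - u'‖)
  waves_self : ∀ u, ‖u‖ ≤ r → S.waves ρ u u = 0
  shocks_self : ∀ u, ‖u‖ ≤ r → S.shocks ρ u u = 0
  interaction : ∀ u w w', ‖u‖ ≤ r → ‖w‖ ≤ r → ‖w'‖ ≤ r →
    ∑ i, |S.waves ρ u w' i - S.waves ρ u w i - S.waves ρ w w' i|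
      ≤ C * approach S.GenuinelyNonlinear (S.waves ρ u w) (S.waves ρ w w')
  norm_sub_le : ∀ u w, ‖u‖ ≤ r → (∃ s, S.SolvesRiemann ρ u w s) →
    ‖w - u‖ ≤ C * ∑ i, |S.waves ρ u w i|

theorem waves_spec {S : Data n} {ρ : ℝ} {u w : State n} (h : ∃ s, S.SolvesRiemann ρ u w s) :
    S.SolvesRiemann ρ u w (S.waves ρ u w) := by
  rw [waves, dif_pos h]; exact h.choose_spec

theorem shocks_spec {S : Data n} {ρ : ℝ} {u w : State n} (h : ∃ s, S.SolvesShock ρ u w s) :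
    S.SolvesShock ρ u w (S.shocks ρ u w) := by
  rw [shocks, dif_pos h]; exact h.choose_spec

/-- The order of the quantifiers matters: `C`, and with it the final `K`, is chosen before `ρ`,
whereas the radius `r` of states connected by waves smaller than `ρ` is chosen after it. -/
theorem exists_isWellPosed {S : Data n} (hS : S.Admissible) (hN : S.Normalized) :
    ∃ ρ₀ > 0, ∃ C > 0, ∀ ρ > 0, ρ < ρ₀ → ∃ r > 0, IsWellPosed S ρ r C := by
  obtain ⟨R, L, ZL, ZS, hL, hSh, hwc⟩ := exists_waveCurves hS hN
  obtain ⟨ρ₁, hρ₁, C₁, hC₁, path₁, lip₁, bd₁, sol₁⟩ :=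
    hL.exists_solver (P := S.IsLax) (fun j u s w hu hs => (hwc j).lax_iff u s w hu hs)
  obtain ⟨ρ₂, hρ₂, C₂, hC₂, path₂, lip₂, -, sol₂⟩ :=
    hSh.exists_solver (P := S.IsShock) (fun j u s w hu hs => (hwc j).shock_iff u s w hu hs)
  obtain ⟨η, hη, -, C₃, hC₃, r₃, hr₃, hint⟩ := hL.exists_interaction
    (G := S.GenuinelyNonlinear) (fun j => (hwc j).add)
  refine ⟨min ρ₁ (min ρ₂ η), lt_min hρ₁ (lt_min hρ₂ hη), C₁ + C₂ + C₃, by positivity,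
    fun ρ hρ hlt => ?_⟩
  obtain ⟨hlt₁, hlt⟩ := lt_min_iff.1 hlt
  obtain ⟨hlt₂, hlt₃⟩ := lt_min_iff.1 hlt
  obtain ⟨ra, hra, sola⟩ := sol₁ ρ hρ
  obtain ⟨rb, hrb, solb⟩ := sol₂ ρ hρ
  set r := min (min ra rb) (min r₃ (min ρ₁ ρ₂)) with hr
  have hr0 : 0 < r := lt_min (lt_min hra hrb) (lt_min hr₃ (lt_min hρ₁ hρ₂))
  have l1 : r ≤ ra := (min_le_left _ _).trans (min_le_left _ _)
  have l2 : r ≤ rb := (min_le_left _ _).trans (min_le_right _ _)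
  have l3 : r ≤ r₃ := (min_le_right _ _).trans (min_le_left _ _)
  have l4 : r ≤ ρ₁ := (min_le_right _ _).trans ((min_le_right _ _).trans (min_le_left _ _))
  have l5 : r ≤ ρ₂ := (min_le_right _ _).trans ((min_le_right _ _).trans (min_le_right _ _))
  have nrm : ∀ {σ : Fin n → ℝ}, (∀ i, |σ i| < ρ) → ‖σ‖ ≤ ρ := fun h =>
    (pi_norm_le_iff_of_nonneg hρ.le).2 fun i => (h i).le
  have iff₁ : ∀ u w s, ‖u‖ ≤ r → (S.SolvesRiemann ρ u w s ↔ (∀ i, |s i| < ρ) ∧ runAll ZL s u = w) :=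
    fun u w s hu => and_congr_right fun hs =>
      path₁ s u w ((nrm hs).trans hlt₁.le) (hu.trans l4)
  have iff₂ : ∀ u w s, ‖u‖ ≤ r → (S.SolvesShock ρ u w s ↔ (∀ i, |s i| < ρ) ∧ runAll ZS s u = w) :=
    fun u w s hu => and_congr_right fun hs =>
      path₂ s u w ((nrm hs).trans hlt₂.le) (hu.trans l5)
  have ex₁ : ∀ u w, ‖u‖ ≤ r → ‖w‖ ≤ r → ∃ s, S.SolvesRiemann ρ u w s := fun u w hu hw => by
    obtain ⟨s, hs⟩ := sola u w (hu.trans l1) (hw.trans l1)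
    exact ⟨s, (iff₁ u w s hu).2 hs⟩
  have ex₂ : ∀ u w, ‖u‖ ≤ r → ‖w‖ ≤ r → ∃ s, S.SolvesShock ρ u w s := fun u w hu hw => by
    obtain ⟨s, hs⟩ := solb u w (hu.trans l2) (hw.trans l2)
    exact ⟨s, (iff₂ u w s hu).2 hs⟩
  have lipw : ∀ u w s u' w' s', ‖u‖ ≤ r → ‖u'‖ ≤ r → S.SolvesRiemann ρ u w s →
      S.SolvesRiemann ρ u' w' s' → ‖s - s'‖ ≤ C₁ * (‖w - w'‖ + ‖u - u'‖) := by
    intro u w s u' w' s' hu hu' hs hs'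
    obtain ⟨h1, h2⟩ := (iff₁ u w s hu).1 hs
    obtain ⟨h3, h4⟩ := (iff₁ u' w' s' hu').1 hs'
    have := lip₁ s s' u u' ((nrm h1).trans hlt₁.le) ((nrm h3).trans hlt₁.le) (hu.trans l4)
      (hu'.trans l4)
    rwa [h2, h4] at this
  have lips : ∀ u w s u' w' s', ‖u‖ ≤ r → ‖u'‖ ≤ r → S.SolvesShock ρ u w s →
      S.SolvesShock ρ u' w' s' → ‖s - s'‖ ≤ C₂ * (‖w - w'‖ + ‖u - u'‖) := by
    intro u w s u' w' s' hu hu' hs hs'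
    obtain ⟨h1, h2⟩ := (iff₂ u w s hu).1 hs
    obtain ⟨h3, h4⟩ := (iff₂ u' w' s' hu').1 hs'
    have := lip₂ s s' u u' ((nrm h1).trans hlt₂.le) ((nrm h3).trans hlt₂.le) (hu.trans l5)
      (hu'.trans l5)
    rwa [h2, h4] at this
  have zero₁ : ∀ u, ‖u‖ ≤ r → S.SolvesRiemann ρ u u 0 := fun u hu =>
    (iff₁ u u 0 hu).2 ⟨fun i => by simpa using hρ, run_zero _ _⟩
  have zero₂ : ∀ u, ‖u‖ ≤ r → S.SolvesShock ρ u u 0 := fun u hu =>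
    (iff₂ u u 0 hu).2 ⟨fun i => by simpa using hρ, run_zero _ _⟩
  have eq_of : ∀ {C : ℝ} {s s' : Fin n → ℝ} {u w : State n},
      ‖s - s'‖ ≤ C * (‖w - w‖ + ‖u - u‖) → s = s' := fun h => by
    simp only [sub_self, norm_zero, add_zero, mul_zero] at h
    exact sub_eq_zero.1 (norm_le_zero_iff.1 h)
  refine ⟨r, hr0, fun u w hu hw => ?_, fun u w hu hw => ?_, fun u w u' w' hu hw hu' hw' => ?_,
    fun u w u' w' hu hw hu' hw' => ?_, fun u hu => ?_, fun u hu => ?_, fun u w w' hu hw hw' => ?_,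
    fun u w hu hex => ?_⟩
  · obtain ⟨s, hs⟩ := ex₁ u w hu hw
    exact ⟨s, hs, fun s' hs' => eq_of (lipw u w s' u w s hu hu hs' hs)⟩
  · obtain ⟨s, hs⟩ := ex₂ u w hu hw
    exact ⟨s, hs, fun s' hs' => eq_of (lips u w s' u w s hu hu hs' hs)⟩
  · refine (lipw u w _ u' w' _ hu hu' (waves_spec (ex₁ u w hu hw))
      (waves_spec (ex₁ u' w' hu' hw'))).trans ?_
    gcongr
    linarith
  · refine (lips u w _ u' w' _ hu hu' (shocks_spec (ex₂ u w hu hw))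
      (shocks_spec (ex₂ u' w' hu' hw'))).trans ?_
    gcongr
    linarith
  · exact eq_of (lipw u u _ u u _ hu hu (waves_spec ⟨0, zero₁ u hu⟩) (zero₁ u hu))
  · exact eq_of (lips u u _ u u _ hu hu (shocks_spec ⟨0, zero₂ u hu⟩) (zero₂ u hu))
  · obtain ⟨a1, a2⟩ := (iff₁ _ _ _ hu).1 (waves_spec (ex₁ u w hu hw))
    obtain ⟨b1, b2⟩ := (iff₁ _ _ _ hw).1 (waves_spec (ex₁ w w' hw hw'))
    obtain ⟨c1, c2⟩ := (iff₁ _ _ _ hu).1 (waves_spec (ex₁ u w' hu hw'))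
    refine (hint _ _ _ u w w' ((nrm a1).trans hlt₃.le) ((nrm b1).trans hlt₃.le)
      ((nrm c1).trans hlt₃.le) (hu.trans l3) (hw.trans l3) (hw'.trans l3) a2 b2 c2).trans ?_
    refine mul_le_mul_of_nonneg_right ?_ (approach_nonneg _ _ _)
    linarith
  · obtain ⟨a1, a2⟩ := (iff₁ _ _ _ hu).1 (waves_spec hex)
    have := bd₁ _ u ((nrm a1).trans hlt₁.le) (hu.trans l4)
    rw [a2] at this
    refine this.trans ?_
    have : 0 ≤ ∑ i, |S.waves ρ u w i| := Finset.sum_nonneg fun _ _ => abs_nonneg _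
    nlinarith

end Data
-- Potentials of lists of Riemann problems and their decrease under merging.
namespace Data
variable {n : ℕ} {G : Fin n → Prop}

/-- For fixed `t`, both `|a t|` and `|a t| - a⁺ t⁺` are subadditive in `a`; the deviation of `a`
from `b + c` is absorbed by the Lipschitz bound. -/
theorem ite_min_neg_mul_le_add (P Q : Prop) [Decidable P] [Decidable Q] (a b c t : ℝ) :
    (if P ∨ (Q ∧ min a t < 0) then |a * t| else 0)
      ≤ (if P ∨ (Q ∧ min b t < 0) then |b * t| else 0)
        + (if P ∨ (Q ∧ min c t < 0) then |c * t| else 0) + |t| * |a - b - c| := by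
  have h1 := ite_min_neg_mul_le P Q a (b + c) t
  rw [← sub_sub] at h1
  refine h1.trans (add_le_add_left ?_ _)
  have h2 : |(b + c) * t| ≤ |b * t| + |c * t| := by rw [add_mul]; exact abs_add_le _ _
  by_cases hP : P
  · simpa [hP] using h2
  by_cases hQ : Q
  · simp only [hP, hQ, false_or, true_and]
    by_cases hb : min b t < 0 <;> by_cases hc : min c t < 0
    · rw [if_pos hb, if_pos hc]
      split_ifs
      · exact h2
      · positivity
    · rw [if_pos hb, if_neg hc]
      rw [not_lt, le_min_iff] at hc
      have hb' : b < 0 := (min_lt_iff.1 hb).resolve_right (by linarith [hc.2])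
      split_ifs with h
      · rw [add_zero, abs_mul, abs_mul]
        refine mul_le_mul_of_nonneg_right ?_ (abs_nonneg t)
        have : b + c < 0 := (min_lt_iff.1 h).resolve_right (by linarith [hc.2])
        rw [abs_of_neg this, abs_of_neg hb']
        linarith [hc.1]
      · positivity
    · rw [if_neg hb, if_pos hc]
      rw [not_lt, le_min_iff] at hb
      have hc' : c < 0 := (min_lt_iff.1 hc).resolve_right (by linarith [hb.2])
      split_ifs with h
      · rw [zero_add, abs_mul, abs_mul]
        refine mul_le_mul_of_nonneg_right ?_ (abs_nonneg t)
        have : b + c < 0 := (min_lt_iff.1 h).resolve_right (by linarith [hb.2])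
        rw [abs_of_neg this, abs_of_neg hc']
        linarith [hb.1]
      · positivity
    · rw [if_neg hb, if_neg hc]
      rw [not_lt, le_min_iff] at hb hc
      rw [if_neg (not_lt.2 (le_min (by linarith [hb.1, hc.1]) hb.2))]
      simp
  · simp [hP, hQ]

theorem approach_le_add_left (σ τ σ' β : Fin n → ℝ) :
    approach G σ' β ≤ approach G σ β + approach G τ β
      + (∑ i, |σ' i - σ i - τ i|) * ∑ j, |β j| := by
  classical
  unfold approach approachOne
  rw [Finset.mul_sum, ← Finset.sum_add_distrib, ← Finset.sum_add_distrib]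
  refine Finset.sum_le_sum fun j _ => ?_
  rw [mul_comm, Finset.mul_sum, ← Finset.sum_add_distrib, ← Finset.sum_add_distrib]
  refine Finset.sum_le_sum fun i _ => ?_
  have h1 := ite_min_neg_mul_le_add (j < i) (i = j ∧ G i) (σ' i) (σ i) (τ i) (β j)
  simp only [and_assoc] at h1
  refine (le_of_eq ?_).trans (h1.trans (le_of_eq ?_)) <;> congr

theorem approach_le_add_right (σ τ σ' β : Fin n → ℝ) :
    approach G β σ' ≤ approach G β σ + approach G β τ
      + (∑ i, |σ' i - σ i - τ i|) * ∑ j, |β j| := by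
  classical
  unfold approach approachOne
  rw [Finset.sum_mul, ← Finset.sum_add_distrib, ← Finset.sum_add_distrib]
  refine Finset.sum_le_sum fun j _ => ?_
  rw [Finset.mul_sum, ← Finset.sum_add_distrib, ← Finset.sum_add_distrib]
  refine Finset.sum_le_sum fun i _ => ?_
  have h1 := ite_min_neg_mul_le_add (j < i) (i = j ∧ G i) (σ' j) (σ j) (τ j) (β i)
  simp only [and_assoc, min_comm _ (β i), mul_comm _ (β i)] at h1
  rw [mul_comm |β i| _] at h1
  refine (le_of_eq ?_).trans (h1.trans (le_of_eq ?_)) <;> congr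

theorem approach_le_mul (σ τ : Fin n → ℝ) :
    approach G σ τ ≤ (∑ i, |σ i|) * ∑ j, |τ j| := by
  classical
  unfold approach approachOne
  rw [Finset.mul_sum]
  refine Finset.sum_le_sum fun j _ => ?_
  rw [Finset.sum_mul]
  refine Finset.sum_le_sum fun i _ => ?_
  split_ifs
  · rw [abs_mul]
  · positivity

/-- The weighted total strength of a list of pairs (weights, strengths). -/
def linPot (F : List ((Fin n → ℝ) × (Fin n → ℝ))) : ℝ := (F.map fun p => ∑ i, p.1 i * |p.2 i|).sum

/-- The total strength of a list of pairs (weights, strengths). -/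
def totalStrength (F : List ((Fin n → ℝ) × (Fin n → ℝ))) : ℝ := (F.map fun p => ∑ i, |p.2 i|).sum

/-- The interaction potential of a list of pairs (weights, strengths). -/
noncomputable def interPot (G : Fin n → Prop) : List ((Fin n → ℝ) × (Fin n → ℝ)) → ℝ
  | [] => 0
  | p :: F => (F.map fun q => approach G p.2 q.2).sum + interPot G F

section lists
variable (F F' : List ((Fin n → ℝ) × (Fin n → ℝ))) (p : (Fin n → ℝ) × (Fin n → ℝ))

@[simp] theorem linPot_cons : linPot (p :: F) = ∑ i, p.1 i * |p.2 i| + linPot F := by simp [linPot]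
@[simp] theorem linPot_append : linPot (F ++ F') = linPot F + linPot F' := by simp [linPot]
@[simp] theorem totalStrength_cons :
    totalStrength (p :: F) = ∑ i, |p.2 i| + totalStrength F := by simp [totalStrength]
@[simp] theorem totalStrength_append :
    totalStrength (F ++ F') = totalStrength F + totalStrength F' := by simp [totalStrength]
@[simp] theorem interPot_cons : interPot G (p :: F)
    = (F.map fun q => approach G p.2 q.2).sum + interPot G F := rfl

theorem totalStrength_nonneg : 0 ≤ totalStrength F :=
  List.sum_nonneg fun x hx => by
    obtain ⟨p, -, rfl⟩ := List.mem_map.1 hx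
    positivity

theorem sum_approach_nonneg (σ : Fin n → ℝ) : 0 ≤ (F.map fun q => approach G σ q.2).sum :=
  List.sum_nonneg fun x hx => by
    obtain ⟨p, -, rfl⟩ := List.mem_map.1 hx
    exact approach_nonneg _ _ _

theorem interPot_nonneg : 0 ≤ interPot G F := by
  induction F with
  | nil => exact le_rfl
  | cons p F ih => exact add_nonneg (sum_approach_nonneg _ _) ih

theorem interPot_le_append : interPot G F ≤ interPot G (F ++ F') := by
  induction F with
  | nil => exact interPot_nonneg _
  | cons p F ih =>
    rw [List.cons_append, interPot_cons, interPot_cons, List.map_append, List.sum_append]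
    linarith [sum_approach_nonneg (G := G) F' p.2]

theorem sum_approach_le (σ : Fin n → ℝ) :
    (F.map fun q => approach G σ q.2).sum ≤ (∑ i, |σ i|) * totalStrength F := by
  induction F with
  | nil => simp [totalStrength]
  | cons p F ih =>
    rw [List.map_cons, List.sum_cons, totalStrength_cons, mul_add]
    exact add_le_add (approach_le_mul _ _) ih

theorem interPot_le_sq : interPot G F ≤ totalStrength F ^ 2 := by
  induction F with
  | nil => exact sq_nonneg _
  | cons p F ih =>
    rw [interPot_cons, totalStrength_cons]
    have h1 := sum_approach_le (G := G) F p.2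
    have h2 := totalStrength_nonneg F
    have h3 : 0 ≤ ∑ i, |p.2 i| := by positivity
    nlinarith

theorem sum_approach_merge (σ τ σ' : Fin n → ℝ) :
    (F.map fun q => approach G σ' q.2).sum ≤ (F.map fun q => approach G σ q.2).sum
      + (F.map fun q => approach G τ q.2).sum
      + (∑ i, |σ' i - σ i - τ i|) * totalStrength F := by
  induction F with
  | nil => simp [totalStrength]
  | cons p F ih =>
    simp only [List.map_cons, List.sum_cons, totalStrength_cons, mul_add]
    linarith [approach_le_add_left (G := G) σ τ σ' p.2]

/-- Merging removes the products of `σ` with `τ`. All other products are subadditive, up to the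
deviation of `σ'` from `σ + τ` times the strength of the other fans. -/
theorem interPot_merge (c σ τ σ' : Fin n → ℝ) :
    interPot G (F ++ (c, σ') :: F') + approach G σ τ
      ≤ interPot G (F ++ (c, σ) :: (c, τ) :: F')
        + (∑ i, |σ' i - σ i - τ i|) * (totalStrength F + totalStrength F') := by
  induction F with
  | nil =>
    have := sum_approach_merge (G := G) F' σ τ σ'
    simp only [List.nil_append, interPot_cons, List.map_cons, List.sum_cons]
    simp only [totalStrength, List.map_nil, List.sum_nil, zero_add] at this ⊢
    linarith
  | cons p F ih =>
    have := approach_le_add_right (G := G) σ τ σ' p.2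
    simp only [List.cons_append, interPot_cons, List.map_append, List.sum_append, List.map_cons,
      List.sum_cons, totalStrength_cons]
    linarith

/-- Merging two adjacent Riemann problems decreases the weighted functional. -/
theorem pot_merge_le {C κ : ℝ} (hC : 0 < C) (hκ : 2 * C ≤ κ) {c σ τ σ' : Fin n → ℝ}
    (hc : ∀ i, 0 ≤ c i ∧ c i ≤ 1) (hg : ∑ i, |σ' i - σ i - τ i| ≤ C * approach G σ τ)
    (hV : C * totalStrength (F ++ (c, σ) :: (c, τ) :: F') ≤ 1 / 2) :
    linPot (F ++ (c, σ') :: F') + κ * interPot G (F ++ (c, σ') :: F')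
      ≤ linPot (F ++ (c, σ) :: (c, τ) :: F')
        + κ * interPot G (F ++ (c, σ) :: (c, τ) :: F') := by
  set g := ∑ i, |σ' i - σ i - τ i| with hgdef
  have hg0 : 0 ≤ g := by positivity
  have hX := approach_nonneg G σ τ
  have h1 := interPot_merge (G := G) F F' c σ τ σ'
  have h2 : ∑ i, c i * |σ' i| ≤ ∑ i, c i * |σ i| + ∑ i, c i * |τ i| + g := by
    rw [hgdef, ← Finset.sum_add_distrib, ← Finset.sum_add_distrib]
    refine Finset.sum_le_sum fun i _ => ?_
    obtain ⟨h3, h4⟩ := hc i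
    have h5 : |σ' i| ≤ |σ i| + |τ i| + |σ' i - σ i - τ i| := by
      have := abs_add_three (σ i) (τ i) (σ' i - σ i - τ i)
      rwa [show σ i + τ i + (σ' i - σ i - τ i) = σ' i by ring] at this
    nlinarith [abs_nonneg (σ' i - σ i - τ i)]
  rw [totalStrength_append, totalStrength_cons, totalStrength_cons] at hV
  have h3 : totalStrength F + totalStrength F' ≤ 1 / (2 * C) := by
    rw [le_div_iff₀ (by positivity)]
    have : 0 ≤ ∑ i, |σ i| := by positivity
    have : 0 ≤ ∑ i, |τ i| := by positivity
    dsimp only at hV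
    nlinarith
  -- Smallness of the total strength means that at most half of the gained `approach G σ τ` is lost
  -- again. The remaining half, multiplied by `κ ≥ 2C`, pays for the growth `g ≤ C * approach G σ τ`
  -- of the linear part.
  have h4 : g * (totalStrength F + totalStrength F') ≤ approach G σ τ / 2 := by
    calc _ ≤ (C * approach G σ τ) * (1 / (2 * C)) := by
          gcongr
          exact add_nonneg (totalStrength_nonneg _) (totalStrength_nonneg _)
      _ = _ := by field_simp
  have h5 : κ * interPot G (F ++ (c, σ') :: F')
      ≤ κ * (interPot G (F ++ (c, σ) :: (c, τ) :: F') - approach G σ τ / 2) := by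
    have : 0 ≤ κ := by linarith
    gcongr
    linarith
  simp only [linPot_append, linPot_cons]
  nlinarith

end lists

/-! ### Sampled maps: deleting a sample point decreases the potential. -/

section sampling
variable {X : Type*} (E : X → X → Fin n → ℝ) (c : ℝ → Fin n → ℝ) (v : ℝ → X)

/-- The Riemann problems between the consecutive values of `v` at the points of a list, starting
from the state `u`, with the weights `c`. -/
def fans : X → List ℝ → List ((Fin n → ℝ) × (Fin n → ℝ))
  | _, [] => []
  | u, t :: T => (c t, E u (v t)) :: fans (v t) T

theorem fans_append (u : X) (T T' : List ℝ) :
    fans E c v u (T ++ T') = fans E c v u T ++ fans E c v (T.foldl (fun _ t => v t) u) T' := by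
  induction T generalizing u with
  | nil => rfl
  | cons t T ih => simp [fans, ih]

variable {E c v}

/-- Deleting the last point discards nonnegative terms. Deleting another one merges its Riemann
problem with the next, and the two must carry the same weights; hence the condition `ht`. -/
theorem pot_remove_le {C κ : ℝ} (hC : 0 < C) (hκ : 2 * C ≤ κ) {B : Set X} {u : X} (hu : u ∈ B)
    (hv : ∀ t, v t ∈ B) (hE : ∀ u ∈ B, ∀ w ∈ B, ∀ w' ∈ B,
      ∑ i, |E u w' i - E u w i - E w w' i| ≤ C * approach G (E u w) (E w w'))
    (hc : ∀ t i, 0 ≤ c t i ∧ c t i ≤ 1) {T T' : List ℝ} {t : ℝ} (ht : ∀ t' ∈ T'.head?, c t' = c t)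
    (hV : C * totalStrength (fans E c v u (T ++ t :: T')) ≤ 1 / 2) :
    linPot (fans E c v u (T ++ T')) + κ * interPot G (fans E c v u (T ++ T'))
      ≤ linPot (fans E c v u (T ++ t :: T')) + κ * interPot G (fans E c v u (T ++ t :: T')) := by
  have hκ0 : 0 ≤ κ := by linarith
  cases T' with
  | nil =>
    rw [List.append_nil, fans_append]
    have h1 := interPot_le_append (G := G) (fans E c v u T)
      (fans E c v (T.foldl (fun _ t => v t) u) [t])
    refine add_le_add ?_ (by gcongr)
    rw [linPot_append, le_add_iff_nonneg_right]
    simp only [fans, linPot_cons]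
    simp only [linPot, List.map_nil, List.sum_nil, add_zero]
    exact Finset.sum_nonneg fun i _ => mul_nonneg (hc t i).1 (abs_nonneg _)
  | cons t' T' =>
    have hct : c t' = c t := ht t' rfl
    have hz : T.foldl (fun _ t => v t) u ∈ B := by
      clear hV
      induction T generalizing u with
      | nil => exact hu
      | cons s T ih => exact ih (hv s)
    rw [fans_append, fans, fans, hct] at hV
    rw [fans_append, fans, hct, fans_append, fans, fans, hct]
    exact pot_merge_le _ _ hC hκ (hc t) (hE _ hz _ (hv t) _ (hv t')) hV

end sampling

end Data
namespace Data
variable {n : ℕ} {G : Fin n → Prop}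

/-- The functional `linPot + κ * interPot`. -/
noncomputable def pot (G : Fin n → Prop) (κ : ℝ) (F : List ((Fin n → ℝ) × (Fin n → ℝ))) : ℝ :=
  linPot F + κ * interPot G F

/-- The weights that are `cm` on the left of `x` and `cp` on its right. -/
noncomputable def splitWeight (x : ℝ) (cm cp : Fin n → ℝ) (t : ℝ) : Fin n → ℝ :=
  if t ≤ x then cm else cp

section sampling
variable {X : Type*} (E : X → X → Fin n → ℝ) (c : ℝ → Fin n → ℝ) (v : ℝ → X)

theorem linPot_fans_one (u : X) (T : List ℝ) :
    linPot (fans E (fun _ _ => 1) v u T) = totalStrength (fans E c v u T) := by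
  induction T generalizing u with
  | nil => rfl
  | cons t T ih => simp [fans, ih (v t)]

variable {E c v}

/-- Because `x` is a sample point other than `t`, it cannot separate `t` from the next one: no
merging takes place across the discontinuity of the weights. -/
theorem pot_erase_le {C κ : ℝ} (hC : 0 < C) (hκ : 2 * C ≤ κ) {B : Set X} {u : X} (hu : u ∈ B)
    (hv : ∀ t, v t ∈ B) (hE : ∀ u ∈ B, ∀ w ∈ B, ∀ w' ∈ B,
      ∑ i, |E u w' i - E u w i - E w w' i| ≤ C * approach G (E u w) (E w w'))
    {cm cp : Fin n → ℝ} (hcm : ∀ i, 0 ≤ cm i ∧ cm i ≤ 1) (hcp : ∀ i, 0 ≤ cp i ∧ cp i ≤ 1)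
    {T : Finset ℝ} {x t : ℝ} (hx : x ∈ T) (ht : t ∉ T)
    (hV : C * totalStrength (fans E (splitWeight x cm cp) v u (insert t T).sort) ≤ 1 / 2) :
    pot G κ (fans E (splitWeight x cm cp) v u T.sort)
      ≤ pot G κ (fans E (splitWeight x cm cp) v u (insert t T).sort) := by
  have hmem : t ∈ (insert t T).sort := by simp
  obtain ⟨L, L', hL⟩ := List.append_of_mem hmem
  have hnd : (L ++ t :: L').Nodup := hL ▸ Finset.sort_nodup _ _
  have hpw : (L ++ t :: L').Pairwise (· ≤ ·) := hL ▸ Finset.pairwise_sort _ _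
  have hsub : (L ++ L').Sublist (L ++ t :: L') := by simp
  have hset : ∀ s, s ∈ L ++ L' ↔ s ∈ T := by
    intro s
    have h1 : s ∈ L ++ t :: L' ↔ s = t ∨ s ∈ T := by rw [← hL]; simp
    have h2 := List.nodup_middle.1 hnd
    rw [List.nodup_cons] at h2
    constructor
    · intro h
      have h3 : s ∈ L ++ t :: L' := hsub.subset h
      rcases h1.1 h3 with rfl | h4
      · exact absurd h h2.1
      · exact h4
    · intro h
      have h3 := h1.2 (Or.inr h)
      have h4 : s ≠ t := fun h5 => ht (h5 ▸ h)
      simpa [h4] using h3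
  have hT : T.sort = L ++ L' := by
    have h1 : (L ++ L').toFinset = T := by ext s; rw [List.mem_toFinset, hset]
    rw [← h1, List.toFinset_sort _ (hnd.sublist hsub)]
    exact hpw.sublist hsub
  have hxt : x ≠ t := fun h => ht (h ▸ hx)
  rw [hL] at hV ⊢
  rw [hT]
  refine pot_remove_le hC hκ hu hv hE (fun s i => ?_) (fun t' ht' => ?_) hV
  · unfold splitWeight; split_ifs
    · exact hcm i
    · exact hcp i
  · rw [List.pairwise_append, List.pairwise_cons] at hpw
    obtain ⟨-, ⟨h1, h2⟩, h3⟩ := hpw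
    have ht'L : t' ∈ L' := List.mem_of_mem_head? ht'
    have h4 : t' ≤ x ↔ t ≤ x := by
      refine ⟨fun h => (h1 t' ht'L).trans h, fun h => ?_⟩
      have hxL : x ∈ L ++ L' := (hset x).2 hx
      rcases List.mem_append.1 hxL with h5 | h5
      · exact absurd (le_antisymm (h3 x h5 t (by simp)) h) hxt
      · cases L' with
        | nil => simp at h5
        | cons a L' =>
          simp only [List.head?_cons, Option.mem_def, Option.some.injEq] at ht'
          subst ht'
          rcases List.mem_cons.1 h5 with h6 | h6
          · exact h6.ge
          · exact (List.pairwise_cons.1 h2).1 x h6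
    simp only [splitWeight, h4]

/-- Each deletion needs a small total strength, which the weighted potential does not control since
weights may vanish. The potential with unit weights and `κ = 2C` is therefore followed along: it
dominates the total strength and is itself monotone under deletion. -/
theorem pot_sample_le {C κ : ℝ} (hC : 0 < C) (hκ : 2 * C ≤ κ) {B : Set X} {u : X} (hu : u ∈ B)
    (hv : ∀ t, v t ∈ B) (hE : ∀ u ∈ B, ∀ w ∈ B, ∀ w' ∈ B,
      ∑ i, |E u w' i - E u w i - E w w' i| ≤ C * approach G (E u w) (E w w'))
    {cm cp : Fin n → ℝ} (hcm : ∀ i, 0 ≤ cm i ∧ cm i ≤ 1) (hcp : ∀ i, 0 ≤ cp i ∧ cp i ≤ 1)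
    {Y T : Finset ℝ} (hYT : Y ⊆ T) {x : ℝ} (hx : x ∈ Y)
    (hV : C * pot G (2 * C) (fans E (fun _ _ => 1) v u T.sort) ≤ 1 / 2) :
    pot G κ (fans E (splitWeight x cm cp) v u Y.sort)
      ≤ pot G κ (fans E (splitWeight x cm cp) v u T.sort) := by
  have hone : splitWeight x (fun _ : Fin n => (1 : ℝ)) (fun _ => 1) = fun _ _ => 1 := by
    funext t; simp [splitWeight]
  have strength_le : ∀ (c : ℝ → Fin n → ℝ) (l : List ℝ), totalStrength (fans E c v u l)
      ≤ pot G (2 * C) (fans E (fun _ _ => 1) v u l) := by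
    intro c l
    rw [pot, linPot_fans_one E c]
    have := interPot_nonneg (G := G) (fans E (fun _ _ => 1) v u l)
    have : 0 ≤ 2 * C * interPot G (fans E (fun _ _ => 1) v u l) := by positivity
    linarith
  suffices H : ∀ U : Finset ℝ, C * pot G (2 * C) (fans E (fun _ _ => 1) v u (Y ∪ U).sort) ≤ 1 / 2 →
      pot G κ (fans E (splitWeight x cm cp) v u Y.sort)
        ≤ pot G κ (fans E (splitWeight x cm cp) v u (Y ∪ U).sort) by
    have := H T
    rw [Finset.union_eq_right.2 hYT] at this
    exact this hV
  intro U
  induction U using Finset.induction_on with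
  | empty => intro _; rw [Finset.union_empty]
  | insert t U _ ih =>
    intro h
    rw [Finset.union_insert] at h ⊢
    by_cases ht : t ∈ Y ∪ U
    · rw [Finset.insert_eq_of_mem ht] at h ⊢
      exact ih h
    · have hxU : x ∈ Y ∪ U := Finset.mem_union_left _ hx
      have h1 := pot_erase_le (κ := 2 * C) hC le_rfl hu hv hE (cm := fun _ => 1) (cp := fun _ => 1)
        (fun i => by simp) (fun i => by simp) hxU ht
        ((mul_le_mul_of_nonneg_left (strength_le _ _) hC.le).trans h)
      rw [hone] at h1
      have h2 := pot_erase_le hC hκ hu hv hE hcm hcp hxU ht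
        ((mul_le_mul_of_nonneg_left (strength_le _ _) hC.le).trans h)
      exact (ih ((mul_le_mul_of_nonneg_left h1 hC.le).trans h)).trans h2

end sampling

end Data

/-! ### Piecewise constant maps of the line. -/

section PiecewiseConstant
variable {n : ℕ} {v : ℝ → State n}

theorem mem_Ico_eventually_left (a b x : ℝ) :
    ∀ᶠ y in 𝓝[<] x, (y ∈ Ico a b ↔ a < x ∧ x ≤ b) := by
  rcases lt_or_ge a x with h | h
  · rcases le_or_gt x b with h' | h'
    · filter_upwards [Ioo_mem_nhdsLT h] with y hy
      simp only [mem_Ico, h, h', and_self, iff_true]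
      exact ⟨hy.1.le, hy.2.trans_le h'⟩
    · filter_upwards [Ioo_mem_nhdsLT h'] with y hy
      simp only [mem_Ico, not_le.2 h', and_false, iff_false, not_and, not_lt]
      exact fun _ => hy.1.le
  · filter_upwards [self_mem_nhdsWithin] with y hy
    simp only [mem_Ico, not_lt.2 h, false_and, iff_false, not_and, not_lt]
    exact fun h' => absurd (h.trans h') (not_le.2 hy)

theorem mem_Ico_eventually_right (a b x : ℝ) :
    ∀ᶠ y in 𝓝[≥] x, (y ∈ Ico a b ↔ x ∈ Ico a b) := by
  rcases lt_or_ge x a with h | h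
  · filter_upwards [Ico_mem_nhdsGE h] with y hy
    simp only [mem_Ico, not_le.2 h, not_le.2 hy.2, false_and]
  · rcases lt_or_ge x b with h' | h'
    · filter_upwards [Ico_mem_nhdsGE h'] with y hy
      simp only [mem_Ico, h, h', h.trans hy.1, hy.2, and_self]
    · filter_upwards [self_mem_nhdsWithin] with y hy
      simp only [mem_Ico, not_lt.2 h', not_lt.2 (h'.trans hy), and_false]

theorem IsPiecewiseConstant.eventually_left (hv : IsPiecewiseConstant v) (x : ℝ) :
    ∃ c, ∀ᶠ y in 𝓝[<] x, v y = c := by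
  classical
  obtain ⟨N, p, c, -, rfl⟩ := hv
  refine ⟨∑ α, if p (Fin.castSucc α) < x ∧ x ≤ p α.succ then c α else 0, ?_⟩
  filter_upwards [eventually_all.2 fun α : Fin N =>
    mem_Ico_eventually_left (p α.castSucc) (p α.succ) x] with y hy
  refine Finset.sum_congr rfl fun α _ => ?_
  simp only [indicator, hy α]

theorem IsPiecewiseConstant.eventually_right (hv : IsPiecewiseConstant v) (x : ℝ) :
    ∀ᶠ y in 𝓝[≥] x, v y = v x := by
  classical
  obtain ⟨N, p, c, -, rfl⟩ := hv
  filter_upwards [eventually_all.2 fun α : Fin N =>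
    mem_Ico_eventually_right (p α.castSucc) (p α.succ) x] with y hy
  refine Finset.sum_congr rfl fun α _ => ?_
  simp only [indicator, hy α]

theorem leftLim_eq_of_eventually {x : ℝ} {c : State n} (h : ∀ᶠ y in 𝓝[<] x, v y = c) :
    Function.leftLim v x = c :=
  leftLim_eq_of_tendsto (tendsto_const_nhds.congr' (h.mono fun _ hy => hy.symm))

theorem IsPiecewiseConstant.eventually_leftLim (hv : IsPiecewiseConstant v) (x : ℝ) :
    ∀ᶠ y in 𝓝[<] x, v y = Function.leftLim v x := by
  obtain ⟨c, hc⟩ := hv.eventually_left x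
  rwa [leftLim_eq_of_eventually hc]

theorem IsPiecewiseConstant.finite_jumps (hv : IsPiecewiseConstant v) : (jumps v).Finite := by
  classical
  obtain ⟨N, p, c, -, rfl⟩ := hv
  refine (Set.finite_range p).subset fun x hx => ?_
  by_contra hxp
  refine hx (leftLim_eq_of_eventually ?_)
  filter_upwards [eventually_all.2 fun α : Fin N =>
    mem_Ico_eventually_left (p α.castSucc) (p α.succ) x] with y hy
  refine Finset.sum_congr rfl fun α _ => ?_
  have h1 : p α.castSucc ≠ x := fun h => hxp ⟨_, h⟩
  have h2 : p α.succ ≠ x := fun h => hxp ⟨_, h⟩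
  have h3 : (p α.castSucc < x ∧ x ≤ p α.succ) ↔ x ∈ Ico (p α.castSucc) (p α.succ) := by
    rw [mem_Ico, lt_iff_le_and_ne, lt_iff_le_and_ne]
    exact ⟨fun h => ⟨h.1.1, h.2, h2.symm⟩, fun h => ⟨⟨h.1, h1⟩, h.2.1⟩⟩
  simp only [indicator, hy α, h3]

theorem IsPiecewiseConstant.exists_support (hv : IsPiecewiseConstant v) :
    ∃ a b, ∀ x, x ∉ Ico a b → v x = 0 := by
  obtain ⟨N, p, c, hp, rfl⟩ := hv
  refine ⟨p 0, p (Fin.last N), fun x hx => Finset.sum_eq_zero fun α _ => ?_⟩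
  refine indicator_of_notMem (fun h => hx ⟨?_, ?_⟩) _
  · exact (hp.monotone (Fin.zero_le _)).trans h.1
  · exact h.2.trans_le (hp.monotone (Fin.le_last _))

theorem IsPiecewiseConstant.measurable (hv : IsPiecewiseConstant v) : Measurable v := by
  obtain ⟨N, p, c, -, rfl⟩ := hv
  exact Finset.measurable_sum _ fun α _ => measurable_const.indicator measurableSet_Ico

/-- Without jumps `v` is continuous on the interval, and local constancy on the right gives it a
zero right derivative everywhere. -/
theorem IsPiecewiseConstant.eq_of_forall_notMem_jumps (hv : IsPiecewiseConstant v) {a b : ℝ}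
    (hab : a ≤ b) (h : ∀ x ∈ Ioc a b, x ∉ jumps v) : v b = v a := by
  refine constant_of_has_deriv_right_zero (f := v) (fun x hx => ?_) (fun x _ => ?_) b
    (right_mem_Icc.2 hab)
  · rcases hx.1.eq_or_lt with rfl | hlt
    · refine ContinuousWithinAt.mono ?_ Icc_subset_Ici_self
      exact tendsto_const_nhds.congr' ((hv.eventually_right a).mono fun _ hy => hy.symm)
    · refine ContinuousAt.continuousWithinAt ?_
      rw [continuousAt_iff_continuous_left'_right']
      refine ⟨?_, tendsto_const_nhds.congr' (((hv.eventually_right x).filter_mono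
        (nhdsWithin_mono _ Ioi_subset_Ici_self)).mono fun _ hy => hy.symm)⟩
      have h1 : Function.leftLim v x = v x := not_not.1 (h x ⟨hlt, hx.2⟩)
      refine tendsto_const_nhds.congr' ((hv.eventually_leftLim x).mono fun _ hy => ?_)
      rw [hy, h1]
  · exact (hasDerivWithinAt_const x (Ici x) (v x)).congr_of_eventuallyEq (hv.eventually_right x) rfl

theorem IsPiecewiseConstant.leftLim_eq (hv : IsPiecewiseConstant v) {a b : ℝ}
    (hab : a < b) (h : ∀ x ∈ Ioo a b, x ∉ jumps v) : Function.leftLim v b = v a := by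
  refine leftLim_eq_of_eventually ?_
  filter_upwards [Ioo_mem_nhdsLT hab] with y hy
  exact hv.eq_of_forall_notMem_jumps hy.1.le fun x hx => h x ⟨hx.1, hx.2.trans_lt hy.2⟩

theorem IsPiecewiseConstant.exists_leftLim_eq (hv : IsPiecewiseConstant v) (b : ℝ) :
    ∃ a < b, Function.leftLim v b = v a ∧ ∀ x ∈ Ioo a b, x ∉ jumps v := by
  have h1 : ∀ᶠ a in 𝓝[<] b, ∀ x ∈ Ioo a b, x ∉ jumps v := by
    have h2 : (jumps v \ {b})ᶜ ∈ 𝓝 b :=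
      (hv.finite_jumps.subset sdiff_subset).isClosed.compl_mem_nhds (by simp)
    obtain ⟨ε, hε, h3⟩ := Metric.mem_nhds_iff.1 h2
    filter_upwards [Ioo_mem_nhdsLT (show b - ε < b by linarith)] with a ha x hx hxj
    refine h3 ?_ ⟨hxj, hx.2.ne⟩
    rw [Metric.mem_ball, Real.dist_eq, abs_lt]
    constructor <;> linarith [ha.1, hx.1, hx.2]
  obtain ⟨a, ha, ha'⟩ := (h1.and self_mem_nhdsWithin).exists
  exact ⟨a, ha', hv.leftLim_eq ha' ha, ha⟩

theorem IsPiecewiseConstant.exists_lt_eq_zero (hv : IsPiecewiseConstant v) (b : ℝ) :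
    ∃ a < b, v a = 0 ∧ ∀ x ∈ jumps v, a < x := by
  obtain ⟨p, q, hpq⟩ := hv.exists_support
  obtain ⟨m, hm⟩ := hv.finite_jumps.bddBelow
  refine ⟨min p (min m b) - 1, ?_, hpq _ ?_, fun x hx => ?_⟩
  · linarith [min_le_right p (min m b), min_le_right m b]
  · intro h
    linarith [h.1, min_le_left p (min m b)]
  · linarith [hm hx, min_le_right p (min m b), min_le_left m b]

end PiecewiseConstant
-- The functionals as potentials of lists, and the bound on the states.
namespace Data
variable {n : ℕ} {S : Data n} {ρ r C : ℝ} {v : ℝ → State n}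

theorem sum_map_sort (T : Finset ℝ) (f : ℝ → ℝ) : (T.sort.map f).sum = ∑ t ∈ T, f t := by
  rw [← List.sum_toFinset _ (Finset.sort_nodup _ _), Finset.sort_toFinset]

theorem interPot_map (G : Fin n → Prop) (c s : ℝ → Fin n → ℝ) {l : List ℝ}
    (hl : l.Pairwise (· < ·)) :
    interPot G (l.map fun t => (c t, s t))
      = ∑ x ∈ l.toFinset, ∑ y ∈ l.toFinset, if x < y then approach G (s x) (s y) else 0 := by
  induction l with
  | nil => simp [interPot]
  | cons t l ih =>
    rw [List.pairwise_cons] at hl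
    have ht : t ∉ l.toFinset := fun h => lt_irrefl t (hl.1 t (by simpa using h))
    rw [List.map_cons, interPot_cons, ih hl.2, List.toFinset_cons, Finset.sum_insert ht,
      Finset.sum_insert ht, if_neg (lt_irrefl t), zero_add]
    congr 1
    · rw [List.map_map, ← List.sum_toFinset _ (hl.2.imp fun h => h.ne)]
      refine Finset.sum_congr rfl fun y hy => ?_
      rw [if_pos (hl.1 y (by simpa using hy))]
      rfl
    · refine Finset.sum_congr rfl fun x hx => ?_
      rw [Finset.sum_insert ht, if_neg (hl.1 x (by simpa using hx)).not_gt, zero_add]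

/-- No jump lies strictly between consecutive points, so each sampled value is the left limit at the
next point. -/
theorem fans_eq_map_of_sorted (hv : IsPiecewiseConstant v) (E : State n → State n → Fin n → ℝ)
    (c : ℝ → Fin n → ℝ) {a : ℝ} {l : List ℝ} (hl : (a :: l).Pairwise (· < ·))
    (hj : ∀ x ∈ jumps v, a < x → x ∈ l) :
    fans E c v (v a) l = l.map fun t => (c t, E (Function.leftLim v t) (v t)) := by
  induction l generalizing a with
  | nil => rfl
  | cons t l ih =>
    rw [List.pairwise_cons] at hl
    have hat : a < t := hl.1 t (by simp)
    have h1 := List.pairwise_cons.1 hl.2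
    rw [fans, List.map_cons, ih hl.2]
    · congr 3
      refine (hv.leftLim_eq hat fun x hx hxj => ?_).symm
      rcases List.mem_cons.1 (hj x hxj hx.1) with rfl | h
      · exact lt_irrefl _ hx.2
      · exact lt_asymm hx.2 (h1.1 x h)
    · intro x hx htx
      rcases List.mem_cons.1 (hj x hx (hat.trans htx)) with rfl | h
      · exact absurd htx (lt_irrefl _)
      · exact h

/-- The list may start from the state `0` because `v` vanishes far to the left. -/
theorem fans_eq_map (hv : IsPiecewiseConstant v) (E : State n → State n → Fin n → ℝ)
    (c : ℝ → Fin n → ℝ) {T : Finset ℝ} (hT : jumps v ⊆ T) :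
    fans E c v 0 T.sort = T.sort.map fun t => (c t, E (Function.leftLim v t) (v t)) := by
  obtain ⟨m, hm⟩ := T.finite_toSet.bddBelow
  obtain ⟨a, ham, ha, -⟩ := hv.exists_lt_eq_zero m
  rw [← ha]
  refine fans_eq_map_of_sorted hv E c (a := a) ?_ fun x hx _ => by simpa using hT hx
  rw [List.pairwise_cons]
  exact ⟨fun t ht => ham.trans_le (hm (by simpa using ht)), (Finset.sortedLT_sort T).pairwise⟩

theorem norm_leftLim_le (hv : IsPiecewiseConstant v) (hr : ∀ x, ‖v x‖ ≤ r) (x : ℝ) :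
    ‖Function.leftLim v x‖ ≤ r := by
  obtain ⟨a, -, h, -⟩ := hv.exists_leftLim_eq x
  rw [h]; exact hr a

theorem IsWellPosed.σ_eq_zero (hW : IsWellPosed S ρ r C) (hr : ∀ x, ‖v x‖ ≤ r) {x : ℝ}
    (hx : x ∉ jumps v) (i : Fin n) : S.σ ρ v x i = 0 := by
  rw [σ, not_not.1 hx, hW.waves_self _ (hr x)]; rfl

theorem finsum_mem_jumps {T : Finset ℝ} (hT : jumps v ⊆ T)
    (P : ℝ → Prop) [DecidablePred P] {f : ℝ → ℝ} (hf : ∀ x ∉ jumps v, f x = 0) :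
    ∑ᶠ x ∈ jumps v ∩ {x | P x}, f x = ∑ x ∈ T, if P x then f x else 0 := by
  rw [finsum_mem_def, finsum_eq_sum_of_support_subset (s := T)]
  · refine Finset.sum_congr rfl fun x _ => ?_
    by_cases hx : x ∈ jumps v <;> by_cases hP : P x <;> simp [hx, hP, hf x]
  · intro x hx
    refine hT ?_
    by_contra h
    exact hx (by simp [h])

theorem linPot_fans_eq (hW : IsWellPosed S ρ r C) (hv : IsPiecewiseConstant v)
    (hr : ∀ x, ‖v x‖ ≤ r) {T : Finset ℝ} (hT : jumps v ⊆ T) (x : ℝ) (cm cp : Fin n → ℝ) :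
    linPot (fans (S.waves ρ) (splitWeight x cm cp) v 0 T.sort)
      = ∑ i, (cm i * S.Aminus ρ v i x + cp i * S.Aplus ρ v i x) := by
  have hm : ∀ i, S.Aminus ρ v i x = ∑ t ∈ T, if t ≤ x then |S.σ ρ v t i| else 0 := fun i =>
    finsum_mem_jumps hT (fun t => t ≤ x) fun t ht => by rw [hW.σ_eq_zero hr ht, abs_zero]
  have hp : ∀ i, S.Aplus ρ v i x = ∑ t ∈ T, if x < t then |S.σ ρ v t i| else 0 := fun i =>
    finsum_mem_jumps hT (fun t => x < t) fun t ht => by rw [hW.σ_eq_zero hr ht, abs_zero]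
  rw [fans_eq_map hv _ _ hT, linPot, List.map_map, sum_map_sort]
  simp only [hm, hp, Finset.mul_sum, ← Finset.sum_add_distrib]
  rw [Finset.sum_comm]
  refine Finset.sum_congr rfl fun t _ => Finset.sum_congr rfl fun i _ => ?_
  by_cases h : x < t
  · simp [splitWeight, h, not_le.2 h, σ]
  · simp [splitWeight, h, not_lt.1 h, σ]

theorem totalStrength_fans_eq (hW : IsWellPosed S ρ r C) (hv : IsPiecewiseConstant v)
    (hr : ∀ x, ‖v x‖ ≤ r) {T : Finset ℝ} (hT : jumps v ⊆ T) (c : ℝ → Fin n → ℝ) :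
    totalStrength (fans (S.waves ρ) c v 0 T.sort) = S.V ρ v := by
  rw [V, ← inter_univ (jumps v), show (univ : Set ℝ) = {x | True} from rfl,
    finsum_mem_jumps hT (fun _ => True)
      fun t ht => Finset.sum_eq_zero fun i _ => by rw [hW.σ_eq_zero hr ht, abs_zero],
    fans_eq_map hv _ _ hT, totalStrength, List.map_map, sum_map_sort]
  simp [σ]

theorem interPot_fans_eq (hW : IsWellPosed S ρ r C) (hv : IsPiecewiseConstant v)
    (hr : ∀ x, ‖v x‖ ≤ r) {T : Finset ℝ} (hT : jumps v ⊆ T) (c : ℝ → Fin n → ℝ) :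
    interPot S.GenuinelyNonlinear (fans (S.waves ρ) c v 0 T.sort) = S.Q ρ v := by
  classical
  rw [fans_eq_map hv _ _ hT, interPot_map _ _ _ (Finset.sortedLT_sort T).pairwise,
    Finset.sort_toFinset, Q, finsum_mem_def,
    finsum_eq_sum_of_support_subset
      (s := (T ×ˢ (Finset.univ : Finset (Fin n))) ×ˢ (T ×ˢ (Finset.univ : Finset (Fin n))))]
  · rw [Finset.sum_product, Finset.sum_product]
    simp only [Finset.sum_product]
    refine Finset.sum_congr rfl fun x _ => ?_
    rw [Finset.sum_comm]
    refine Finset.sum_congr rfl fun y _ => ?_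
    have hterm : ∀ i j : Fin n, (S.approaching ρ v).indicator
        (fun p => |S.σ ρ v p.1.1 p.1.2 * S.σ ρ v p.2.1 p.2.2|) ((x, i), (y, j))
        = if x < y then (if j < i ∨ (i = j ∧ S.GenuinelyNonlinear i ∧
            min (S.σ ρ v x i) (S.σ ρ v y j) < 0) then |S.σ ρ v x i * S.σ ρ v y j| else 0) else 0 := by
      intro i j
      rw [indicator_apply]
      by_cases hx : x ∈ jumps v
      · by_cases hy : y ∈ jumps v
        · simp only [approaching, mem_ofPred_eq, hx, hy, true_and, ite_and]
        · simp [hW.σ_eq_zero hr hy]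
      · simp [hW.σ_eq_zero hr hx]
    simp only [hterm]
    by_cases hxy : x < y
    · simp only [if_pos hxy, approach, approachOne, σ]
      rw [Finset.sum_comm]
      refine Finset.sum_congr rfl fun i _ => Finset.sum_congr rfl fun j _ => ?_
      congr
    · simp [hxy]
  · intro p hp
    have h1 : p ∈ S.approaching ρ v := by
      by_contra h
      exact hp (by simp [h])
    simp only [Finset.coe_product, mem_prod, Finset.coe_univ, mem_univ, and_true]
    exact ⟨hT h1.1, hT h1.2.1⟩


theorem Q_nonneg (S : Data n) (ρ : ℝ) (v : ℝ → State n) : 0 ≤ S.Q ρ v :=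
  finsum_nonneg fun _ => finsum_nonneg fun _ => abs_nonneg _

theorem Aplus_nonneg (S : Data n) (ρ : ℝ) (v : ℝ → State n) (j : Fin n) (x : ℝ) :
    0 ≤ S.Aplus ρ v j x :=
  finsum_nonneg fun _ => finsum_nonneg fun _ => abs_nonneg _

theorem Aminus_nonneg (S : Data n) (ρ : ℝ) (v : ℝ → State n) (j : Fin n) (x : ℝ) :
    0 ≤ S.Aminus ρ v j x :=
  finsum_nonneg fun _ => finsum_nonneg fun _ => abs_nonneg _

theorem V_lt_of_mem_Dstar {C₀ δ : ℝ} (hC₀ : 0 < C₀) (hv : v ∈ S.Dstar ρ C₀ δ) : S.V ρ v < δ := by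
  have h1 : S.V ρ v + C₀ * S.Q ρ v < δ := hv.2.2.2
  have h2 : 0 ≤ C₀ * S.Q ρ v := mul_nonneg hC₀.le (Q_nonneg S ρ v)
  linarith

/-- The values of an element of `Dstar` are controlled by its total strength. -/
theorem norm_le_of_mem_Dstar (hW : IsWellPosed S ρ r C) (hC : 0 < C) {C₀ δ : ℝ} (hC₀ : 0 < C₀)
    (hδ : C * δ ≤ r) (hv : v ∈ S.Dstar ρ C₀ δ) (x : ℝ) : ‖v x‖ ≤ r := by
  classical
  have hpc := hv.1
  set J := hpc.finite_jumps.toFinset with hJ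
  have hJm : ∀ t, t ∈ J ↔ t ∈ jumps v := fun t => by simp [hJ]
  set s : ℝ → ℝ := fun t => ∑ i, |S.σ ρ v t i| with hs
  have hs0 : ∀ t, 0 ≤ s t := fun t => Finset.sum_nonneg fun _ _ => abs_nonneg _
  have hV : ∑ t ∈ J, s t < δ := by
    have := V_lt_of_mem_Dstar hC₀ hv
    rwa [V, finsum_mem_eq_finite_toFinset_sum _ hpc.finite_jumps] at this
  have hle : ∀ A ⊆ J, C * ∑ t ∈ A, s t ≤ r := fun A hA => by
    have : ∑ t ∈ A, s t ≤ ∑ t ∈ J, s t := Finset.sum_le_sum_of_subset_of_nonneg hA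
      fun _ _ _ => hs0 _
    nlinarith
  -- Induction on the number of jumps up to `x`. The previous case bounds the left limit at the last
  -- jump, and `norm_sub_le` then asks only for solvability there, not for a bound on the right
  -- state.
  suffices H : ∀ (m : ℕ) (x : ℝ), (J.filter (· ≤ x)).card = m →
      ‖v x‖ ≤ C * ∑ t ∈ J.filter (· ≤ x), s t from
    (H _ x rfl).trans (hle _ (Finset.filter_subset _ _))
  intro m
  induction m using Nat.strong_induction_on with
  | _ m ih =>
    intro x hm
    rcases (J.filter (· ≤ x)).eq_empty_or_nonempty with he | hne
    · obtain ⟨a, hax, ha, -⟩ := hpc.exists_lt_eq_zero x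
      rw [he, hpc.eq_of_forall_notMem_jumps hax.le, ha]
      · simp
      · intro y hy hyj
        have : y ∈ J.filter (· ≤ x) := by simp [hJm, hyj, hy.2]
        simp [he] at this
    · set t := (J.filter (· ≤ x)).max' hne with ht
      have htm := Finset.max'_mem _ hne
      rw [← ht, Finset.mem_filter] at htm
      have hvx : v x = v t := by
        refine hpc.eq_of_forall_notMem_jumps htm.2 fun y hy hyj => ?_
        have := Finset.le_max' (J.filter (· ≤ x)) y (by simp [hJm, hyj, hy.2])
        exact absurd hy.1 (not_lt.2 this)
      obtain ⟨a, hat, hla, -⟩ := hpc.exists_leftLim_eq t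
      have hsub : insert t (J.filter (· ≤ a)) ⊆ J.filter (· ≤ x) := by
        intro y hy
        rcases Finset.mem_insert.1 hy with rfl | hy
        · exact Finset.mem_filter.2 htm
        · rw [Finset.mem_filter] at hy ⊢
          exact ⟨hy.1, by linarith [hy.2, htm.2]⟩
      have hta : t ∉ J.filter (· ≤ a) := by simp [hat]
      have hcard := Finset.card_le_card hsub
      rw [Finset.card_insert_of_notMem hta] at hcard
      have h1 := ih _ (by omega) a rfl
      have h2 := Finset.sum_le_sum_of_subset_of_nonneg hsub (f := s) fun _ _ _ => hs0 _
      rw [Finset.sum_insert hta] at h2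
      have h3 : ‖v t - Function.leftLim v t‖ ≤ C * s t :=
        hW.norm_sub_le _ _ (by rw [hla]; exact h1.trans (hle _ (Finset.filter_subset _ _)))
          (hv.2.2.1 t ((hJm t).1 htm.1))
      have h4 := norm_sub_norm_le (v t) (Function.leftLim v t)
      rw [hla] at h3 h4
      rw [hvx]
      nlinarith

open Classical in
/-- The weights, on the left of `x`, of the potential `A i q x`. -/
noncomputable def leftWeight (S : Data n) (i : Fin n) (q : ℝ) (j : Fin n) : ℝ :=
  if i < j ∨ (j = i ∧ S.GenuinelyNonlinear i ∧ ¬ 0 ≤ q) then 1 else 0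

open Classical in
/-- The weights, on the right of `x`, of the potential `A i q x`. -/
noncomputable def rightWeight (S : Data n) (i : Fin n) (q : ℝ) (j : Fin n) : ℝ :=
  if j < i ∨ (j = i ∧ S.GenuinelyNonlinear i ∧ 0 ≤ q) then 1 else 0

theorem leftWeight_mem (S : Data n) (i : Fin n) (q : ℝ) (j : Fin n) :
    0 ≤ leftWeight S i q j ∧ leftWeight S i q j ≤ 1 := by
  unfold leftWeight; split_ifs <;> norm_num

theorem rightWeight_mem (S : Data n) (i : Fin n) (q : ℝ) (j : Fin n) :
    0 ≤ rightWeight S i q j ∧ rightWeight S i q j ≤ 1 := by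
  unfold rightWeight; split_ifs <;> norm_num

/-- This puts `A` in the form of a linear potential whose weights depend on `q` only through its
sign. -/
theorem A_eq_sum (S : Data n) (ρ : ℝ) (v : ℝ → State n) (i : Fin n) (q x : ℝ) :
    S.A ρ v i q x = ∑ j, (leftWeight S i q j * S.Aminus ρ v j x
      + rightWeight S i q j * S.Aplus ρ v j x) := by
  classical
  have h1 : (if S.GenuinelyNonlinear i then
      (if 0 ≤ q then S.Aplus ρ v i x else S.Aminus ρ v i x) else 0)
      = ∑ j, if j = i then (if S.GenuinelyNonlinear i then
        (if 0 ≤ q then S.Aplus ρ v j x else S.Aminus ρ v j x) else 0) else 0 := by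
    simp
  unfold A
  rw [h1, Finset.sum_filter, Finset.sum_filter, ← Finset.sum_add_distrib,
    ← Finset.sum_add_distrib]
  refine Finset.sum_congr rfl fun j _ => ?_
  unfold leftWeight rightWeight
  rcases lt_trichotomy j i with h | h | h
  · simp [h, h.not_gt, h.ne]
  · subst h
    by_cases hG : S.GenuinelyNonlinear j <;> by_cases hq : 0 ≤ q <;> simp [hG, hq]
  · simp [h, h.not_gt, h.ne']

end Data
-- Lower semicontinuity of the weights.
namespace Data
variable {n : ℕ} {G : Fin n → Prop}

/-- The condition `min a b < 0` is discontinuous, but the term it governs is `|a b| - a⁺ b⁺`. -/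
theorem continuous_approach (G : Fin n → Prop) :
    Continuous fun p : (Fin n → ℝ) × (Fin n → ℝ) => approach G p.1 p.2 := by
  classical
  unfold approach approachOne
  refine continuous_finsetSum _ fun j _ => continuous_finsetSum _ fun i _ => ?_
  by_cases h1 : j < i
  · simp only [h1, true_or, if_true]; fun_prop
  by_cases h2 : i = j ∧ G i
  · obtain ⟨rfl, hG⟩ := h2
    have : ∀ p : (Fin n → ℝ) × (Fin n → ℝ), (if i < i ∨ (i = i ∧ G i ∧ min (p.1 i) (p.2 i) < 0)
        then |p.1 i * p.2 i| else 0) = |p.1 i * p.2 i| - max (p.1 i) 0 * max (p.2 i) 0 := by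
      intro p
      simp only [lt_irrefl, false_or, true_and, hG]
      split_ifs with h
      · rcases min_lt_iff.1 h with h | h
        · rw [max_eq_right h.le]; ring
        · rw [max_eq_right h.le]; ring
      · rw [not_lt, le_min_iff] at h
        rw [max_eq_left h.1, max_eq_left h.2, abs_of_nonneg (mul_nonneg h.1 h.2), sub_self]
    refine Continuous.congr ?_ fun p => (this p).symm
    fun_prop
  · have : ∀ p : (Fin n → ℝ) × (Fin n → ℝ), (if j < i ∨ (i = j ∧ G i ∧ min (p.1 i) (p.2 j) < 0)
        then |p.1 i * p.2 j| else 0) = 0 := by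
      intro p
      rw [if_neg]
      rintro (h | ⟨h, h', -⟩)
      · exact h1 h
      · exact h2 ⟨h, h'⟩
    simp only [this]
    fun_prop

section sampling
variable {X : Type*} {E : X → X → Fin n → ℝ} {c c' : ℝ → Fin n → ℝ} {v v' : ℝ → X}

theorem fans_congr {l : List ℝ} (h : ∀ t ∈ l, c t = c' t ∧ v t = v' t) (u : X) :
    fans E c v u l = fans E c' v' u l := by
  induction l generalizing u with
  | nil => rfl
  | cons t l ih =>
    rw [fans, fans, (h t (by simp)).1, (h t (by simp)).2, ih fun s hs => h s (by simp [hs])]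

theorem fans_map (y : ℝ → ℝ) (l : List ℝ) (u : X) :
    fans E c v u (l.map y) = fans E (c ∘ y) (v ∘ y) u l := by
  induction l generalizing u with
  | nil => rfl
  | cons t l ih => simp [fans, ih]

variable [TopologicalSpace X] {B : Set X} {w : ℕ → ℝ → X}

theorem tendsto_pot_fans (G : Fin n → Prop) (κ : ℝ) (c : ℝ → Fin n → ℝ)
    (hE : ∀ (a b : ℕ → X) (a' b' : X), (∀ k, a k ∈ B) → (∀ k, b k ∈ B) → a' ∈ B → b' ∈ B →
      Tendsto a atTop (𝓝 a') → Tendsto b atTop (𝓝 b') →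
      Tendsto (fun k => E (a k) (b k)) atTop (𝓝 (E a' b')))
    (hw : ∀ k t, w k t ∈ B) (hv : ∀ t, v t ∈ B) {l : List ℝ}
    (hl : ∀ t ∈ l, Tendsto (fun k => w k t) atTop (𝓝 (v t))) {u : X} (hu : u ∈ B) :
    Tendsto (fun k => pot G κ (fans E c (w k) u l)) atTop (𝓝 (pot G κ (fans E c v u l))) := by
  -- The induction on the list requires a converging initial state `z k` and products with a
  -- converging wave vector `s k`.
  suffices H : ∀ (z : ℕ → X) (u : X), (∀ k, z k ∈ B) → u ∈ B → Tendsto z atTop (𝓝 u) →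
      Tendsto (fun k => linPot (fans E c (w k) (z k) l)) atTop (𝓝 (linPot (fans E c v u l))) ∧
      Tendsto (fun k => interPot G (fans E c (w k) (z k) l)) atTop
        (𝓝 (interPot G (fans E c v u l))) ∧
      ∀ (s : ℕ → Fin n → ℝ) (σ : Fin n → ℝ), Tendsto s atTop (𝓝 σ) →
        Tendsto (fun k => ((fans E c (w k) (z k) l).map fun q => approach G (s k) q.2).sum) atTop
          (𝓝 ((fans E c v u l).map fun q => approach G σ q.2).sum) by
    obtain ⟨h1, h2, -⟩ := H (fun _ => u) u (fun _ => hu) hu tendsto_const_nhds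
    exact h1.add (h2.const_mul κ)
  induction l with
  | nil =>
    intro z u _ _ _
    simp only [fans]
    exact ⟨tendsto_const_nhds, tendsto_const_nhds, fun _ _ _ => tendsto_const_nhds⟩
  | cons t l ih =>
    intro z u hz hu hzu
    have hwt := hl t (by simp)
    obtain ⟨h1, h2, h3⟩ := ih (fun s hs => hl s (by simp [hs])) (fun k => w k t) (v t)
      (fun k => hw k t) (hv t) hwt
    have hEt := hE z (fun k => w k t) u (v t) hz (fun k => hw k t) hu (hv t) hzu hwt
    simp only [fans, linPot_cons, interPot_cons, List.map_cons, List.sum_cons]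
    refine ⟨Tendsto.add (tendsto_finsetSum _ fun i _ => ?_) h1, (h3 _ _ hEt).add h2,
      fun s σ hs => Tendsto.add ?_ (h3 s σ hs)⟩
    · exact ((tendsto_pi_nhds.1 hEt i).abs).const_mul _
    · have h4 : Tendsto (fun k => (s k, E (z k) (w k t))) atTop (𝓝 (σ, E u (v t))) :=
        hs.prodMk_nhds hEt
      have h5 := ((continuous_approach G).tendsto (σ, E u (v t))).comp h4
      simpa only [Function.comp_def] using h5

end sampling

variable {S : Data n} {ρ r C κ : ℝ} {v : ℝ → State n} {w : ℕ → ℝ → State n}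

/-- The part of the weights in the stability functional that is due to `v`. -/
noncomputable def weightPot (S : Data n) (ρ κ : ℝ) (cm cp : Fin n → ℝ) (v : ℝ → State n) (x : ℝ) :
    ℝ :=
  ∑ i, (cm i * S.Aminus ρ v i x + cp i * S.Aplus ρ v i x) + κ * S.Q ρ v

theorem pot_fans_eq_weightPot (hW : IsWellPosed S ρ r C) (hv : IsPiecewiseConstant v)
    (hr : ∀ x, ‖v x‖ ≤ r) {T : Finset ℝ} (hT : jumps v ⊆ T) (x : ℝ) (cm cp : Fin n → ℝ) :
    pot S.GenuinelyNonlinear κ (fans (S.waves ρ) (splitWeight x cm cp) v 0 T.sort)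
      = weightPot S ρ κ cm cp v x := by
  rw [pot, linPot_fans_eq hW hv hr hT, interPot_fans_eq hW hv hr hT, weightPot]

/-- By right continuity `v` keeps its value on a short interval after `t`, which meets `D`. Staying
below the next points of `T` preserves the order of the samples. -/
theorem IsPiecewiseConstant.exists_sample (hv : IsPiecewiseConstant v) {D : Set ℝ} (hD : Dense D)
    (T : Finset ℝ) (t : ℝ) : ∃ y ∈ D, t ≤ y ∧ v y = v t ∧ ∀ s ∈ T, t < s → y < s := by
  have h1 : ∀ᶠ y in 𝓝[>] t, v y = v t :=
    (hv.eventually_right t).filter_mono (nhdsWithin_mono _ Ioi_subset_Ici_self)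
  have h2 : ∀ᶠ y in 𝓝[>] t, ∀ s ∈ T, t < s → y < s := by
    rw [Finset.eventually_all]
    intro s _
    by_cases hs : t < s
    · filter_upwards [Ioo_mem_nhdsGT hs] with y hy _ using hy.2
    · exact Eventually.of_forall fun y h => absurd h hs
  obtain ⟨b, hb, hb'⟩ := (mem_nhdsGT_iff_exists_Ioo_subset).1 (h1.and h2)
  obtain ⟨y, hy, hyD⟩ := hD.exists_mem_open isOpen_Ioo (nonempty_Ioo.2 hb)
  exact ⟨y, hy, hyD.1.le, (hb' hyD).1, (hb' hyD).2⟩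

/-- Lower semicontinuity of the weights. -/
theorem eventually_weightPot_lt (hW : IsWellPosed S ρ r C) (hC : 0 < C) (hκ : 2 * C ≤ κ)
    (hv : IsPiecewiseConstant v) (hr : ∀ x, ‖v x‖ ≤ r) (hw : ∀ k, IsPiecewiseConstant (w k))
    (hwr : ∀ k x, ‖w k x‖ ≤ r) (hsmall : ∀ k, C * (S.V ρ (w k) + 2 * C * S.Q ρ (w k)) ≤ 1 / 2)
    {D : Set ℝ} (hD : Dense D) (hlim : ∀ y ∈ D, Tendsto (fun k => w k y) atTop (𝓝 (v y)))
    {x : ℝ} (hx : x ∈ D) {cm cp : Fin n → ℝ} (hcm : ∀ i, 0 ≤ cm i ∧ cm i ≤ 1)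
    (hcp : ∀ i, 0 ≤ cp i ∧ cp i ≤ 1) {ε : ℝ} (hε : 0 < ε) :
    ∀ᶠ k in atTop, weightPot S ρ κ cm cp v x < weightPot S ρ κ cm cp (w k) x + ε := by
  classical
  set B : Set (State n) := {u | ‖u‖ ≤ r} with hB
  have h0B : (0 : State n) ∈ B := by
    simpa [hB] using (norm_nonneg _).trans (hr 0)
  set T : Finset ℝ := insert x hv.finite_jumps.toFinset with hT
  have hJT : jumps v ⊆ T := fun t ht => by simp [hT, ht]
  have hxT : x ∈ T := by simp [hT]
  -- The point `x`, which lies in `D`, is sampled at itself, since the weights are split there.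
  have hy : ∀ t, ∃ y ∈ D, t ≤ y ∧ v y = v t ∧ (∀ s ∈ T, t < s → y < s) ∧ (t = x → y = x) := by
    intro t
    by_cases htx : t = x
    · exact ⟨t, htx ▸ hx, le_rfl, rfl, fun s _ h => h, fun h => h⟩
    · obtain ⟨y, h1, h2, h3, h4⟩ := IsPiecewiseConstant.exists_sample hv hD T t
      exact ⟨y, h1, h2, h3, h4, fun h => absurd h htx⟩
  choose y hyD hyt hyv hyT hyx using hy
  have hmono : (T.sort.map y).Pairwise (· < ·) := by
    rw [List.pairwise_map]
    refine List.Pairwise.imp_of_mem ?_ (Finset.sortedLT_sort T).pairwise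
    intro a b _ hb hab
    exact (hyT a b (by simpa using hb) hab).trans_le (hyt b)
  have hsort : (T.image y).sort = T.sort.map y := by
    have h1 : (T.sort.map y).toFinset = T.image y := by ext; simp
    rw [← h1, List.toFinset_sort _ (hmono.imp fun h => h.ne)]
    exact hmono.imp fun h => h.le
  have hxY : x ∈ T.image y := Finset.mem_image.2 ⟨x, hxT, hyx x rfl⟩
  have hlv : pot S.GenuinelyNonlinear κ (fans (S.waves ρ) (splitWeight x cm cp) v 0
      (T.image y).sort) = weightPot S ρ κ cm cp v x := by
    rw [← pot_fans_eq_weightPot hW hv hr hJT, hsort, fans_map]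
    congr 1
    refine fans_congr (fun t ht => ⟨?_, hyv t⟩) 0
    have h1 : y t ≤ x ↔ t ≤ x := by
      refine ⟨fun h => (hyt t).trans h, fun h => ?_⟩
      rcases h.eq_or_lt with h | h
      · exact (hyx t h).le
      · exact (hyT t x hxT h).le
    simp only [Function.comp, splitWeight, h1]
  have htend := tendsto_pot_fans (E := S.waves ρ) (B := B) (w := w) (v := v)
    S.GenuinelyNonlinear κ (splitWeight x cm cp) (l := (T.image y).sort) (u := 0)
    (fun a b a' b' ha hb ha' hb' hla hlb => by
      rw [tendsto_iff_norm_sub_tendsto_zero] at hla hlb ⊢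
      refine squeeze_zero (fun _ => norm_nonneg _)
        (fun k => hW.waves_lip _ _ _ _ (ha k) (hb k) ha' hb') ?_
      simpa using (hlb.add hla).const_mul C) hwr hr
    (fun t ht => by
      rw [Finset.mem_sort, Finset.mem_image] at ht
      obtain ⟨s, -, rfl⟩ := ht
      exact hlim _ (hyD s)) h0B
  rw [hlv] at htend
  -- With all the jumps of `w k` added to the sample the potential is exactly its functional;
  -- deleting them again can only decrease it.
  have hle : ∀ k, pot S.GenuinelyNonlinear κ (fans (S.waves ρ) (splitWeight x cm cp) (w k) 0
      (T.image y).sort) ≤ weightPot S ρ κ cm cp (w k) x := by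
    intro k
    have hJk : jumps (w k) ⊆ ((T.image y ∪ (hw k).finite_jumps.toFinset : Finset ℝ) : Set ℝ) :=
      fun t ht => by simp [ht]
    rw [← pot_fans_eq_weightPot hW (hw k) (hwr k) hJk]
    refine pot_sample_le (B := B) hC hκ h0B (hwr k) (fun a ha b hb b' hb' =>
      hW.interaction a b b' ha hb hb') hcm hcp Finset.subset_union_left hxY ?_
    rw [pot, linPot_fans_one _ (fun _ _ => 1), totalStrength_fans_eq hW (hw k) (hwr k) hJk,
      interPot_fans_eq hW (hw k) (hwr k) hJk]
    exact hsmall k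
  filter_upwards [htend.eventually_const_lt (show weightPot S ρ κ cm cp v x - ε < _ by linarith)]
    with k hk
  linarith [hle k]

end Data

/-! ### The integrand: measurability, integrability, pointwise lower semicontinuity. -/

theorem IsPiecewiseConstant.finite_range {n : ℕ} {v : ℝ → State n} (hv : IsPiecewiseConstant v) :
    (range v).Finite := by
  classical
  obtain ⟨N, p, c, -, rfl⟩ := hv
  refine (Set.finite_range fun P : Fin N → Prop => ∑ α, if P α then c α else 0).subset ?_
  rintro _ ⟨y, rfl⟩
  refine ⟨fun α => y ∈ Ico (p α.castSucc) (p α.succ), Finset.sum_congr rfl fun α _ => ?_⟩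
  simp [indicator]

/-- No regularity of `φ` is needed because `v` and `v'` have finite ranges. -/
theorem IsPiecewiseConstant.measurable_comp₂ {n : ℕ} {v v' : ℝ → State n}
    (hv : IsPiecewiseConstant v) (hv' : IsPiecewiseConstant v') (φ : State n → State n → ℝ) :
    Measurable fun x => φ (v x) (v' x) := by
  intro s _
  have h1 : (fun x => φ (v x) (v' x)) ⁻¹' s
      = (fun x => (v x, v' x)) ⁻¹' ({p | φ p.1 p.2 ∈ s} ∩ range v ×ˢ range v') := by
    ext x; simp
  rw [h1]
  exact (hv.measurable.prodMk hv'.measurable)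
    ((hv.finite_range.prod hv'.finite_range).subset inter_subset_right).measurableSet

namespace Data
variable {n : ℕ} {S : Data n} {ρ r C κ κ₁ κ₂ : ℝ} {v v' : ℝ → State n}

theorem Q_le_sq (hW : IsWellPosed S ρ r C) (hv : IsPiecewiseConstant v) (hr : ∀ x, ‖v x‖ ≤ r) :
    S.Q ρ v ≤ S.V ρ v ^ 2 := by
  have hT : jumps v ⊆ hv.finite_jumps.toFinset := by simp
  rw [← interPot_fans_eq hW hv hr hT (fun _ _ => 1), ← totalStrength_fans_eq hW hv hr hT
    (fun _ _ => 1)]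
  exact interPot_le_sq _

/-- The two maps contribute separately, and within each contribution `Q` has the coefficient `κ₂`.
Hence the threshold for `κ₂` is independent of `κ₁`. -/
theorem W_eq (S : Data n) (ρ κ₁ κ₂ : ℝ) (v v' : ℝ → State n) (i : Fin n) (q x : ℝ) :
    S.W ρ κ₁ κ₂ v v' i q x = 1 + κ₁ * (weightPot S ρ κ₂ (leftWeight S i q) (rightWeight S i q) v x
      + weightPot S ρ κ₂ (leftWeight S i (-q)) (rightWeight S i (-q)) v' x) := by
  rw [W, weightPot, weightPot, A_eq_sum, A_eq_sum]
  ring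

theorem weightPot_nonneg (hκ : 0 ≤ κ) (i : Fin n) (q x : ℝ) :
    0 ≤ weightPot S ρ κ (leftWeight S i q) (rightWeight S i q) v x :=
  add_nonneg (Finset.sum_nonneg fun j _ => add_nonneg
    (mul_nonneg (leftWeight_mem S i q j).1 (Aminus_nonneg _ _ _ _ _))
    (mul_nonneg (rightWeight_mem S i q j).1 (Aplus_nonneg _ _ _ _ _)))
    (mul_nonneg hκ (Q_nonneg _ _ _))

theorem integrand_nonneg (hκ₁ : 0 ≤ κ₁) (hκ₂ : 0 ≤ κ₂) (i : Fin n) (x : ℝ) :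
    0 ≤ S.integrand ρ κ₁ κ₂ v v' i x := by
  rw [integrand, W_eq]
  have := weightPot_nonneg (S := S) (ρ := ρ) (v := v) hκ₂ i (S.shocks ρ (v x) (v' x) i) x
  have := weightPot_nonneg (S := S) (ρ := ρ) (v := v') hκ₂ i (-S.shocks ρ (v x) (v' x) i) x
  positivity

theorem Aminus_eq_sum (hW : IsWellPosed S ρ r C) (hr : ∀ x, ‖v x‖ ≤ r) {T : Finset ℝ}
    (hT : jumps v ⊆ T) (j : Fin n) (x : ℝ) :
    S.Aminus ρ v j x = ∑ t ∈ T, if t ≤ x then |S.σ ρ v t j| else 0 :=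
  finsum_mem_jumps hT (fun t => t ≤ x) fun t ht => by rw [hW.σ_eq_zero hr ht, abs_zero]

theorem Aplus_eq_sum (hW : IsWellPosed S ρ r C) (hr : ∀ x, ‖v x‖ ≤ r) {T : Finset ℝ}
    (hT : jumps v ⊆ T) (j : Fin n) (x : ℝ) :
    S.Aplus ρ v j x = ∑ t ∈ T, if x < t then |S.σ ρ v t j| else 0 :=
  finsum_mem_jumps hT (fun t => x < t) fun t ht => by rw [hW.σ_eq_zero hr ht, abs_zero]

theorem measurable_Aminus (hW : IsWellPosed S ρ r C) (hv : IsPiecewiseConstant v)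
    (hr : ∀ x, ‖v x‖ ≤ r) (j : Fin n) : Measurable (S.Aminus ρ v j) := by
  have hT : jumps v ⊆ hv.finite_jumps.toFinset := by simp
  simp only [funext (Aminus_eq_sum hW hr hT j)]
  exact Finset.measurable_sum _ fun t _ => Measurable.ite measurableSet_Ici measurable_const
    measurable_const

theorem measurable_Aplus (hW : IsWellPosed S ρ r C) (hv : IsPiecewiseConstant v)
    (hr : ∀ x, ‖v x‖ ≤ r) (j : Fin n) : Measurable (S.Aplus ρ v j) := by
  have hT : jumps v ⊆ hv.finite_jumps.toFinset := by simp
  simp only [funext (Aplus_eq_sum hW hr hT j)]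
  exact Finset.measurable_sum _ fun t _ => Measurable.ite measurableSet_Iio measurable_const
    measurable_const

theorem exists_weightPot_le (hW : IsWellPosed S ρ r C) (hv : IsPiecewiseConstant v)
    (hr : ∀ x, ‖v x‖ ≤ r) (κ : ℝ) :
    ∃ M, ∀ i q x, weightPot S ρ κ (leftWeight S i q) (rightWeight S i q) v x ≤ M := by
  have hT : jumps v ⊆ hv.finite_jumps.toFinset := by simp
  set m := fun j => ∑ t ∈ hv.finite_jumps.toFinset, |S.σ ρ v t j| with hm
  have h1 : ∀ j x, S.Aminus ρ v j x ≤ m j := fun j x => by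
    rw [Aminus_eq_sum hW hr hT]
    refine Finset.sum_le_sum fun t _ => ?_
    split_ifs
    · exact le_rfl
    · exact abs_nonneg _
  have h2 : ∀ j x, S.Aplus ρ v j x ≤ m j := fun j x => by
    rw [Aplus_eq_sum hW hr hT]
    refine Finset.sum_le_sum fun t _ => ?_
    split_ifs
    · exact le_rfl
    · exact abs_nonneg _
  refine ⟨∑ j, (m j + m j) + κ * S.Q ρ v, fun i q x => ?_⟩
  refine add_le_add_left (Finset.sum_le_sum fun j _ => add_le_add ?_ ?_) _
  · exact (mul_le_of_le_one_left (Aminus_nonneg _ _ _ _ _) (leftWeight_mem S i q j).2).trans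
      (h1 j x)
  · exact (mul_le_of_le_one_left (Aplus_nonneg _ _ _ _ _) (rightWeight_mem S i q j).2).trans
      (h2 j x)

theorem measurable_integrand (hW : IsWellPosed S ρ r C) (hv : IsPiecewiseConstant v)
    (hv' : IsPiecewiseConstant v') (hr : ∀ x, ‖v x‖ ≤ r) (hr' : ∀ x, ‖v' x‖ ≤ r) (κ₁ κ₂ : ℝ)
    (i : Fin n) : Measurable (S.integrand ρ κ₁ κ₂ v v' i) := by
  unfold integrand
  simp only [W_eq, weightPot]
  have m1 := fun j => measurable_Aminus hW hv hr j
  have m2 := fun j => measurable_Aplus hW hv hr j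
  have m3 := fun j => measurable_Aminus hW hv' hr' j
  have m4 := fun j => measurable_Aplus hW hv' hr' j
  have m5 := hv.measurable_comp₂ hv' fun a b => S.shocks ρ a b i
  have m6 := fun j => hv.measurable_comp₂ hv' fun a b => leftWeight S i (S.shocks ρ a b i) j
  have m7 := fun j => hv.measurable_comp₂ hv' fun a b => rightWeight S i (S.shocks ρ a b i) j
  have m8 := fun j => hv.measurable_comp₂ hv' fun a b => leftWeight S i (-S.shocks ρ a b i) j
  have m9 := fun j => hv.measurable_comp₂ hv' fun a b => rightWeight S i (-S.shocks ρ a b i) j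
  refine (continuous_abs.measurable.comp m5).mul
    (measurable_const.add (measurable_const.mul (Measurable.add ?_ ?_)))
  · exact (Finset.measurable_sum _ fun j _ => ((m6 j).mul (m1 j)).add
      ((m7 j).mul (m2 j))).add measurable_const
  · exact (Finset.measurable_sum _ fun j _ => ((m8 j).mul (m3 j)).add
      ((m9 j).mul (m4 j))).add measurable_const

theorem integrable_integrand (hW : IsWellPosed S ρ r C) (hv : IsPiecewiseConstant v)
    (hv' : IsPiecewiseConstant v') (hr : ∀ x, ‖v x‖ ≤ r) (hr' : ∀ x, ‖v' x‖ ≤ r) (hκ₁ : 0 ≤ κ₁)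
    (hκ₂ : 0 ≤ κ₂) (i : Fin n) : Integrable (S.integrand ρ κ₁ κ₂ v v' i) := by
  obtain ⟨M, hM⟩ := exists_weightPot_le hW hv hr κ₂
  obtain ⟨M', hM'⟩ := exists_weightPot_le hW hv' hr' κ₂
  obtain ⟨a, b, hab⟩ := hv.exists_support
  obtain ⟨a', b', hab'⟩ := hv'.exists_support
  refine Integrable.mono' (g := (Icc (min a a') (max b b')).indicator
    fun _ => ρ * (1 + κ₁ * (M + M'))) ?_
    (measurable_integrand hW hv hv' hr hr' κ₁ κ₂ i).aestronglyMeasurable (ae_of_all _ fun x => ?_)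
  · exact (integrable_indicator_iff measurableSet_Icc).2 (integrableOn_const (by simp))
  · rw [Real.norm_of_nonneg (integrand_nonneg hκ₁ hκ₂ i x)]
    by_cases hx : x ∈ Icc (min a a') (max b b')
    · rw [indicator_of_mem hx, integrand, W_eq]
      have h1 := (shocks_spec (hW.shock _ _ (hr x) (hr' x)).exists).1 i
      have h2 := hM i (S.shocks ρ (v x) (v' x) i) x
      have h3 := hM' i (-S.shocks ρ (v x) (v' x) i) x
      have h4 := weightPot_nonneg (S := S) (ρ := ρ) (v := v) hκ₂ i (S.shocks ρ (v x) (v' x) i) x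
      have h5 := weightPot_nonneg (S := S) (ρ := ρ) (v := v') hκ₂ i
        (-S.shocks ρ (v x) (v' x) i) x
      have h6 := (abs_nonneg _).trans h1.le
      gcongr
    · have h1 : x ∉ Ico a b := fun h => hx ⟨(min_le_left _ _).trans h.1,
        h.2.le.trans (le_max_left _ _)⟩
      have h2 : x ∉ Ico a' b' := fun h => hx ⟨(min_le_right _ _).trans h.1,
        h.2.le.trans (le_max_right _ _)⟩
      rw [indicator_of_notMem hx, integrand, hab x h1, hab' x h2,
        hW.shocks_self 0 (by simpa using (norm_nonneg _).trans (hr 0))]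
      simp

theorem leftWeight_congr (i : Fin n) {q q' : ℝ} (h : 0 ≤ q ↔ 0 ≤ q') :
    leftWeight S i q = leftWeight S i q' := by
  classical
  funext j
  unfold leftWeight
  exact if_congr (by rw [h]) rfl rfl

theorem rightWeight_congr (i : Fin n) {q q' : ℝ} (h : 0 ≤ q ↔ 0 ≤ q') :
    rightWeight S i q = rightWeight S i q' := by
  classical
  funext j
  unfold rightWeight
  exact if_congr (by rw [h]) rfl rfl

/-- Pointwise lower semicontinuity of the integrand. -/
theorem eventually_integrand_lt (hW : IsWellPosed S ρ r C) (hC : 0 < C) (hκ₁ : 0 < κ₁)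
    (hκ₂ : 2 * C ≤ κ₂)
    (hv : IsPiecewiseConstant v) (hr : ∀ x, ‖v x‖ ≤ r)
    (hv' : IsPiecewiseConstant v') (hr' : ∀ x, ‖v' x‖ ≤ r) {w w' : ℕ → ℝ → State n}
    (hw : ∀ k, IsPiecewiseConstant (w k)) (hwr : ∀ k x, ‖w k x‖ ≤ r)
    (hsmall : ∀ k, C * (S.V ρ (w k) + 2 * C * S.Q ρ (w k)) ≤ 1 / 2)
    (hw' : ∀ k, IsPiecewiseConstant (w' k)) (hwr' : ∀ k x, ‖w' k x‖ ≤ r)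
    (hsmall' : ∀ k, C * (S.V ρ (w' k) + 2 * C * S.Q ρ (w' k)) ≤ 1 / 2)
    {D : Set ℝ} (hD : Dense D) (hlim : ∀ y ∈ D, Tendsto (fun k => w k y) atTop (𝓝 (v y)))
    (hlim' : ∀ y ∈ D, Tendsto (fun k => w' k y) atTop (𝓝 (v' y)))
    {x : ℝ} (hx : x ∈ D) (i : Fin n) {ε : ℝ} (hε : 0 < ε) :
    ∀ᶠ k in atTop, S.integrand ρ κ₁ κ₂ v v' i x < S.integrand ρ κ₁ κ₂ (w k) (w' k) i x + ε := by
  have hκ₂0 : 0 ≤ κ₂ := by linarith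
  set q := S.shocks ρ (v x) (v' x) i with hq
  have hqlim : Tendsto (fun k => S.shocks ρ (w k x) (w' k x) i) atTop (𝓝 q) := by
    suffices H : Tendsto (fun k => S.shocks ρ (w k x) (w' k x)) atTop
        (𝓝 (S.shocks ρ (v x) (v' x))) from tendsto_pi_nhds.1 H i
    have h1 := hlim x hx
    have h2 := hlim' x hx
    rw [tendsto_iff_norm_sub_tendsto_zero] at h1 h2 ⊢
    refine squeeze_zero (fun _ => norm_nonneg _)
      (fun k => hW.shocks_lip _ _ _ _ (hwr k x) (hwr' k x) (hr x) (hr' x)) ?_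
    simpa using (h2.add h1).const_mul C
  -- The weight may be discontinuous in `q` at `0`, but there the factor `|q|` vanishes.
  by_cases hq0 : q = 0
  · refine Eventually.of_forall fun k => ?_
    have h1 := integrand_nonneg (S := S) (ρ := ρ) (v := w k) (v' := w' k) hκ₁.le hκ₂0 i x
    rw [integrand, ← hq, hq0, abs_zero, zero_mul]
    linarith
  · have hsign : ∀ᶠ k in atTop, (0 ≤ q ↔ 0 ≤ S.shocks ρ (w k x) (w' k x) i) ∧
        (0 ≤ -q ↔ 0 ≤ -S.shocks ρ (w k x) (w' k x) i) := by
      rcases lt_or_gt_of_ne hq0 with h | h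
      · filter_upwards [hqlim.eventually_lt_const h] with k hk
        constructor <;> constructor <;> intro _ <;> linarith
      · filter_upwards [hqlim.eventually_const_lt h] with k hk
        constructor <;> constructor <;> intro _ <;> linarith
    -- Chosen so that the total loss `|q| * κ₁ * (2 * ε')` is strictly less than `ε`.
    set ε' := ε / (2 * κ₁ * (|q| + 1)) with hε'
    have hε'0 : 0 < ε' := by positivity
    have e1 := eventually_weightPot_lt hW hC hκ₂ hv hr hw hwr hsmall hD hlim hx
      (leftWeight_mem S i q) (rightWeight_mem S i q) hε'0
    have e2 := eventually_weightPot_lt hW hC hκ₂ hv' hr' hw' hwr' hsmall' hD hlim' hx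
      (leftWeight_mem S i (-q)) (rightWeight_mem S i (-q)) hε'0
    set P := weightPot S ρ κ₂ (leftWeight S i q) (rightWeight S i q) v x
    set P' := weightPot S ρ κ₂ (leftWeight S i (-q)) (rightWeight S i (-q)) v' x
    have e3 : ∀ᶠ k in atTop, |q| * (1 + κ₁ * (P + P')) - ε
        < |S.shocks ρ (w k x) (w' k x) i| * (1 + κ₁ * (P + P' - 2 * ε')) := by
      have h1 : Tendsto (fun k => |S.shocks ρ (w k x) (w' k x) i| * (1 + κ₁ * (P + P' - 2 * ε')))
          atTop (𝓝 (|q| * (1 + κ₁ * (P + P' - 2 * ε')))) := hqlim.abs.mul_const _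
      refine h1.eventually_const_lt ?_
      have h2 : |q| * (κ₁ * (2 * ε')) < ε := by
        have : |q| * (κ₁ * (2 * ε')) = ε * (|q| / (|q| + 1)) := by rw [hε']; field_simp
        rw [this]
        have : |q| / (|q| + 1) < 1 := by rw [div_lt_one (by positivity)]; linarith
        nlinarith
      nlinarith
    filter_upwards [hsign, e1, e2, e3] with k h1 h2 h3 h4
    rw [integrand, integrand, W_eq, W_eq, ← hq, ← leftWeight_congr i h1.1,
      ← rightWeight_congr i h1.1, ← leftWeight_congr i h1.2, ← rightWeight_congr i h1.2]
    have h5 : |S.shocks ρ (w k x) (w' k x) i| * (1 + κ₁ * (P + P' - 2 * ε'))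
        ≤ |S.shocks ρ (w k x) (w' k x) i| * (1 + κ₁ * (
          weightPot S ρ κ₂ (leftWeight S i q) (rightWeight S i q) (w k) x
          + weightPot S ρ κ₂ (leftWeight S i (-q)) (rightWeight S i (-q)) (w' k) x)) := by
      gcongr
      linarith
    linarith

end Data
-- Lower semicontinuity of `Phi` and the relaxed functional.
namespace Data
variable {n : ℕ} {S : Data n} {ρ r C C₀ δ κ₁ κ₂ : ℝ} {u u' v v' : ℝ → State n}

theorem Phi_nonneg (hκ₁ : 0 ≤ κ₁) (hκ₂ : 0 ≤ κ₂) : 0 ≤ S.Phi ρ κ₁ κ₂ v v' :=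
  Finset.sum_nonneg fun i _ => integral_nonneg fun x => integrand_nonneg hκ₁ hκ₂ i x

theorem lintegral_sum_integrand (hW : IsWellPosed S ρ r C) (hv : IsPiecewiseConstant v)
    (hv' : IsPiecewiseConstant v') (hr : ∀ x, ‖v x‖ ≤ r) (hr' : ∀ x, ‖v' x‖ ≤ r) (hκ₁ : 0 ≤ κ₁)
    (hκ₂ : 0 ≤ κ₂) :
    ∫⁻ x, ENNReal.ofReal (∑ i, S.integrand ρ κ₁ κ₂ v v' i x)
      = ENNReal.ofReal (S.Phi ρ κ₁ κ₂ v v') := by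
  have hint := fun i => integrable_integrand hW hv hv' hr hr' hκ₁ hκ₂ i
  rw [Phi, ← integral_finsetSum _ fun i _ => hint i, ofReal_integral_eq_lintegral_ofReal
    (integrable_finsetSum _ fun i _ => hint i)
    (ae_of_all _ fun x => Finset.sum_nonneg fun i _ => integrand_nonneg hκ₁ hκ₂ i x)]

theorem exists_subseq_tendsto_ae (hv : IsPiecewiseConstant v) {w : ℕ → ℝ → State n}
    (hw : ∀ k, IsPiecewiseConstant (w k))
    (h : Tendsto (fun k => eLpNorm (fun x => w k x - v x) 1 volume) atTop (𝓝 0)) :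
    ∃ φ : ℕ → ℕ, StrictMono φ ∧ ∀ᵐ x, Tendsto (fun k => w (φ k) x) atTop (𝓝 (v x)) :=
  (tendstoInMeasure_of_tendsto_eLpNorm one_ne_zero
    (fun k => (hw k).measurable.aestronglyMeasurable)
    hv.measurable.aestronglyMeasurable h).exists_seq_tendsto_ae

/-- Lower semicontinuity of `Phi` with respect to the `L¹` convergence. -/
theorem exists_Phi_lt (hW : IsWellPosed S ρ r C) (hC : 0 < C) (hC₀ : 0 < C₀)
    (hδr : C * δ ≤ r) (hδC : C * (δ + 2 * C * δ ^ 2) ≤ 1 / 2) (hκ₁ : 0 < κ₁) (hκ₂ : 2 * C ≤ κ₂)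
    (hu : u ∈ S.Dstar ρ C₀ δ) (hu' : u' ∈ S.Dstar ρ C₀ δ) {ε : ℝ} (hε : 0 < ε) :
    ∃ η > 0, ∀ v ∈ S.B ρ C₀ δ η u, ∀ v' ∈ S.B ρ C₀ δ η u',
      S.Phi ρ κ₁ κ₂ u u' - ε ≤ S.Phi ρ κ₁ κ₂ v v' := by
  have hκ₂0 : 0 ≤ κ₂ := by linarith
  have hball : ∀ v ∈ S.Dstar ρ C₀ δ, ∀ x, ‖v x‖ ≤ r := fun v hv =>
    norm_le_of_mem_Dstar hW hC hC₀ hδr hv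
  have hsm : ∀ v ∈ S.Dstar ρ C₀ δ, C * (S.V ρ v + 2 * C * S.Q ρ v) ≤ 1 / 2 := by
    intro v hv
    have h1 := (V_lt_of_mem_Dstar hC₀ hv).le
    have h2 := Q_le_sq hW hv.1 (hball v hv)
    have h3 : 0 ≤ S.V ρ v := finsum_nonneg fun _ => finsum_nonneg fun _ =>
      Finset.sum_nonneg fun _ _ => abs_nonneg _
    refine le_trans ?_ hδC
    gcongr
    exact h2.trans (by gcongr)
  by_contra! hcon
  choose! w hw w' hw' hlt using fun k : ℕ => hcon (1 / ((k : ℝ) + 1)) (by positivity)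
  have hzero : ∀ (z : ℕ → ℝ → State n) (v : ℝ → State n),
      (∀ k : ℕ, z k ∈ S.B ρ C₀ δ (1 / ((k : ℝ) + 1)) v) →
      Tendsto (fun k => eLpNorm (fun x => z k x - v x) 1 volume) atTop (𝓝 0) := by
    intro z v hz
    refine tendsto_of_tendsto_of_tendsto_of_le_of_le tendsto_const_nhds
      (h := fun k : ℕ => ENNReal.ofReal (1 / ((k : ℝ) + 1))) ?_ (fun _ => zero_le) fun k =>
      (hz k).2.le
    simpa using ENNReal.tendsto_ofReal tendsto_one_div_add_atTop_nhds_zero_nat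
  obtain ⟨φ, hφ, hae⟩ := exists_subseq_tendsto_ae hu.1 (fun k => (hw k).1.1) (hzero w u hw)
  obtain ⟨φ', hφ', hae'⟩ := exists_subseq_tendsto_ae hu'.1 (fun k => (hw' (φ k)).1.1)
    ((hzero w' u' hw').comp hφ.tendsto_atTop)
  set z := fun k => w (φ (φ' k)) with hz
  set z' := fun k => w' (φ (φ' k)) with hz'
  have hzD : ∀ k, z k ∈ S.Dstar ρ C₀ δ := fun k => (hw _).1
  have hzD' : ∀ k, z' k ∈ S.Dstar ρ C₀ δ := fun k => (hw' _).1
  have hlim : ∀ᵐ x, Tendsto (fun k => z k x) atTop (𝓝 (u x)) ∧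
      Tendsto (fun k => z' k x) atTop (𝓝 (u' x)) := by
    filter_upwards [hae, hae'] with x h1 h2
    exact ⟨h1.comp hφ'.tendsto_atTop, h2⟩
  -- Almost everywhere convergence gives a dense set of common convergence, from which the sample
  -- points are taken.
  have hdense := Measure.dense_of_ae hlim
  have hpt : ∀ᵐ x, ENNReal.ofReal (∑ i, S.integrand ρ κ₁ κ₂ u u' i x)
      ≤ liminf (fun k => ENNReal.ofReal (∑ i, S.integrand ρ κ₁ κ₂ (z k) (z' k) i x)) atTop := by
    filter_upwards [hlim] with x hx
    refine le_of_forall_lt fun a ha => ?_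
    obtain ⟨b, hab, hb⟩ := exists_between ha
    refine hab.trans_le (le_liminf_of_le (by isBoundedDefault) ?_)
    have hbtop : b ≠ ⊤ := hb.ne_top
    have hb' : b.toReal < ∑ i, S.integrand ρ κ₁ κ₂ u u' i x :=
      (ENNReal.lt_ofReal_iff_toReal_lt hbtop).1 hb
    set g := (∑ i, S.integrand ρ κ₁ κ₂ u u' i x) - b.toReal with hg
    have hg0 : 0 < g := sub_pos.2 hb'
    have hev : ∀ᶠ k in atTop, ∀ i, S.integrand ρ κ₁ κ₂ u u' i x
        < S.integrand ρ κ₁ κ₂ (z k) (z' k) i x + g / (n + 1) :=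
      eventually_all.2 fun i => eventually_integrand_lt hW hC hκ₁ hκ₂ hu.1 (hball u hu) hu'.1
        (hball u' hu') (fun k => (hzD k).1) (fun k => hball _ (hzD k)) (fun k => hsm _ (hzD k))
        (fun k => (hzD' k).1) (fun k => hball _ (hzD' k)) (fun k => hsm _ (hzD' k)) hdense
        (fun y hy => hy.1) (fun y hy => hy.2) hx i (by positivity)
    filter_upwards [hev] with k hk
    rw [ENNReal.le_ofReal_iff_toReal_le hbtop
      (Finset.sum_nonneg fun i _ => integrand_nonneg hκ₁.le hκ₂0 i x)]
    have h1 := Finset.sum_le_sum fun i (_ : i ∈ Finset.univ) => (hk i).le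
    rw [Finset.sum_add_distrib, Finset.sum_const, Finset.card_univ, Fintype.card_fin,
      nsmul_eq_mul] at h1
    have h2 : (n : ℝ) * (g / (n + 1)) ≤ g := by
      rw [mul_div_assoc', div_le_iff₀ (by positivity)]
      nlinarith
    linarith
  have hmeas : ∀ k, Measurable fun x =>
      ENNReal.ofReal (∑ i, S.integrand ρ κ₁ κ₂ (z k) (z' k) i x) := fun k =>
    (Finset.measurable_sum _ fun i _ => measurable_integrand hW (hzD k).1 (hzD' k).1
      (hball _ (hzD k)) (hball _ (hzD' k)) κ₁ κ₂ i).ennreal_ofReal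
  have h1 := (lintegral_mono_ae hpt).trans (lintegral_liminf_le hmeas)
  rw [lintegral_sum_integrand hW hu.1 hu'.1 (hball u hu) (hball u' hu') hκ₁.le hκ₂0] at h1
  simp only [fun k => lintegral_sum_integrand hW (hzD k).1 (hzD' k).1 (hball _ (hzD k))
    (hball _ (hzD' k)) hκ₁.le hκ₂0] at h1
  have h2 : liminf (fun k => ENNReal.ofReal (S.Phi ρ κ₁ κ₂ (z k) (z' k))) atTop
      ≤ ENNReal.ofReal (S.Phi ρ κ₁ κ₂ u u' - ε) :=
    liminf_le_of_le (by isBoundedDefault) fun b hb => by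
      obtain ⟨k, hk⟩ := hb.exists
      exact hk.trans (ENNReal.ofReal_le_ofReal (hlt _).le)
  have h3 := h1.trans h2
  -- Needed since `ENNReal.ofReal` truncates at `0`; it follows from `Phi ≥ 0` along the assumed
  -- counterexample.
  have h4 : 0 ≤ S.Phi ρ κ₁ κ₂ u u' - ε :=
    (Phi_nonneg (S := S) (ρ := ρ) (v := w 0) (v' := w' 0) hκ₁.le hκ₂0).trans (hlt 0).le
  rw [ENNReal.ofReal_le_ofReal_iff h4] at h3
  linarith

/-- For small `η` the infimum is squeezed between `Phi - ε`, by `hlsc`, and `Phi`, because `u` and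
`u'` are competitors. Nonnegativity of `Phi` makes the real infimum a genuine one. -/
theorem tendsto_XiEta (hκ₁ : 0 ≤ κ₁) (hκ₂ : 0 ≤ κ₂) (hu : u ∈ S.Dstar ρ C₀ δ)
    (hu' : u' ∈ S.Dstar ρ C₀ δ)
    (hlsc : ∀ ε > 0, ∃ η > 0, ∀ v ∈ S.B ρ C₀ δ η u, ∀ v' ∈ S.B ρ C₀ δ η u',
      S.Phi ρ κ₁ κ₂ u u' - ε ≤ S.Phi ρ κ₁ κ₂ v v') :
    Tendsto (fun η => S.XiEta ρ C₀ δ κ₁ κ₂ η u u') (𝓝[>] 0) (𝓝 (S.Xi ρ C₀ δ κ₁ κ₂ u u')) ∧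
      S.Xi ρ C₀ δ κ₁ κ₂ u u' = S.Phi ρ κ₁ κ₂ u u' := by
  have hself : ∀ (v : ℝ → State n) (η : ℝ), v ∈ S.Dstar ρ C₀ δ → 0 < η → v ∈ S.B ρ C₀ δ η v :=
    fun v η hv hη => ⟨hv, by simpa using hη⟩
  have hle : ∀ η > 0, S.XiEta ρ C₀ δ κ₁ κ₂ η u u' ≤ S.Phi ρ κ₁ κ₂ u u' := fun η hη =>
    csInf_le ⟨0, by rintro _ ⟨v, -, v', -, rfl⟩; exact Phi_nonneg hκ₁ hκ₂⟩
      ⟨u, hself u η hu hη, u', hself u' η hu' hη, rfl⟩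
  have hge : ∀ ε > 0, ∃ η > 0, ∀ η' > 0, η' ≤ η →
      S.Phi ρ κ₁ κ₂ u u' - ε ≤ S.XiEta ρ C₀ δ κ₁ κ₂ η' u u' := by
    intro ε hε
    obtain ⟨η, hη, h⟩ := hlsc ε hε
    refine ⟨η, hη, fun η' hη' hle => le_csInf
      ⟨_, u, hself u η' hu hη', u', hself u' η' hu' hη', rfl⟩ ?_⟩
    rintro _ ⟨v, hv, v', hv', rfl⟩
    exact h v ⟨hv.1, hv.2.trans_le (ENNReal.ofReal_le_ofReal hle)⟩ v'
      ⟨hv'.1, hv'.2.trans_le (ENNReal.ofReal_le_ofReal hle)⟩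
  have hXi : S.Xi ρ C₀ δ κ₁ κ₂ u u' = S.Phi ρ κ₁ κ₂ u u' := by
    have : Nonempty {η : ℝ // 0 < η} := ⟨⟨1, one_pos⟩⟩
    refine le_antisymm (ciSup_le fun η => hle η η.2) (le_of_forall_pos_sub_le fun ε hε => ?_)
    obtain ⟨η, hη, h⟩ := hge ε hε
    refine (h η hη le_rfl).trans (le_ciSup (f := fun η : {η : ℝ // 0 < η} =>
      S.XiEta ρ C₀ δ κ₁ κ₂ η u u') ⟨S.Phi ρ κ₁ κ₂ u u', ?_⟩ ⟨η, hη⟩)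
    rintro _ ⟨η, rfl⟩
    exact hle η η.2
  refine ⟨?_, hXi⟩
  rw [hXi, Metric.tendsto_nhdsWithin_nhds]
  intro ε hε
  obtain ⟨η, hη, h⟩ := hge (ε / 2) (by positivity)
  refine ⟨η, hη, fun η' hη' hd => ?_⟩
  have hη'0 : 0 < η' := hη'
  rw [Real.dist_eq, sub_zero, abs_of_pos hη'0] at hd
  rw [Real.dist_eq, abs_lt]
  constructor <;> linarith [h η' hη'0 hd.le, hle η' hη'0]

end Data
end ConsLaw

theorem mainTheorem6 {n : ℕ} (S : ConsLaw.Data n) (hS : S.Admissible) (hN : S.Normalized) :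
    ∃ ρ₀ > 0, ∃ K > 0, ∀ ρ : ℝ, 0 < ρ → ρ < ρ₀ →
      ∃ δ₀ > 0, ∀ δ : ℝ, 0 < δ → δ < δ₀ →
        ∀ C₀ κ₁ κ₂ : ℝ, 0 < C₀ → 0 < κ₁ → K ≤ κ₂ →
          ∀ u ∈ S.Dstar ρ C₀ δ, ∀ u' ∈ S.Dstar ρ C₀ δ,
            (∀ x, ∃! s, S.SolvesRiemann ρ (Function.leftLim u x) (u x) s) ∧
            (∀ x, ∃! q, S.SolvesShock ρ (u x) (u' x) q) ∧
            (∀ i, Integrable (S.integrand ρ κ₁ κ₂ u u' i) volume) ∧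
            Tendsto (fun η => S.XiEta ρ C₀ δ κ₁ κ₂ η u u') (𝓝[>] 0)
              (𝓝 (S.Xi ρ C₀ δ κ₁ κ₂ u u')) ∧
            S.Xi ρ C₀ δ κ₁ κ₂ u u' = S.Phi ρ κ₁ κ₂ u u' := by
  obtain ⟨ρ₀, hρ₀, C, hC, hwell⟩ := ConsLaw.Data.exists_isWellPosed hS hN
  refine ⟨ρ₀, hρ₀, 2 * C, by positivity, fun ρ hρ hρlt => ?_⟩
  obtain ⟨r, hr, hW⟩ := hwell ρ hρ hρlt
  -- The first bound confines the states to the ball of radius `r`. The others give `C (δ + 2 C δ²)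
  -- ≤ 1 / 2`, which, as `V < δ` and `Q ≤ V²`, is the smallness required by the merging argument.
  refine ⟨min (r / C) (min 1 (1 / (2 * C * (1 + 2 * C)))), by positivity,
    fun δ hδ hδlt C₀ κ₁ κ₂ hC₀ hκ₁ hκ₂ u hu u' hu' => ?_⟩
  rw [lt_min_iff, lt_min_iff, lt_div_iff₀ hC, lt_div_iff₀ (by positivity)] at hδlt
  obtain ⟨h1, h2, h3⟩ := hδlt
  have hδr : C * δ ≤ r := by linarith
  have hδC : C * (δ + 2 * C * δ ^ 2) ≤ 1 / 2 := by
    have : C * (2 * C * δ ^ 2) ≤ C * (2 * C * (δ * 1)) := by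
      rw [sq]; gcongr
    linarith
  have hκ₂0 : 0 ≤ κ₂ := by linarith
  have hur := ConsLaw.Data.norm_le_of_mem_Dstar hW hC hC₀ hδr hu
  have hur' := ConsLaw.Data.norm_le_of_mem_Dstar hW hC hC₀ hδr hu'
  exact ⟨fun x => hW.riemann _ _ (ConsLaw.Data.norm_leftLim_le hu.1 hur x) (hur x),
    fun x => hW.shock _ _ (hur x) (hur' x),
    ConsLaw.Data.integrable_integrand hW hu.1 hu'.1 hur hur' hκ₁.le hκ₂0,
    ConsLaw.Data.tendsto_XiEta hκ₁.le hκ₂0 hu hu' fun ε hε =>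
      ConsLaw.Data.exists_Phi_lt hW hC hC₀ hδr hδC hκ₁ hκ₂ hu hu' hε⟩
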